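/- **Conventions.** Let $k$ be a field. A tensor category is a $k$-linear monoidal category $(\mathcal C,\otimes,\mathbb 1)$ (bilinear tensor product). An *action* of a group $G$ on $\mathcal C$ consists of $k$-linear monoidal autoequivalences $g_*$ of $\mathcal C$ ($g\in G$) and monoidal natural isomorphisms $g_*h_*\cong (gh)_*$ and $1_*\cong \mathrm{id}$ satisfying the usual associativity and unit axioms. The *crossed product* $\mathcal C\rtimes G$ is the $k$-linear monoidal category whose objects are finite formal direct sums of symbols $[V,\sigma]$ ($V\in\mathcal C$, $\sigma\in G$), with $\mathrm{Hom}([V,\sigma],[W,\tau])=\mathrm{Hom}_{\mathcal C}(V,W)$ if $\sigma=\tau$ and $0$ otherwise, with matrices of such morphisms between direct sums, and with tensor product determined by $[V,\sigma]\otimes[W,\tau]=[V\otimes\sigma_*W,\sigma\tau]$ (associator and unitors being those induced by the action and by $\mathcal C$). A function $\pi:Q^4\to k^\times$ lies in $Z^4(Q,k^\times)$ (normalized 4-cocycles, trivial action) if it equals $1$ whenever one of its arguments is $1$ and $$\pi(b,c,d,e)\,\pi(a,bc,d,e)\,\pi(a,b,c,de)=\pi(ab,c,d,e)\,\pi(a,b,cd,e)\,\pi(a,b,c,d).$$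 For monoidal endofunctors $F,G$ of a $k$-linear monoidal category $\mathcal D$, a *pseudonatural isomorphism* $(U,\chi):F\Rightarrow G$ is an invertible object $U\in\mathcal D$ with isomorphisms $\chi_V:F(V)\otimes U\to U\otimes G(V)$ natural in $V$ and compatible with the tensor product and the unit. Vertical composition has object $U\otimes U'$, the whiskering $\mathrm{id}_K\otimes(U,\chi)$ has object $K(U)$, and $(U,\chi)\otimes \mathrm{id}_H$ has object $U$. An invertible *modification* $(U,\chi)\Rrightarrow(U',\chi')$ is an isomorphism $U\to U'$ commuting with $\chi,\chi'$. A *$\pi$-anomalous action* of $Q$ on $\mathcal D$ is a $k^\times$-linear monoidal 2-functor from the 3-group of $(Q,k^\times,\pi)$ to the 3-group $2\text{-}\mathrm{Aut}_\otimes(\mathcal D)$ of $k$-linear monoidal autoequivalences, pseudonatural isomorphisms and invertible modifications. Explicitly, it consists of $k$-linear monoidal autoequivalences $F_q$, pseudonatural isomorphisms $(U_{q,r},\chi_{q,r}):F_qF_r\Rightarrow F_{qr}$ and $\mathrm{id}\Rightarrow F_1$, invertible modifications $$\omega_{q,r,s}:\chi_{q,rs}\circ(\mathrm{id}_{F_q}\otimes\chi_{r,s})\Rrightarrow\chi_{qr,s}\circ(\chi_{q,r}\otimes\mathrm{id}_{F_s}),$$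 and invertible modifications comparing $\chi_{1,q}$ and $\chi_{q,1}$, precomposed with the unit, with $\mathrm{id}_{F_q}$, subject to the unit axiom and to the associativity axiom that the composite $$F_qF_r(U_{s,t})\otimes F_q(U_{r,st})\otimes U_{q,rst}\longrightarrow U_{q,r}\otimes U_{qr,s}\otimes U_{qrs,t}$$ of $F_q(\omega_{r,s,t})$, $\omega_{q,rs,t}$, $\omega_{q,r,s}$ is $\pi(q,r,s,t)$ times the composite of $\omega_{q,r,st}$, $\chi_{q,r}(U_{s,t})$, $\omega_{qr,s,t}$. **Statement.** Let $n>1$, let $F_n$ be the free group of rank $n$, let $Q$ be a finite group and let $\rho:F_n\to Q$ be a surjective homomorphism. Put $m=|Q|(n-1)+1$. Let $\mathcal C$ be a $k$-linear monoidal category with an action of $F_n$, and let $\pi\in Z^4(Q,k^\times)$. Then $\ker\rho$ is isomorphic to the free group $F_m$ of rank $m$, and for every isomorphism $F_m\cong\ker\rho$, with $F_m$ acting on $\mathcal C$ by restriction of the $F_n$-action along $F_m\cong\ker\rho\subseteq F_n$, there exists a $\pi$-anomalous action of $Q$ on $\mathcal C\rtimes F_m$. -/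

import Mathlib

open CategoryTheory CategoryTheory.MonoidalCategory

universe w v u

/-- A `k`-linear (strong) monoidal autoequivalence of a `k`-linear monoidal category `C`. -/
structure LinearMonoidalAutoequiv (k : Type w) [Field k] (C : Type u) [Category.{v} C]
    [Preadditive C] [Linear k C] [MonoidalCategory C] where
  functor : C ⥤ C
  [monoidal : functor.Monoidal]
  [additive : functor.Additive]
  [linear : functor.Linear k]
  [isEquivalence : functor.IsEquivalence]

attribute [instance] LinearMonoidalAutoequiv.monoidal LinearMonoidalAutoequiv.additive
  LinearMonoidalAutoequiv.linear LinearMonoidalAutoequiv.isEquivalence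

/-- The identity `F a = F b` for `a = b`, as an isomorphism of functors. -/
def LinearMonoidalAutoequiv.castIso {k : Type w} [Field k] {C : Type u} [Category.{v} C]
    [Preadditive C] [Linear k C] [MonoidalCategory C] {G : Type*}
    (F : G → LinearMonoidalAutoequiv k C) {a b : G} (h : a = b) :
    (F a).functor ≅ (F b).functor :=
  eqToIso (congrArg (fun g => (F g).functor) h)

theorem LinearMonoidalAutoequiv.castIso_refl {k : Type w} [Field k] {C : Type u} [Category.{v} C]
    [Preadditive C] [Linear k C] [MonoidalCategory C] {G : Type*}
    (F : G → LinearMonoidalAutoequiv k C) (a : G) :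
    LinearMonoidalAutoequiv.castIso F (rfl : a = a) = Iso.refl _ := rfl

instance LinearMonoidalAutoequiv.castIso_isMonoidal {k : Type w} [Field k] {C : Type u}
    [Category.{v} C] [Preadditive C] [Linear k C] [MonoidalCategory C] {G : Type*}
    (F : G → LinearMonoidalAutoequiv k C) {a b : G} (h : a = b) :
    NatTrans.IsMonoidal (LinearMonoidalAutoequiv.castIso F h).hom := by
  subst h
  exact inferInstanceAs (NatTrans.IsMonoidal (𝟙 _))

/-- An action of a group `G` on the `k`-linear monoidal category `C` by `k`-linear monoidal
autoequivalences: a monoidal functor from the discrete monoidal category `G` to the monoidal category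
of monoidal autoequivalences of `C` and monoidal natural isomorphisms. It consists of `g ↦ g_*`,
monoidal isomorphisms `mulIso g h : g_* ∘ h_* ≅ (gh)_*` and `oneIso : 1_* ≅ id`, with the
associativity and unit axioms. -/
structure TensorAction (k : Type w) [Field k] (G : Type*) [Group G] (C : Type u) [Category.{v} C]
    [Preadditive C] [Linear k C] [MonoidalCategory C] where
  aut : G → LinearMonoidalAutoequiv k C
  mulIso (g h : G) : (aut h).functor ⋙ (aut g).functor ≅ (aut (g * h)).functor
  mulIso_isMonoidal (g h : G) : NatTrans.IsMonoidal (mulIso g h).hom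
  oneIso : (aut 1).functor ≅ 𝟭 C
  oneIso_isMonoidal : NatTrans.IsMonoidal oneIso.hom
  assoc (g h l : G) (V : C) :
    (mulIso g h).hom.app ((aut l).functor.obj V) ≫ (mulIso (g * h) l).hom.app V =
      (aut g).functor.map ((mulIso h l).hom.app V) ≫ (mulIso g (h * l)).hom.app V ≫
        (LinearMonoidalAutoequiv.castIso aut (mul_assoc g h l).symm).hom.app V
  one_mul (g : G) (V : C) :
    (mulIso 1 g).hom.app V ≫ (LinearMonoidalAutoequiv.castIso aut (_root_.one_mul g)).hom.app V =
      oneIso.hom.app ((aut g).functor.obj V)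
  mul_one (g : G) (V : C) :
    (mulIso g 1).hom.app V ≫ (LinearMonoidalAutoequiv.castIso aut (_root_.mul_one g)).hom.app V =
      (aut g).functor.map (oneIso.hom.app V)

attribute [instance] TensorAction.mulIso_isMonoidal TensorAction.oneIso_isMonoidal

theorem LinearMonoidalAutoequiv.castIso_trans {k : Type w} [Field k] {C : Type u} [Category.{v} C]
    [Preadditive C] [Linear k C] [MonoidalCategory C] {G : Type*}
    (F : G → LinearMonoidalAutoequiv k C) {a b c : G} (h : a = b) (h' : b = c) (V : C) :
    (castIso F h).hom.app V ≫ (castIso F h').hom.app V = (castIso F (h.trans h')).hom.app V := by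
  subst h h'
  simp [castIso]

section cast
variable {k : Type w} [Field k] {C : Type u} [Category.{v} C]
    [Preadditive C] [Linear k C] [MonoidalCategory C] {G : Type*} [Group G]

theorem TensorAction.mulIso_cast_left (A : TensorAction k G C) {g g' : G} (hg : g = g') (h : G)
    (V : C) :
    (A.mulIso g h).hom.app V ≫
        (LinearMonoidalAutoequiv.castIso A.aut (congrArg (· * h) hg)).hom.app V =
      (LinearMonoidalAutoequiv.castIso A.aut hg).hom.app ((A.aut h).functor.obj V) ≫
        (A.mulIso g' h).hom.app V := by
  subst hg
  simp [LinearMonoidalAutoequiv.castIso]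

theorem TensorAction.mulIso_cast_right (A : TensorAction k G C) (g : G) {h h' : G} (hh : h = h')
    (V : C) :
    (A.mulIso g h).hom.app V ≫
        (LinearMonoidalAutoequiv.castIso A.aut (congrArg (g * ·) hh)).hom.app V =
      (A.aut g).functor.map ((LinearMonoidalAutoequiv.castIso A.aut hh).hom.app V) ≫
        (A.mulIso g h').hom.app V := by
  subst hh
  simp [LinearMonoidalAutoequiv.castIso]

theorem TensorAction.assoc_inv (A : TensorAction k G C) (g h l : G) (V : C) :
    (LinearMonoidalAutoequiv.castIso A.aut (mul_assoc g h l)).hom.app V ≫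
      (A.mulIso g (h * l)).inv.app V ≫ (A.aut g).functor.map ((A.mulIso h l).inv.app V) =
    (A.mulIso (g * h) l).inv.app V ≫ (A.mulIso g h).inv.app ((A.aut l).functor.obj V) := by
  have := A.assoc g h l V
  rw [← cancel_epi ((A.mulIso (g * h) l).hom.app V),
    ← cancel_epi ((A.mulIso g h).hom.app ((A.aut l).functor.obj V)), reassoc_of% this,
    reassoc_of% (LinearMonoidalAutoequiv.castIso_trans A.aut (mul_assoc g h l).symm
      (mul_assoc g h l) V)]
  simp [LinearMonoidalAutoequiv.castIso_refl, ← Functor.map_comp]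

theorem TensorAction.mul_one_inv (A : TensorAction k G C) (g : G) (V : C) :
    (A.mulIso g 1).inv.app V ≫ (A.aut g).functor.map (A.oneIso.hom.app V) =
      (LinearMonoidalAutoequiv.castIso A.aut (_root_.mul_one g)).hom.app V := by
  rw [← A.mul_one g V]
  simp

/-- The action of `H` obtained from an action of `G` by pulling back along `φ : H → G`. -/
def TensorAction.restrict (A : TensorAction k G C) {H : Type*} [Group H] (φ : H →* G) :
    TensorAction k H C where
  aut h := A.aut (φ h)
  mulIso g h := A.mulIso (φ g) (φ h) ≪≫ LinearMonoidalAutoequiv.castIso A.aut (map_mul φ g h).symm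
  mulIso_isMonoidal g h := inferInstanceAs (NatTrans.IsMonoidal ((A.mulIso (φ g) (φ h)).hom ≫
    (LinearMonoidalAutoequiv.castIso A.aut (map_mul φ g h).symm).hom))
  oneIso := LinearMonoidalAutoequiv.castIso A.aut (map_one φ) ≪≫ A.oneIso
  oneIso_isMonoidal := inferInstanceAs (NatTrans.IsMonoidal
    ((LinearMonoidalAutoequiv.castIso A.aut (map_one φ)).hom ≫ A.oneIso.hom))
  assoc g h l V := by
    have e1 := A.mulIso_cast_left (map_mul φ g h).symm (φ l) V
    have e2 := A.mulIso_cast_right (φ g) (map_mul φ h l).symm V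
    have e3 := A.assoc (φ g) (φ h) (φ l) V
    have hc : ∀ (a b : H) (h : a = b),
      LinearMonoidalAutoequiv.castIso (fun x => A.aut (φ x)) h =
        LinearMonoidalAutoequiv.castIso A.aut (congrArg φ h) := fun _ _ _ => rfl
    simp only [hc, Iso.trans_hom, NatTrans.comp_app, Functor.map_comp, Category.assoc]
    rw [← reassoc_of% e1, ← reassoc_of% e2, reassoc_of% e3]
    simp only [LinearMonoidalAutoequiv.castIso_trans]
  one_mul g V := by
    have e1 := A.mulIso_cast_left (map_one φ) (φ g) V
    have e2 := A.one_mul (φ g) V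
    have hc : ∀ (a b : H) (h : a = b),
      LinearMonoidalAutoequiv.castIso (fun x => A.aut (φ x)) h =
        LinearMonoidalAutoequiv.castIso A.aut (congrArg φ h) := fun _ _ _ => rfl
    simp only [hc, Iso.trans_hom, NatTrans.comp_app, Category.assoc]
    rw [← e2, ← reassoc_of% e1]
    simp only [LinearMonoidalAutoequiv.castIso_trans]
  mul_one g V := by
    have e1 := A.mulIso_cast_right (φ g) (map_one φ) V
    have e2 := A.mul_one (φ g) V
    have hc : ∀ (a b : H) (h : a = b),
      LinearMonoidalAutoequiv.castIso (fun x => A.aut (φ x)) h =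
        LinearMonoidalAutoequiv.castIso A.aut (congrArg φ h) := fun _ _ _ => rfl
    simp only [hc, Iso.trans_hom, NatTrans.comp_app, Functor.map_comp, Category.assoc]
    rw [← e2, ← reassoc_of% e1]
    simp only [LinearMonoidalAutoequiv.castIso_trans]
end cast

section coh
namespace CrossedObj
open Functor.LaxMonoidal Functor.OplaxMonoidal
variable {C : Type u} [Category.{v} C] [MonoidalCategory C]

theorem coh_left {X X' P Q R : C} (f : X ⟶ X') (θ : P ⊗ Q ⟶ R) :
    ((f ▷ P ≫ X' ◁ 𝟙 P) ▷ Q ≫ (X' ⊗ P) ◁ 𝟙 Q) ≫ (α_ X' P Q).hom ≫ X' ◁ θ =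
      ((α_ X P Q).hom ≫ X ◁ θ) ≫ f ▷ R ≫ X' ◁ 𝟙 R := by
  simp [whisker_exchange]

theorem coh_middle (F : C ⥤ C) [F.Monoidal] (X : C) {Y Y' P Q : C} (f : Y ⟶ Y')
    (c : P ⟶ F.obj Q) :
    ((X ◁ F.map f) ▷ P ≫ (X ⊗ F.obj Y') ◁ 𝟙 P) ≫ (α_ _ _ _).hom ≫ X ◁ (F.obj Y' ◁ c ≫ μ F Y' Q) =
      ((α_ _ _ _).hom ≫ X ◁ (F.obj Y ◁ c ≫ μ F Y Q)) ≫ X ◁ F.map (f ▷ Q ≫ Y' ◁ 𝟙 Q) := by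
  simp [← MonoidalCategory.whiskerLeft_comp, ← whisker_exchange_assoc, ← μ_natural_left]

theorem coh_right (F : C ⥤ C) [F.Monoidal] (X Y : C) {P P' Q Q' : C} (f : P ⟶ P') (g : Q ⟶ Q')
    (c : P ⟶ F.obj Q) (c' : P' ⟶ F.obj Q') (h : f ≫ c' = c ≫ F.map g) :
    (X ⊗ F.obj Y) ◁ f ≫ (α_ _ _ _).hom ≫ X ◁ (F.obj Y ◁ c' ≫ μ F Y Q') =
      ((α_ _ _ _).hom ≫ X ◁ (F.obj Y ◁ c ≫ μ F Y Q)) ≫ X ◁ F.map (Y ◁ g) := by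
  simp only [tensor_whiskerLeft, Category.assoc, Iso.inv_hom_id_assoc, ←
    MonoidalCategory.whiskerLeft_comp, ← μ_natural_right]
  simp only [← MonoidalCategory.whiskerLeft_comp_assoc, h]

theorem coh_pentagon (F K M : C ⥤ C) [F.Monoidal] [K.Monoidal] [M.Monoidal]
    (c : ∀ V, M.obj V ⟶ F.obj (K.obj V)) (W X Y : C) {P E T T' : C}
    (hc : μ M Y P ≫ c (Y ⊗ P) = (c Y ⊗ₘ c P) ≫ μ F _ _ ≫ F.map (μ K Y P))
    (i : T ⟶ T') (t : T' ⟶ F.obj E) (e : E ⟶ K.obj P) (s : T ⟶ M.obj P)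
    (h : i ≫ t ≫ F.map e = s ≫ c P) :
    (((α_ W (F.obj X) (M.obj Y)).hom ≫ W ◁ (F.obj X ◁ c Y ≫ μ F X (K.obj Y))) ▷ T ≫
      (W ⊗ F.obj (X ⊗ K.obj Y)) ◁ i) ≫
      ((α_ _ _ _).hom ≫ W ◁ (F.obj (X ⊗ K.obj Y) ◁ t ≫ μ F _ _)) ≫
      W ◁ F.map ((α_ X (K.obj Y) E).hom ≫ X ◁ (K.obj Y ◁ e ≫ μ K Y P)) =
    ((α_ (W ⊗ F.obj X) (M.obj Y) T).hom ≫ (W ⊗ F.obj X) ◁ (M.obj Y ◁ s ≫ μ M Y P)) ≫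
      (α_ W (F.obj X) _).hom ≫ W ◁ (F.obj X ◁ c (Y ⊗ P) ≫ μ F X (K.obj (Y ⊗ P))) := by
  have key : (F.obj X ◁ c Y ≫ μ F X (K.obj Y)) ▷ T ≫ _ ◁ (i ≫ t) ≫ μ F _ _ ≫
      F.map ((α_ X (K.obj Y) E).hom ≫ X ◁ (K.obj Y ◁ e ≫ μ K Y P)) =
      (α_ _ _ _).hom ≫ F.obj X ◁ (M.obj Y ◁ s ≫ μ M Y P ≫ c (Y ⊗ P)) ≫ μ F X _ := by
    rw [hc]
    simp only [Functor.map_comp, comp_whiskerRight, Category.assoc]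
    rw [← whisker_exchange_assoc, Functor.LaxMonoidal.associativity_assoc]
    simp only [← μ_natural_right, MonoidalCategory.whiskerLeft_comp,
      Functor.map_comp, Category.assoc, ← μ_natural_right_assoc]
    simp only [tensor_whiskerLeft, whisker_assoc, Category.assoc, Iso.inv_hom_id_assoc]
    simp only [← MonoidalCategory.whiskerLeft_comp_assoc]
    congr 3
    rw [MonoidalCategory.tensorHom_def]
    have h' := congrArg (fun z => M.obj Y ◁ z) h
    simp only [MonoidalCategory.whiskerLeft_comp] at h'
    simp only [Category.assoc, ← whisker_exchange_assoc]
    rw [← reassoc_of% h', MonoidalCategory.whiskerLeft_comp, Category.assoc,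
      ← μ_natural_right_assoc, whisker_exchange_assoc, whisker_exchange_assoc,
      whisker_exchange_assoc, whisker_exchange_assoc, whisker_exchange_assoc]
  have key' := congrArg (fun z => (α_ _ _ _).hom ▷ T ≫ (α_ _ _ _).hom ≫ W ◁ z) key
  simp at key' ⊢
  rw [← key']

theorem coh_triangle (F L : C ⥤ C) [F.Monoidal] (X Y : C) (c : L.obj Y ⟶ F.obj Y)
    (E : C) (c' : L.obj Y ⟶ F.obj E) (n : E ⟶ Y) (h : c' ≫ F.map n = c) :
    ((α_ X (F.obj (𝟙_ C)) (L.obj Y)).hom ≫ X ◁ (F.obj (𝟙_ C) ◁ c' ≫ μ F (𝟙_ C) E)) ≫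
      X ◁ F.map (𝟙_ C ◁ n ≫ (λ_ Y).hom) =
    (X ◁ η F ≫ (ρ_ X).hom) ▷ L.obj Y ≫ X ◁ c := by
  subst h
  have h2 : F.obj (𝟙_ C) ◁ c' ≫ μ F (𝟙_ C) E ≫ F.map (𝟙_ C ◁ n ≫ (λ_ Y).hom) =
      η F ▷ _ ≫ (λ_ _).hom ≫ c' ≫ F.map n := by
    rw [Functor.map_comp, ← μ_natural_right_assoc, Functor.Monoidal.map_leftUnitor]
    simp only [Functor.Monoidal.μ_δ_assoc]
    rw [← leftUnitor_naturality, ← whisker_exchange_assoc, MonoidalCategory.whiskerLeft_comp,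
      Category.assoc]
  simp only [Category.assoc, ← MonoidalCategory.whiskerLeft_comp, h2]
  simp

end CrossedObj
end coh

section crossed
variable {k : Type w} [Field k] {C : Type u} [Category.{v} C]
    [Preadditive C] [Linear k C] [MonoidalCategory C] {G : Type*} [Group G]

/-- A homogeneous object `[V, σ]` of the crossed product of `C` with `G`, where `V` is an object
of `C` and `σ` is in `G`. -/
structure CrossedObj (A : TensorAction k G C) where
  obj : C
  deg : G

namespace CrossedObj

variable {A : TensorAction k G C}

/-- Morphisms `[V, σ] ⟶ [W, τ]` are the morphisms `V ⟶ W` if `σ = τ`, and only `0`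
if `σ ≠ τ`. -/
def homSubmodule (X Y : CrossedObj A) : Submodule k (X.obj ⟶ Y.obj) where
  carrier := {f | X.deg ≠ Y.deg → f = 0}
  add_mem' ha hb h := by rw [ha h, hb h, add_zero]
  zero_mem' _ := rfl
  smul_mem' c f hf h := by rw [hf h, smul_zero]

instance : Category.{v} (CrossedObj A) where
  Hom X Y := homSubmodule X Y
  id X := ⟨𝟙 X.obj, fun h => (h rfl).elim⟩
  comp {X Y Z} f g := ⟨f.1 ≫ g.1, fun h => by
    by_cases h' : X.deg = Y.deg
    · rw [g.2 (h' ▸ h), Limits.comp_zero]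
    · rw [f.2 h', Limits.zero_comp]⟩
  id_comp f := Subtype.ext (Category.id_comp f.1)
  comp_id f := Subtype.ext (Category.comp_id f.1)
  assoc f g h := Subtype.ext (Category.assoc f.1 g.1 h.1)

@[ext]
theorem hom_ext {X Y : CrossedObj A} {f g : X ⟶ Y} (h : f.1 = g.1) : f = g := Subtype.ext h

@[simp] theorem id_val (X : CrossedObj A) : (𝟙 X : X ⟶ X).1 = 𝟙 X.obj := rfl
@[simp] theorem comp_val {X Y Z : CrossedObj A} (f : X ⟶ Y) (g : Y ⟶ Z) :
    (f ≫ g).1 = f.1 ≫ g.1 := rfl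

instance : Preadditive (CrossedObj A) where
  homGroup X Y := inferInstanceAs (AddCommGroup (homSubmodule X Y))
  add_comp _ _ _ f f' g := Subtype.ext (Preadditive.add_comp _ _ _ f.1 f'.1 g.1)
  comp_add _ _ _ f g g' := Subtype.ext (Preadditive.comp_add _ _ _ f.1 g.1 g'.1)

instance : Linear k (CrossedObj A) where
  homModule X Y := inferInstanceAs (Module k (homSubmodule X Y))
  smul_comp _ _ _ r f g := Subtype.ext (Linear.smul_comp _ _ _ r f.1 g.1)
  comp_smul _ _ _ f r g := Subtype.ext (Linear.comp_smul _ _ _ f.1 r g.1)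

@[simp] theorem add_val {X Y : CrossedObj A} (f g : X ⟶ Y) : (f + g).1 = f.1 + g.1 := rfl
@[simp] theorem zero_val {X Y : CrossedObj A} : (0 : X ⟶ Y).1 = 0 := rfl
@[simp] theorem smul_val {X Y : CrossedObj A} (r : k) (f : X ⟶ Y) : (r • f).1 = r • f.1 := rfl

/-- An isomorphism in `C` between the objects underlying two homogeneous objects of the same degree. -/
@[simps]
def mkIso {X Y : CrossedObj A} (e : X.obj ≅ Y.obj) (h : X.deg = Y.deg) : X ≅ Y where
  hom := ⟨e.hom, fun h' => (h' h).elim⟩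
  inv := ⟨e.inv, fun h' => (h' h.symm).elim⟩
  hom_inv_id := Subtype.ext e.hom_inv_id
  inv_hom_id := Subtype.ext e.inv_hom_id

theorem cast_naturality (A : TensorAction k G C) {a b : G} (h : a = b) {V W : C} (f : V ⟶ W) :
  (A.aut a).functor.map f ≫ (LinearMonoidalAutoequiv.castIso A.aut h).hom.app W =
   (LinearMonoidalAutoequiv.castIso A.aut h).hom.app V ≫ (A.aut b).functor.map f :=
  (LinearMonoidalAutoequiv.castIso A.aut h).hom.naturality f

theorem eq_zero_of_deg_ne {X Y : CrossedObj A} (f : X ⟶ Y) (h : X.deg ≠ Y.deg) : f = 0 :=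
  Subtype.ext (f.2 h)

variable [MonoidalPreadditive C]

open scoped Classical in
/-- The tensor product is `[V, σ] ⊗ [W, τ] = [V ⊗ σ_* W, στ]`; a morphism `f : [V, σ] ⟶ [V', σ]`
and a morphism `g : [W, τ] ⟶ [W', τ]` have tensor product `f ⊗ σ_* g`. The associator is
`(V ⊗ σ_* W) ⊗ (στ)_* X ≅ V ⊗ (σ_* W ⊗ (στ)_* X) ≅ V ⊗ (σ_* W ⊗ σ_* τ_* X) ≅ V ⊗ σ_* (W ⊗ τ_* X)`,
and the unit is `[𝟙, 1]`. -/
noncomputable instance : MonoidalCategoryStruct (CrossedObj A) where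
  tensorObj X Y := ⟨X.obj ⊗ (A.aut X.deg).functor.obj Y.obj, X.deg * Y.deg⟩
  whiskerLeft X Y Z f := ⟨X.obj ◁ (A.aut X.deg).functor.map f.1, fun h => by
    rw [f.2 fun e => h (congrArg (X.deg * ·) e), Functor.map_zero,
      MonoidalPreadditive.whiskerLeft_zero]⟩
  whiskerRight {X Y} f Z :=
    ⟨if h : X.deg = Y.deg then
        f.1 ▷ (A.aut X.deg).functor.obj Z.obj ≫
          Y.obj ◁ (LinearMonoidalAutoequiv.castIso A.aut h).hom.app Z.obj
      else 0, fun h => dif_neg fun e => h (congrArg (· * Z.deg) e)⟩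
  tensorUnit := ⟨𝟙_ C, 1⟩
  associator X Y Z := mkIso
    (α_ X.obj ((A.aut X.deg).functor.obj Y.obj) ((A.aut (X.deg * Y.deg)).functor.obj Z.obj) ≪≫
      whiskerLeftIso X.obj
        (whiskerLeftIso _ ((A.mulIso X.deg Y.deg).symm.app Z.obj) ≪≫
          Functor.Monoidal.μIso (A.aut X.deg).functor Y.obj ((A.aut Y.deg).functor.obj Z.obj)))
    (mul_assoc _ _ _)
  leftUnitor X := mkIso (whiskerLeftIso _ (A.oneIso.app X.obj) ≪≫ λ_ X.obj) (one_mul _)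
  rightUnitor X := mkIso
    (whiskerLeftIso _ (Functor.Monoidal.εIso (A.aut X.deg).functor).symm ≪≫ ρ_ X.obj)
    (mul_one _)

theorem whiskerLeft_val (X : CrossedObj A) {Y Z : CrossedObj A} (f : Y ⟶ Z) :
    (X ◁ f).1 = X.obj ◁ (A.aut X.deg).functor.map f.1 := rfl

theorem whiskerRight_val {X Y : CrossedObj A} (f : X ⟶ Y) (h : X.deg = Y.deg) (Z : CrossedObj A) :
    (f ▷ Z).1 = f.1 ▷ (A.aut X.deg).functor.obj Z.obj ≫
          Y.obj ◁ (LinearMonoidalAutoequiv.castIso A.aut h).hom.app Z.obj := dif_pos h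

theorem whiskerLeft_zero' (X : CrossedObj A) {Y Z : CrossedObj A} :
    X ◁ (0 : Y ⟶ Z) = 0 := by
  ext; simp [whiskerLeft_val]

theorem zero_whiskerRight' {X Y : CrossedObj A} (Z : CrossedObj A) :
    (0 : X ⟶ Y) ▷ Z = 0 := by
  ext
  by_cases h : X.deg = Y.deg
  · simp [whiskerRight_val _ h]
  · exact (0 ▷ Z : X ⊗ Z ⟶ Y ⊗ Z).2 fun e => h (mul_right_cancel e)

@[simp] theorem associator_hom_val (X Y Z : CrossedObj A) : (α_ X Y Z).hom.1 =
    (α_ X.obj ((A.aut X.deg).functor.obj Y.obj) ((A.aut (X.deg * Y.deg)).functor.obj Z.obj)).hom ≫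
      X.obj ◁ (_ ◁ (A.mulIso X.deg Y.deg).inv.app Z.obj ≫
          Functor.LaxMonoidal.μ (A.aut X.deg).functor Y.obj ((A.aut Y.deg).functor.obj Z.obj)) := rfl

@[simp] theorem leftUnitor_hom_val (X : CrossedObj A) : (λ_ X).hom.1 =
    _ ◁ A.oneIso.hom.app X.obj ≫ (λ_ X.obj).hom := rfl

@[simp] theorem rightUnitor_hom_val (X : CrossedObj A) : (ρ_ X).hom.1 =
    X.obj ◁ Functor.OplaxMonoidal.η (A.aut X.deg).functor ≫ (ρ_ X.obj).hom := rfl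

theorem whiskerLeft_id' (X Y : CrossedObj A) : X ◁ 𝟙 Y = 𝟙 (X ⊗ Y) := by
  ext
  have h := (A.aut X.deg).functor.map_id Y.obj
  change X.obj ◁ (A.aut X.deg).functor.map (𝟙 Y.obj) = 𝟙 (X.obj ⊗ (A.aut X.deg).functor.obj Y.obj)
  rw [h, MonoidalCategory.whiskerLeft_id]

theorem id_whiskerRight' (X Y : CrossedObj A) : 𝟙 X ▷ Y = 𝟙 (X ⊗ Y) := by
  ext
  simp only [whiskerRight_val (𝟙 X) rfl, id_val, LinearMonoidalAutoequiv.castIso_refl,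
    Iso.refl_hom, NatTrans.id_app, MonoidalCategory.whiskerLeft_id,
    MonoidalCategory.id_whiskerRight, Category.comp_id]
  rfl

theorem whiskerLeft_comp' (X : CrossedObj A) {Y Z W : CrossedObj A} (f : Y ⟶ Z) (g : Z ⟶ W) :
    X ◁ (f ≫ g) = X ◁ f ≫ X ◁ g := by
  ext; simp only [whiskerLeft_val, comp_val, Functor.map_comp, MonoidalCategory.whiskerLeft_comp]

theorem comp_whiskerRight' {X Y Z : CrossedObj A} (f : X ⟶ Y) (g : Y ⟶ Z) (W : CrossedObj A) :
    (f ≫ g) ▷ W = f ▷ W ≫ g ▷ W := by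
  by_cases h : X.deg = Y.deg
  · by_cases h' : Y.deg = Z.deg
    · ext
      simp only [whiskerRight_val _ h, whiskerRight_val _ h', whiskerRight_val _ (h.trans h'),
        comp_val, comp_whiskerRight, Category.assoc,
        ← LinearMonoidalAutoequiv.castIso_trans A.aut h h']
      rw [whisker_exchange_assoc, ← MonoidalCategory.whiskerLeft_comp]
    · rw [eq_zero_of_deg_ne g h', Limits.comp_zero, zero_whiskerRight', zero_whiskerRight',
        Limits.comp_zero]
  · rw [eq_zero_of_deg_ne f h, Limits.zero_comp, zero_whiskerRight', zero_whiskerRight',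
        Limits.zero_comp]

theorem whisker_exchange' {W X Y Z : CrossedObj A} (f : W ⟶ X) (g : Y ⟶ Z) :
    W ◁ g ≫ f ▷ Z = f ▷ Y ≫ X ◁ g := by
  by_cases h : W.deg = X.deg
  · ext
    simp only [comp_val, whiskerRight_val _ h, whiskerLeft_val, Category.assoc,
      whisker_exchange_assoc]
    rw [← MonoidalCategory.whiskerLeft_comp, ← MonoidalCategory.whiskerLeft_comp, cast_naturality]
  · rw [eq_zero_of_deg_ne f h, zero_whiskerRight', zero_whiskerRight', Limits.zero_comp,
      Limits.comp_zero]

theorem associator_naturality_left' {X X' : CrossedObj A} (f : X ⟶ X') (Y Z : CrossedObj A) :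
    (f ▷ Y) ▷ Z ≫ (α_ X' Y Z).hom = (α_ X Y Z).hom ≫ f ▷ (Y ⊗ Z) := by
  by_cases h : X.deg = X'.deg
  · ext
    obtain ⟨X, σ⟩ := X
    obtain ⟨X', σ'⟩ := X'
    obtain rfl : σ = σ' := h
    have h1 := whiskerRight_val f rfl Y
    have h2 := whiskerRight_val (f ▷ Y) rfl Z
    have h3 := whiskerRight_val f rfl (Y ⊗ Z)
    simp only [comp_val, h1, h2, h3, LinearMonoidalAutoequiv.castIso_refl, Iso.refl_hom]
    exact coh_left f.1 _
  · rw [eq_zero_of_deg_ne f h, zero_whiskerRight', zero_whiskerRight', zero_whiskerRight',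
      Limits.zero_comp, Limits.comp_zero]

theorem associator_naturality_middle' (X : CrossedObj A) {Y Y' : CrossedObj A} (f : Y ⟶ Y')
    (Z : CrossedObj A) :
    (X ◁ f) ▷ Z ≫ (α_ X Y' Z).hom = (α_ X Y Z).hom ≫ X ◁ (f ▷ Z) := by
  by_cases h : Y.deg = Y'.deg
  · ext
    obtain ⟨Y, σ⟩ := Y
    obtain ⟨Y', σ'⟩ := Y'
    obtain rfl : σ = σ' := h
    have h1 := whiskerRight_val f rfl Z
    have h2 := whiskerRight_val (X ◁ f) rfl Z
    simp only [comp_val, h1, h2, whiskerLeft_val, LinearMonoidalAutoequiv.castIso_refl,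
      Iso.refl_hom]
    exact coh_middle (A.aut X.deg).functor X.obj f.1 ((A.mulIso X.deg σ).inv.app Z.obj)
  · rw [eq_zero_of_deg_ne f h, zero_whiskerRight', whiskerLeft_zero', whiskerLeft_zero',
      zero_whiskerRight', Limits.zero_comp, Limits.comp_zero]

theorem associator_naturality_right' (X Y : CrossedObj A) {Z Z' : CrossedObj A} (f : Z ⟶ Z') :
    (X ⊗ Y) ◁ f ≫ (α_ X Y Z').hom = (α_ X Y Z).hom ≫ X ◁ (Y ◁ f) := by
  ext
  simp only [comp_val, whiskerLeft_val, associator_hom_val]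
  exact coh_right (A.aut X.deg).functor X.obj Y.obj ((A.aut (X.deg * Y.deg)).functor.map f.1)
    ((A.aut Y.deg).functor.map f.1) _ _ ((A.mulIso X.deg Y.deg).inv.naturality f.1)

theorem leftUnitor_naturality' {X Y : CrossedObj A} (f : X ⟶ Y) :
    𝟙_ (CrossedObj A) ◁ f ≫ (λ_ Y).hom = (λ_ X).hom ≫ f := by
  ext
  simp only [comp_val, whiskerLeft_val, leftUnitor_hom_val]
  have := A.oneIso.hom.naturality f.1
  change 𝟙_ C ◁ (A.aut 1).functor.map f.1 ≫ 𝟙_ C ◁ A.oneIso.hom.app Y.obj ≫ (λ_ Y.obj).hom =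
    (𝟙_ C ◁ A.oneIso.hom.app X.obj ≫ (λ_ X.obj).hom) ≫ f.1
  rw [← MonoidalCategory.whiskerLeft_comp_assoc, this]
  simp

theorem rightUnitor_naturality' {X Y : CrossedObj A} (f : X ⟶ Y) :
    f ▷ 𝟙_ (CrossedObj A) ≫ (ρ_ Y).hom = (ρ_ X).hom ≫ f := by
  by_cases h : X.deg = Y.deg
  · ext
    obtain ⟨X, σ⟩ := X
    obtain ⟨Y, σ'⟩ := Y
    obtain rfl : σ = σ' := h
    have h1 := whiskerRight_val f rfl (𝟙_ (CrossedObj A))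
    simp only [comp_val, h1, LinearMonoidalAutoequiv.castIso_refl, Iso.refl_hom,
      rightUnitor_hom_val]
    change (f.1 ▷ (A.aut σ).functor.obj (𝟙_ C) ≫ Y ◁ 𝟙 _) ≫
      Y ◁ Functor.OplaxMonoidal.η (A.aut σ).functor ≫ (ρ_ Y).hom =
      (X ◁ Functor.OplaxMonoidal.η (A.aut σ).functor ≫ (ρ_ X).hom) ≫ f.1
    simp [← whisker_exchange_assoc]
  · rw [eq_zero_of_deg_ne f h, zero_whiskerRight', Limits.zero_comp, Limits.comp_zero]

theorem pentagon' (W X Y Z : CrossedObj A) : Pentagon W X Y Z := by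
  have h1 := whiskerRight_val (α_ W X Y).hom (mul_assoc _ _ _) Z
  unfold Pentagon
  ext
  simp only [comp_val, h1, whiskerLeft_val, associator_hom_val]
  exact coh_pentagon (A.aut W.deg).functor (A.aut X.deg).functor
    (A.aut (W.deg * X.deg)).functor (fun V => (A.mulIso W.deg X.deg).inv.app V) W.obj X.obj Y.obj
    (NatTrans.IsMonoidal.tensor (τ := (A.mulIso W.deg X.deg).inv) _ _) _ _ _ _
    (A.assoc_inv W.deg X.deg Y.deg Z.obj)

theorem triangle' (X Y : CrossedObj A) : (α_ X (𝟙_ _) Y).hom ≫ X ◁ (λ_ Y).hom =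
    (ρ_ X).hom ▷ Y := by
  have h1 := whiskerRight_val (ρ_ X).hom (mul_one _) Y
  ext
  simp only [comp_val, h1, whiskerLeft_val, associator_hom_val, leftUnitor_hom_val,
    rightUnitor_hom_val]
  exact coh_triangle (A.aut X.deg).functor (A.aut (X.deg * 1)).functor X.obj Y.obj _ _ _ _
    (A.mul_one_inv X.deg Y.obj)

noncomputable instance : MonoidalCategory (CrossedObj A) where
  tensorHom_def _ _ := rfl
  id_tensorHom_id X Y := by
    change 𝟙 X ▷ Y ≫ X ◁ 𝟙 Y = _
    rw [whiskerLeft_id', id_whiskerRight', Category.comp_id]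
  tensorHom_comp_tensorHom {X₁ Y₁ Z₁ X₂ Y₂ Z₂} f₁ f₂ g₁ g₂ := by
    change (f₁ ▷ X₂ ≫ Y₁ ◁ f₂) ≫ g₁ ▷ Y₂ ≫ Z₁ ◁ g₂ = (f₁ ≫ g₁) ▷ X₂ ≫ Z₁ ◁ (f₂ ≫ g₂)
    rw [whiskerLeft_comp', comp_whiskerRight', Category.assoc, Category.assoc,
      reassoc_of% whisker_exchange' g₁ f₂]
  whiskerLeft_id := whiskerLeft_id'
  id_whiskerRight := id_whiskerRight'
  associator_naturality {X₁ X₂ X₃ Y₁ Y₂ Y₃} f₁ f₂ f₃ := by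
    change ((f₁ ▷ X₂ ≫ Y₁ ◁ f₂) ▷ X₃ ≫ (Y₁ ⊗ Y₂) ◁ f₃) ≫ (α_ Y₁ Y₂ Y₃).hom =
      (α_ X₁ X₂ X₃).hom ≫ f₁ ▷ (X₂ ⊗ X₃) ≫ Y₁ ◁ (f₂ ▷ X₃ ≫ Y₂ ◁ f₃)
    rw [whiskerLeft_comp', comp_whiskerRight', Category.assoc, associator_naturality_right',
      Category.assoc, reassoc_of% associator_naturality_middle' Y₁ f₂ X₃,
      reassoc_of% associator_naturality_left' f₁ X₂ X₃]
  leftUnitor_naturality := leftUnitor_naturality'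
  rightUnitor_naturality := rightUnitor_naturality'
  pentagon := pentagon'
  triangle := triangle'

end CrossedObj
end crossed

section crossed2
variable {k : Type w} [Field k] {C : Type u} [Category.{v} C]
    [Preadditive C] [Linear k C] [MonoidalCategory C] [MonoidalPreadditive C] {G : Type*} [Group G]
    {A : TensorAction k G C}
namespace CrossedObj

instance : MonoidalPreadditive (CrossedObj A) where
  whiskerLeft_zero := whiskerLeft_zero' _
  zero_whiskerRight := zero_whiskerRight' _
  whiskerLeft_add f g := by
    ext
    simp only [add_val, whiskerLeft_val, Functor.map_add, MonoidalPreadditive.whiskerLeft_add]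
  add_whiskerRight {X Y Z} f g := by
    by_cases h : Y.deg = Z.deg
    · ext
      simp only [add_val, whiskerRight_val _ h, MonoidalPreadditive.add_whiskerRight,
        Preadditive.add_comp]
    · rw [eq_zero_of_deg_ne f h, eq_zero_of_deg_ne g h, add_zero, zero_whiskerRight', add_zero]

instance [MonoidalLinear k C] : MonoidalLinear k (CrossedObj A) where
  whiskerLeft_smul X Y Z r f := by
    ext
    simp only [smul_val, whiskerLeft_val, Functor.map_smul, MonoidalLinear.whiskerLeft_smul]
  smul_whiskerRight r Y Z f X := by
    by_cases h : Y.deg = Z.deg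
    · ext
      simp only [smul_val, whiskerRight_val _ h, MonoidalLinear.smul_whiskerRight,
        Linear.smul_comp]
    · rw [eq_zero_of_deg_ne f h, smul_zero, zero_whiskerRight', smul_zero]

end CrossedObj
end crossed2


section envelope
variable {k : Type w} [Field k] {D : Type u} [Category.{v} D] [Preadditive D]
namespace MatTensor

/-- The hom spaces of `Mat_ D` (finite formal direct sums of objects of `D`, and matrices of morphisms)
are `k`-vector spaces entrywise. -/
instance linear [Linear k D] : Linear k (Mat_ D) where
  homModule M N := inferInstanceAs (Module k (∀ i j, M.X i ⟶ N.X j))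
  smul_comp M N K r f g := by
    ext i j
    change ∑ l, (r • f i l) ≫ g l j = r • ∑ l, f i l ≫ g l j
    simp [Finset.smul_sum]
  comp_smul M N K f r g := by
    ext i j
    change ∑ l, f i l ≫ (r • g l j) = r • ∑ l, f i l ≫ g l j
    simp [Finset.smul_sum]

theorem smul_apply [Linear k D] {M N : Mat_ D} (r : k) (f : M ⟶ N) (i : M.ι) (j : N.ι) :
    (r • f) i j = r • f i j := rfl

theorem zero_apply {M N : Mat_ D} (i : M.ι) (j : N.ι) : (0 : M ⟶ N) i j = 0 := rfl

open scoped Classical in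
/-- The generalised permutation matrix with entries `φ i` in the positions `(i, e i)`. -/
noncomputable def reindexHom {M N : Mat_ D} (e : M.ι ≃ N.ι) (φ : ∀ i, M.X i ⟶ N.X (e i)) : M ⟶ N :=
  fun i j => if h : e i = j then φ i ≫ eqToHom (congrArg N.X h) else 0

theorem reindexHom_apply_self {M N : Mat_ D} (e : M.ι ≃ N.ι) (φ : ∀ i, M.X i ⟶ N.X (e i))
    (i : M.ι) : reindexHom e φ i (e i) = φ i := by
  simp [reindexHom]

theorem reindexHom_apply_ne {M N : Mat_ D} (e : M.ι ≃ N.ι) (φ : ∀ i, M.X i ⟶ N.X (e i))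
    (i : M.ι) (j : N.ι) (h : e i ≠ j) : reindexHom e φ i j = 0 := by
  simp [reindexHom, h]

theorem reindexHom_comp_apply {M N K : Mat_ D} (e : M.ι ≃ N.ι)
    (φ : ∀ i, M.X i ⟶ N.X (e i)) (f : N ⟶ K) (i : M.ι) (l : K.ι) :
    (reindexHom e φ ≫ f) i l = φ i ≫ f (e i) l := by
  rw [Mat_.comp_apply, Finset.sum_eq_single (e i), reindexHom_apply_self]
  · intro b _ hb
    rw [reindexHom_apply_ne _ _ _ _ hb.symm, Limits.zero_comp]
  · simp

theorem comp_reindexHom_apply {L M N : Mat_ D} (e : M.ι ≃ N.ι)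
    (φ : ∀ i, M.X i ⟶ N.X (e i)) (f : L ⟶ M) (l : L.ι) (i : M.ι) :
    (f ≫ reindexHom e φ) l (e i) = f l i ≫ φ i := by
  rw [Mat_.comp_apply, Finset.sum_eq_single i, reindexHom_apply_self]
  · intro b _ hb
    rw [reindexHom_apply_ne _ _ _ _ fun h => hb (e.injective h), Limits.comp_zero]
  · simp

theorem hom_ext_equiv {L N : Mat_ D} {ι : Type} (e : ι ≃ N.ι) {f g : L ⟶ N}
    (h : ∀ l i, f l (e i) = g l (e i)) : f = g := by
  ext l j
  obtain ⟨i, rfl⟩ := e.surjective j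
  exact h l i

/-- `f` is the generalised permutation matrix with entries `φ i` in the positions `(i, e i)`. -/
structure IsReindex {M N : Mat_ D} (f : M ⟶ N) (e : M.ι → N.ι) (φ : ∀ i, M.X i ⟶ N.X (e i)) :
    Prop where
  self (i : M.ι) : f i (e i) = φ i
  ne (i : M.ι) (j : N.ι) (h : e i ≠ j) : f i j = 0

theorem isReindex_reindexHom {M N : Mat_ D} (e : M.ι ≃ N.ι) (φ : ∀ i, M.X i ⟶ N.X (e i)) :
    IsReindex (reindexHom e φ) e φ :=
  ⟨reindexHom_apply_self e φ, reindexHom_apply_ne e φ⟩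

theorem IsReindex.comp {M N K : Mat_ D} {f : M ⟶ N} {g : N ⟶ K} {e : M.ι → N.ι} {e' : N.ι → K.ι}
    {φ : ∀ i, M.X i ⟶ N.X (e i)} {φ' : ∀ i, N.X i ⟶ K.X (e' i)} (hf : IsReindex f e φ)
    (hg : IsReindex g e' φ') : IsReindex (f ≫ g) (fun i => e' (e i)) (fun i => φ i ≫ φ' (e i)) := by
  have key : ∀ i l, (f ≫ g) i l = φ i ≫ g (e i) l := by
    intro i l
    rw [Mat_.comp_apply, Finset.sum_eq_single (e i), hf.self]
    · intro b _ hb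
      rw [hf.ne _ _ hb.symm, Limits.zero_comp]
    · simp
  exact ⟨fun i => by rw [key, hg.self], fun i j h => by rw [key, hg.ne _ _ h, Limits.comp_zero]⟩

theorem IsReindex.eq {M N : Mat_ D} {f g : M ⟶ N} {e : M.ι → N.ι}
    {φ φ' : ∀ i, M.X i ⟶ N.X (e i)} (hf : IsReindex f e φ) (hg : IsReindex g e φ')
    (h : ∀ i, φ i = φ' i) : f = g := by
  ext i j
  by_cases h' : e i = j
  · subst h'
    rw [hf.self, hg.self, h]
  · rw [hf.ne _ _ h', hg.ne _ _ h']

theorem isReindex_id (M : Mat_ D) : IsReindex (𝟙 M) (fun i => i) (fun i => 𝟙 (M.X i)) :=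
  ⟨Mat_.id_apply_self M, Mat_.id_apply_of_ne M⟩

open scoped Classical in
/-- The generalised permutation matrix with entries `φ i` in the positions `(e i, i)`. -/
noncomputable def reindexInv {M N : Mat_ D} (e : M.ι ≃ N.ι) (φ : ∀ i, N.X (e i) ⟶ M.X i) :
    N ⟶ M :=
  fun j i => if h : e i = j then eqToHom (congrArg N.X h.symm) ≫ φ i else 0

theorem reindexInv_apply_self {M N : Mat_ D} (e : M.ι ≃ N.ι) (φ : ∀ i, N.X (e i) ⟶ M.X i)
    (i : M.ι) : reindexInv e φ (e i) i = φ i := by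
  simp [reindexInv]

theorem reindexInv_apply_ne {M N : Mat_ D} (e : M.ι ≃ N.ι) (φ : ∀ i, N.X (e i) ⟶ M.X i)
    (j : N.ι) (i : M.ι) (h : e i ≠ j) : reindexInv e φ j i = 0 := by
  simp [reindexInv, h]

/-- Two formal direct sums are isomorphic if their summands are isomorphic up to a bijection of the
indices. -/
noncomputable def reindexIso {M N : Mat_ D} (e : M.ι ≃ N.ι) (φ : ∀ i, M.X i ≅ N.X (e i)) :
    M ≅ N where
  hom := reindexHom e fun i => (φ i).hom
  inv := reindexInv e fun i => (φ i).inv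
  hom_inv_id := by
    ext i i'
    rw [reindexHom_comp_apply]
    by_cases h : i = i'
    · subst h
      rw [reindexInv_apply_self, Iso.hom_inv_id, Mat_.id_apply_self]
    · rw [Mat_.id_apply_of_ne _ _ _ h, reindexInv_apply_ne _ _ _ _
        fun h' => h (e.injective h').symm, Limits.comp_zero]
  inv_hom_id := by
    refine hom_ext_equiv e fun j i => ?_
    rw [comp_reindexHom_apply]
    by_cases h : e i = j
    · subst h
      rw [reindexInv_apply_self, Iso.inv_hom_id, Mat_.id_apply_self]
    · rw [Mat_.id_apply_of_ne _ _ _ (Ne.symm h), reindexInv_apply_ne _ _ _ _ h, Limits.zero_comp]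

variable [MonoidalCategory D]

/-- The tensor product of `D` extended to finite formal direct sums: it is distributive over the
summands, and entrywise on matrices. -/
noncomputable instance : MonoidalCategoryStruct (Mat_ D) where
  tensorObj M N := ⟨M.ι × N.ι, fun p => M.X p.1 ⊗ N.X p.2⟩
  tensorHom f g := fun p q => f p.1 q.1 ⊗ₘ g p.2 q.2
  whiskerLeft M _ _ g := fun p q => (𝟙 M : M ⟶ M) p.1 q.1 ⊗ₘ g p.2 q.2
  whiskerRight f N := fun p q => f p.1 q.1 ⊗ₘ (𝟙 N : N ⟶ N) p.2 q.2
  tensorUnit := ⟨PUnit, fun _ => 𝟙_ D⟩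
  associator M N K := reindexIso (Equiv.prodAssoc M.ι N.ι K.ι)
    fun p => α_ (M.X p.1.1) (N.X p.1.2) (K.X p.2)
  leftUnitor M := reindexIso (Equiv.punitProd M.ι) fun p => λ_ (M.X p.2)
  rightUnitor M := reindexIso (Equiv.prodPUnit M.ι) fun p => ρ_ (M.X p.1)

theorem tensorHom_apply {M M' N N' : Mat_ D} (f : M ⟶ M') (g : N ⟶ N') (p : (M ⊗ N).ι)
    (q : (M' ⊗ N').ι) : (f ⊗ₘ g) p q = f p.1 q.1 ⊗ₘ g p.2 q.2 := rfl

variable [MonoidalPreadditive D]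

theorem id_tensorHom_id (M N : Mat_ D) : 𝟙 M ⊗ₘ 𝟙 N = 𝟙 (M ⊗ N) := by
  ext p q
  rw [tensorHom_apply]
  by_cases h1 : p.1 = q.1
  · by_cases h2 : p.2 = q.2
    · obtain rfl : p = q := Prod.ext h1 h2
      rw [Mat_.id_apply_self, Mat_.id_apply_self, Mat_.id_apply_self]
      exact MonoidalCategory.id_tensorHom_id _ _
    · rw [Mat_.id_apply_of_ne _ _ _ h2, Mat_.id_apply_of_ne _ _ _ fun h => h2 (congrArg Prod.snd h),
        MonoidalPreadditive.tensor_zero]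
  · rw [Mat_.id_apply_of_ne _ _ _ h1, Mat_.id_apply_of_ne _ _ _ fun h => h1 (congrArg Prod.fst h),
        MonoidalPreadditive.zero_tensor]

theorem tensorHom_comp_tensorHom {X₁ Y₁ Z₁ X₂ Y₂ Z₂ : Mat_ D} (f₁ : X₁ ⟶ Y₁) (f₂ : X₂ ⟶ Y₂)
    (g₁ : Y₁ ⟶ Z₁) (g₂ : Y₂ ⟶ Z₂) :
    (f₁ ⊗ₘ f₂) ≫ (g₁ ⊗ₘ g₂) = (f₁ ≫ g₁) ⊗ₘ (f₂ ≫ g₂) := by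
  ext p q
  rw [tensorHom_apply, Mat_.comp_apply, Mat_.comp_apply, Mat_.comp_apply, sum_tensor]
  simp_rw [tensor_sum]
  rw [← Finset.sum_product']
  refine Finset.sum_congr rfl fun x _ => ?_
  rw [tensorHom_apply, tensorHom_apply, MonoidalCategory.tensorHom_comp_tensorHom]

theorem IsReindex.tensor {M N M' N' : Mat_ D} {f : M ⟶ N} {g : M' ⟶ N'} {e : M.ι → N.ι}
    {e' : M'.ι → N'.ι} {φ : ∀ i, M.X i ⟶ N.X (e i)} {φ' : ∀ i, M'.X i ⟶ N'.X (e' i)}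
    (hf : IsReindex f e φ) (hg : IsReindex g e' φ') :
    IsReindex (f ⊗ₘ g) (fun p : M.ι × M'.ι => (e p.1, e' p.2)) (fun p => φ p.1 ⊗ₘ φ' p.2) := by
  constructor
  · intro p
    rw [tensorHom_apply, hf.self, hg.self]
  · intro p q h
    rw [tensorHom_apply]
    by_cases h1 : e p.1 = q.1
    · have h2 : e' p.2 ≠ q.2 := fun h2 => h (Prod.ext h1 h2)
      rw [hg.ne _ _ h2, MonoidalPreadditive.tensor_zero]
    · rw [hf.ne _ _ h1, MonoidalPreadditive.zero_tensor]

noncomputable instance : MonoidalCategory (Mat_ D) := .ofTensorHom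
  (id_tensorHom_id := id_tensorHom_id)
  (id_tensorHom := fun _ _ _ _ => rfl)
  (tensorHom_id := fun _ _ => rfl)
  (tensorHom_comp_tensorHom := tensorHom_comp_tensorHom)
  (associator_naturality := fun {X₁ X₂ X₃ Y₁ Y₂ Y₃} f₁ f₂ f₃ => by
    refine hom_ext_equiv (Equiv.prodAssoc _ _ _) fun p q => ?_
    refine (comp_reindexHom_apply _ _ _ _ _).trans
      (Eq.trans ?_ (reindexHom_comp_apply _ _ _ _ _).symm)
    exact MonoidalCategory.associator_naturality _ _ _)
  (leftUnitor_naturality := fun {X Y} f => by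
    refine hom_ext_equiv (Equiv.punitProd Y.ι) fun p q => ?_
    refine (comp_reindexHom_apply _ _ _ _ _).trans
      (Eq.trans ?_ (reindexHom_comp_apply _ _ _ _ _).symm)
    obtain ⟨⟨⟩, i⟩ := p
    obtain ⟨⟨⟩, j⟩ := q
    have h : (𝟙 (𝟙_ (Mat_ D)) : 𝟙_ (Mat_ D) ⟶ 𝟙_ (Mat_ D)) PUnit.unit PUnit.unit = 𝟙 (𝟙_ D) :=
      Mat_.id_apply_self _ _
    change ((𝟙 (𝟙_ (Mat_ D)) : 𝟙_ (Mat_ D) ⟶ 𝟙_ (Mat_ D)) PUnit.unit PUnit.unit ⊗ₘ f i j) ≫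
      (λ_ (Y.X j)).hom = (λ_ (X.X i)).hom ≫ f i j
    rw [h]
    exact (congrArg (· ≫ (λ_ (Y.X j)).hom) (id_tensorHom (𝟙_ D) (f i j))).trans
      (MonoidalCategory.leftUnitor_naturality (f i j)))
  (rightUnitor_naturality := fun {X Y} f => by
    refine hom_ext_equiv (Equiv.prodPUnit Y.ι) fun p q => ?_
    refine (comp_reindexHom_apply _ _ _ _ _).trans
      (Eq.trans ?_ (reindexHom_comp_apply _ _ _ _ _).symm)
    obtain ⟨i, ⟨⟩⟩ := p
    obtain ⟨j, ⟨⟩⟩ := q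
    have h : (𝟙 (𝟙_ (Mat_ D)) : 𝟙_ (Mat_ D) ⟶ 𝟙_ (Mat_ D)) PUnit.unit PUnit.unit = 𝟙 (𝟙_ D) :=
      Mat_.id_apply_self _ _
    change (f i j ⊗ₘ (𝟙 (𝟙_ (Mat_ D)) : 𝟙_ (Mat_ D) ⟶ 𝟙_ (Mat_ D)) PUnit.unit PUnit.unit) ≫
      (ρ_ (Y.X j)).hom = (ρ_ (X.X i)).hom ≫ f i j
    rw [h]
    exact (congrArg (· ≫ (ρ_ (Y.X j)).hom) (tensorHom_id (f i j) (𝟙_ D))).trans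
      (MonoidalCategory.rightUnitor_naturality (f i j)))
  (pentagon := fun W X Y Z => by
    have a : ∀ M N K : Mat_ D, IsReindex (α_ M N K).hom (fun p => (p.1.1, p.1.2, p.2))
      (fun p => (α_ (M.X p.1.1) (N.X p.1.2) (K.X p.2)).hom) := fun M N K =>
        isReindex_reindexHom (M := (M ⊗ N) ⊗ K) (N := M ⊗ (N ⊗ K)) (Equiv.prodAssoc _ _ _) _
    refine (((a W X Y).tensor (isReindex_id Z)).comp
      ((a W (X ⊗ Y) Z).comp ((isReindex_id W).tensor (a X Y Z)))).eq
      ((a (W ⊗ X) Y Z).comp (a W X (Y ⊗ Z))) fun p => ?_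
    have := MonoidalCategory.pentagon (W.X p.1.1.1) (X.X p.1.1.2) (Y.X p.1.2) (Z.X p.2)
    rw [← tensorHom_id, ← id_tensorHom] at this
    exact this)
  (triangle := fun X Y => by
    refine ((isReindex_reindexHom (M := (X ⊗ 𝟙_ (Mat_ D)) ⊗ Y) (N := X ⊗ (𝟙_ (Mat_ D) ⊗ Y))
      (Equiv.prodAssoc X.ι PUnit Y.ι) _).comp ((isReindex_id X).tensor
        (isReindex_reindexHom (M := 𝟙_ (Mat_ D) ⊗ Y) (Equiv.punitProd Y.ι) _))).eq
      ((isReindex_reindexHom (M := X ⊗ 𝟙_ (Mat_ D)) (Equiv.prodPUnit X.ι) _).tensor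
        (isReindex_id Y)) fun p => ?_
    have := MonoidalCategory.triangle (X.X p.1.1) (Y.X p.2)
    rw [← tensorHom_id, ← id_tensorHom] at this
    exact this)

instance : MonoidalPreadditive (Mat_ D) where
  whiskerLeft_zero := by
    intros; ext p q; exact MonoidalPreadditive.tensor_zero _
  zero_whiskerRight := by
    intros; ext p q; exact MonoidalPreadditive.zero_tensor _
  whiskerLeft_add f g := by
    ext p q; exact MonoidalPreadditive.tensor_add _ _ _
  add_whiskerRight f g := by
    ext p q; exact MonoidalPreadditive.add_tensor _ _ _

theorem tensor_smul [Linear k D] [MonoidalLinear k D] {X X' Y Y' : D} (r : k) (f : X ⟶ X')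
    (g : Y ⟶ Y') : f ⊗ₘ (r • g) = r • (f ⊗ₘ g) := by
  simp [MonoidalCategory.tensorHom_def]

theorem smul_tensor [Linear k D] [MonoidalLinear k D] {X X' Y Y' : D} (r : k) (f : X ⟶ X')
    (g : Y ⟶ Y') : (r • f) ⊗ₘ g = r • (f ⊗ₘ g) := by
  simp [MonoidalCategory.tensorHom_def]

instance [Linear k D] [MonoidalLinear k D] : MonoidalLinear k (Mat_ D) where
  whiskerLeft_smul X Y Z r f := by
    ext p q; exact tensor_smul _ _ _
  smul_whiskerRight r Y Z f X := by
    ext p q; exact smul_tensor _ _ _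

end MatTensor
end envelope

section anomalous
open Functor.LaxMonoidal Functor.OplaxMonoidal
variable {D : Type u} [Category.{v} D] [MonoidalCategory D]

/-- The data of a pseudonatural transformation `F ⇒ G` of monoidal endofunctors (regarded as
2-functors of the one-object bicategory with endomorphisms `D`): an object `U = obj` of `D` and
isomorphisms `χ_V : F V ⊗ U ≅ U ⊗ G V`. -/
structure PseudonaturalData (F G : D ⥤ D) where
  obj : D
  app (V : D) : F.obj V ⊗ obj ≅ obj ⊗ G.obj V

/-- The data `(U, χ)` is a pseudonatural isomorphism of monoidal functors: `χ` is natural, compatible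
with the tensor product and the unit through the monoidal structures of `F` and `G`, and `U` is an
invertible object. -/
structure IsPseudonaturalIso {F G : D ⥤ D} [F.Monoidal] [G.Monoidal]
    (T : PseudonaturalData F G) : Prop where
  naturality {V W : D} (f : V ⟶ W) :
    F.map f ▷ T.obj ≫ (T.app W).hom = (T.app V).hom ≫ T.obj ◁ G.map f
  tensor (V W : D) :
    μ F V W ▷ T.obj ≫ (T.app (V ⊗ W)).hom =
      (α_ _ _ _).hom ≫ F.obj V ◁ (T.app W).hom ≫ (α_ _ _ _).inv ≫
        (T.app V).hom ▷ G.obj W ≫ (α_ _ _ _).hom ≫ T.obj ◁ μ G V W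
  unit :
    ε F ▷ T.obj ≫ (T.app (𝟙_ D)).hom = (λ_ T.obj).hom ≫ (ρ_ T.obj).inv ≫ T.obj ◁ ε G
  invertible : ∃ U : D, Nonempty (T.obj ⊗ U ≅ 𝟙_ D) ∧ Nonempty (U ⊗ T.obj ≅ 𝟙_ D)

namespace PseudonaturalData

/-- The identity pseudonatural transformation, with `U = 𝟙`. -/
def id (F : D ⥤ D) : PseudonaturalData F F where
  obj := 𝟙_ D
  app V := ρ_ (F.obj V) ≪≫ (λ_ (F.obj V)).symm

/-- Vertical composition `F ⇒ G ⇒ H`; its object is the tensor product `U_S ⊗ U_T`. -/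
def comp {F G H : D ⥤ D} (S : PseudonaturalData F G) (T : PseudonaturalData G H) :
    PseudonaturalData F H where
  obj := S.obj ⊗ T.obj
  app V := (α_ _ _ _).symm ≪≫ whiskerRightIso (S.app V) T.obj ≪≫ α_ _ _ _ ≪≫
    whiskerLeftIso S.obj (T.app V) ≪≫ (α_ _ _ _).symm

/-- The whiskering `id_K ⊗ T : K ∘ F ⇒ K ∘ G`; its object is `K U` and its component at `V` is
`K F V ⊗ K U ≅ K (F V ⊗ U) ≅ K (U ⊗ G V) ≅ K U ⊗ K G V`. -/
def postcomp {F G : D ⥤ D} (T : PseudonaturalData F G) (K : D ⥤ D) [K.Monoidal] :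
    PseudonaturalData (F ⋙ K) (G ⋙ K) where
  obj := K.obj T.obj
  app V := Functor.Monoidal.μIso K (F.obj V) T.obj ≪≫ K.mapIso (T.app V) ≪≫
    (Functor.Monoidal.μIso K T.obj (G.obj V)).symm

/-- The whiskering `T ⊗ id_H : F ∘ H ⇒ G ∘ H`; its object is `U`. -/
def precomp {F G : D ⥤ D} (T : PseudonaturalData F G) (H : D ⥤ D) :
    PseudonaturalData (H ⋙ F) (H ⋙ G) where
  obj := T.obj
  app V := T.app (H.obj V)

/-- Transport along isomorphisms of the source and of the target. -/
def congr {F F' G G' : D ⥤ D} (T : PseudonaturalData F G) (e : F ≅ F') (e' : G ≅ G') :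
    PseudonaturalData F' G' where
  obj := T.obj
  app V := whiskerRightIso (e.symm.app V) T.obj ≪≫ T.app V ≪≫ whiskerLeftIso T.obj (e'.app V)

end PseudonaturalData

/-- The isomorphism `Γ : U_S ≅ U_T` is an invertible modification `S ⇛ T`, that is, it commutes with
the structure isomorphisms of `S` and `T`. -/
def IsModification {F G : D ⥤ D} (S T : PseudonaturalData F G) (Γ : S.obj ≅ T.obj) : Prop :=
  ∀ V : D, F.obj V ◁ Γ.hom ≫ (T.app V).hom = (S.app V).hom ≫ Γ.hom ▷ G.obj V

/-- Normalized 4-cocycles of a group with values in an abelian group `M` (written multiplicatively)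
with trivial action. -/
structure IsNormalizedCocycle₄ {Q M : Type*} [Group Q] [CommGroup M] (π : Q → Q → Q → Q → M) :
    Prop where
  cocycle (a b c d e : Q) :
    π b c d e * π a (b * c) d e * π a b c (d * e) =
      π (a * b) c d e * π a b (c * d) e * π a b c d
  normalized (a b c d : Q) (h : a = 1 ∨ b = 1 ∨ c = 1 ∨ d = 1) : π a b c d = 1

/-- A `π`-anomalous action of `Q` on the `k`-linear monoidal category `D`: a monoidal 2-functor
(one-object trihomomorphism) from the 3-group of `(Q, kˣ, π)`, which has only identity 2-morphisms and
pentagonator `π`, to the 3-group of `k`-linear monoidal autoequivalences of `D`, pseudonatural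
isomorphisms and invertible modifications, under which the 3-morphism `a : kˣ` acts as the scalar `a`.
It consists of

* `aut`: monoidal autoequivalences `F_q`;
* `mul`: pseudonatural isomorphisms `(U_{q,r}, χ_{q,r}) : F_q ∘ F_r ⇒ F_{qr}`;
* `one`: a pseudonatural isomorphism `id ⇒ F_1`;
* `assoc`: invertible modifications
  `ω_{q,r,s} : χ_{q,rs} ∘ (id ⊗ χ_{r,s}) ⇛ χ_{qr,s} ∘ (χ_{q,r} ⊗ id)`;
* `leftUnit`, `rightUnit`: invertible modifications comparing `χ_{1,q}` and `χ_{q,1}`, composed with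
  the unit, with the identity of `F_q`;

with the associativity axiom `pentagon`, which says that the two composites of the `ω` from
`F_q F_r U_{s,t} ⊗ (F_q U_{r,st} ⊗ U_{q,r(st)})` to `U_{q,r} ⊗ (U_{qr,s} ⊗ U_{(qr)s,t})`, one through
`F_q ω_{r,s,t}`, `ω_{q,rs,t}`, `ω_{q,r,s}` and the other through `ω_{q,r,st}`, the interchange
`χ_{q,r}` at `U_{s,t}` and `ω_{qr,s,t}`, differ by the scalar `π(q,r,s,t)`, and with the unit axiom
`triangle`. The morphisms `eqToHom` are the equalities given by associativity and unitality in `Q`. -/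
structure AnomalousAction (k : Type w) [Field k] {Q : Type*} [Group Q] (π : Q → Q → Q → Q → kˣ)
    (D : Type u) [Category.{v} D] [Preadditive D] [Linear k D] [MonoidalCategory D] where
  aut : Q → LinearMonoidalAutoequiv k D
  mul (q r : Q) : PseudonaturalData ((aut r).functor ⋙ (aut q).functor) (aut (q * r)).functor
  mul_isPseudonaturalIso (q r : Q) : IsPseudonaturalIso (mul q r)
  one : PseudonaturalData (𝟭 D) (aut 1).functor
  one_isPseudonaturalIso : IsPseudonaturalIso one
  assoc (q r s : Q) :
    (aut q).functor.obj (mul r s).obj ⊗ (mul q (r * s)).obj ≅ (mul q r).obj ⊗ (mul (q * r) s).obj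
  assoc_isModification (q r s : Q) :
    IsModification
      ((((mul r s).postcomp (aut q).functor).comp (mul q (r * s))).congr
        (Functor.associator (aut s).functor (aut r).functor (aut q).functor)
        (LinearMonoidalAutoequiv.castIso aut (mul_assoc q r s).symm))
      (((mul q r).precomp (aut s).functor).comp (mul (q * r) s))
      (assoc q r s)
  leftUnit (q : Q) : one.obj ⊗ (mul 1 q).obj ≅ 𝟙_ D
  leftUnit_isModification (q : Q) :
    IsModification
      (((one.precomp (aut q).functor).comp (mul 1 q)).congr
        (Functor.rightUnitor (aut q).functor)
        (LinearMonoidalAutoequiv.castIso aut (one_mul q)))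
      (.id (aut q).functor) (leftUnit q)
  rightUnit (q : Q) : (aut q).functor.obj one.obj ⊗ (mul q 1).obj ≅ 𝟙_ D
  rightUnit_isModification (q : Q) :
    IsModification
      (((one.postcomp (aut q).functor).comp (mul q 1)).congr
        (Functor.leftUnitor (aut q).functor)
        (LinearMonoidalAutoequiv.castIso aut (mul_one q)))
      (.id (aut q).functor) (rightUnit q)
  pentagon (q r s t : Q) :
    (α_ _ _ _).inv ≫
        ((μ (aut q).functor _ _ ≫ (aut q).functor.map (assoc r s t).hom ≫
            δ (aut q).functor _ _) ⊗ₘ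
          eqToHom (congrArg (fun x => (mul q x).obj) (mul_assoc r s t).symm)) ≫
        (α_ _ _ _).hom ≫
        (aut q).functor.obj (mul r s).obj ◁ (assoc q (r * s) t).hom ≫
        (α_ _ _ _).inv ≫
        ((assoc q r s).hom ⊗ₘ
          eqToHom (congrArg (fun x => (mul x t).obj) (mul_assoc q r s).symm)) ≫
        (α_ _ _ _).hom =
      (π q r s t : k) •
        ((aut q).functor.obj ((aut r).functor.obj (mul s t).obj) ◁ (assoc q r (s * t)).hom ≫
        (α_ _ _ _).inv ≫
        ((mul q r).app (mul s t).obj).hom ▷ (mul (q * r) (s * t)).obj ≫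
        (α_ _ _ _).hom ≫
        (mul q r).obj ◁ (assoc (q * r) s t).hom)
  triangle (q r : Q) :
    (α_ _ _ _).inv ≫
        (μ (aut q).functor _ _ ≫ (aut q).functor.map (leftUnit r).hom ≫
          η (aut q).functor) ▷ (mul q (1 * r)).obj ≫
        (λ_ _).hom ≫
        eqToHom (congrArg (fun x => (mul q x).obj) (one_mul r)) =
      (aut q).functor.obj one.obj ◁ (assoc q 1 r).hom ≫
        (α_ _ _ _).inv ≫
        (rightUnit q).hom ▷ (mul (q * 1) r).obj ≫
        (λ_ _).hom ≫
        eqToHom (congrArg (fun x => (mul x r).obj) (mul_one q))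

end anomalous

/-- The crossed product `C ⋊ G` of a `k`-linear monoidal category with a group acting on it: its
objects are finite (formal) direct sums of homogeneous objects `[V, σ]`, its morphisms are matrices of
homogeneous morphisms, and its tensor product extends the one of the homogeneous objects. -/
abbrev CrossedProduct {k : Type w} [Field k] {C : Type u} [Category.{v} C]
    [Preadditive C] [Linear k C] [MonoidalCategory C] [MonoidalPreadditive C] {G : Type*} [Group G]
    (A : TensorAction k G C) := Mat_ (CrossedObj A)

/-! The crossed product with the kernel `N = ker ρ` sits inside the crossed product with the whole
free group, where the invertible objects `[𝟙, g]` are available. Choose a section `s` of `ρ` with `s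
1 = 1`, and let `u(q,r)` in `N` be its factor set, so that `s q * s r = u(q,r) * s(qr)`. Conjugation
by `[𝟙, s q]` is a monoidal autoequivalence `[V, σ] ↦ [(s q)_* V, s q σ (s q)⁻¹]`, and `U_{q,r} =
[𝟙, u(q,r)]` compares `F_q F_r` with `F_{qr}`. As it stands this action has no anomaly. The anomaly
is put in by scalars: multiply `χ_{q,r}` at an object of degree `σ` by a scalar `β_{q,r}(σ)`, and
multiply `ω_{q,r,s}` by a scalar `γ(q,r,s)`.

Compatibility of `χ` with tensor products says that `β_{q,r}` is a character of `N`. That `ω` is a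
modification says that `β` is a 2-cocycle of `Q` in the characters of `N`, with `Q` acting by
conjugation through `s`. In the pentagon, the interchange of `χ_{q,r}` with `U_{x,y}` contributes
`β_{q,r}(u(x,y))`. The anomaly is therefore the cup product of `β` with the extension class, up to
the coboundary of `γ`, and every `π` has to be written in this form.

Freeness makes this possible: a free group has no cohomology above degree one, so inflating `π`
loses its class. Explicitly, crossed homomorphisms from a free group to the functions `Q → M` are
prescribed arbitrarily on generators (`exists_isCrossedHom`) and are determined there
(`IsCrossedHom.ext_of`). Let `D_{a,b}` be the one whose value on a generator `f` is `x ↦ π(a,b,x,ρ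
f)`. The cocycle identity of `π` on generators propagates to an identity among the `D_{a,b}` on the
whole group. Evaluating at `1`, on the kernel and on the section, yields `β` and `γ`
(`exists_characters_of_cocycle`). The same crossed homomorphisms, counted with coefficients of order
two, give the rank of the kernel.

The categorical verification uses tiles, that is, squares recording an isomorphism `X' ⊗ [𝟙, h] ≅
[𝟙, g] ⊗ X`. They form a double category. A morphism `X' ⟶ Y'` is determined by the morphism `X ⟶ Y`
over which it lies (`Tile.Over.unique`), and structural morphisms lie over structural morphisms
(`Tile.over_associator` and its companions). Since conjugation functors and their constraints lie
over identities, each axiom reduces to monoidal coherence together with one identity of scalars.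

All this happens on homogeneous objects. The extension to formal direct sums is formal, since all
structural morphisms there are generalised permutation matrices whose axioms hold entry by entry. -/

section CrossedHom

/-! ### Crossed homomorphisms into functions on a quotient group -/

/-- A crossed homomorphism from `F` to the module of functions `Q → M`, on which `F` acts by right
translation through `ρ : F → Q`. -/
structure IsCrossedHom {F Q M : Type*} [Group F] [Group Q] [CommGroup M] (ρ : F →* Q)
    (D : F → Q → M) : Prop where
  map_mul (g h : F) (x : Q) : D (g * h) x = D g x * D h (x * ρ g)

namespace IsCrossedHom

variable {F Q M : Type*} [Group F] [Group Q] [CommGroup M] {ρ : F →* Q} {D E : F → Q → M}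

theorem map_one (hD : IsCrossedHom ρ D) (x : Q) : D 1 x = 1 := by
  have := hD.map_mul 1 1 x
  simpa using this

theorem map_inv (hD : IsCrossedHom ρ D) (g : F) (x : Q) : D g⁻¹ (x * ρ g) = (D g x)⁻¹ := by
  have := hD.map_mul g g⁻¹ x
  rw [mul_inv_cancel, hD.map_one] at this
  exact eq_inv_of_mul_eq_one_right this.symm

theorem mul (hD : IsCrossedHom ρ D) (hE : IsCrossedHom ρ E) : IsCrossedHom ρ (D * E) :=
  ⟨fun g h x => by simp only [Pi.mul_apply, hD.map_mul, hE.map_mul]; exact mul_mul_mul_comm _ _ _ _⟩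

theorem translate (hD : IsCrossedHom ρ D) (c : Q) : IsCrossedHom ρ fun g x => D g (c * x) :=
  ⟨fun g h x => by simp only [hD.map_mul, mul_assoc]⟩

theorem principal (ρ : F →* Q) (f : Q → M) : IsCrossedHom ρ fun g x => f (x * ρ g) / f x :=
  ⟨fun g h x => by simp only [_root_.map_mul, ← mul_assoc, mul_comm (_ / f x),
    div_mul_div_cancel]⟩

theorem map_mul_of_mem_ker (hD : IsCrossedHom ρ D) {σ : F} (hσ : ρ σ = 1) (τ : F) (x : Q) :
    D (σ * τ) x = D σ x * D τ x := by
  rw [hD.map_mul, hσ, mul_one]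

/-- The contributions of `y` and `y⁻¹` cancel, and only the evaluation point of the middle factor
moves. Values at any point of `Q` thus become values at `1` on a conjugate, which is how conjugation
enters the cocycle condition on `β`. -/
theorem conj (hD : IsCrossedHom ρ D) {σ : F} (hσ : ρ σ = 1) (y : F) :
    D (y * σ * y⁻¹) 1 = D σ (ρ y) := by
  have h := hD.map_inv y 1
  rw [one_mul] at h
  rw [hD.map_mul, hD.map_mul, _root_.map_mul, hσ, one_mul, mul_one, one_mul, h,
    mul_right_comm, mul_inv_cancel, one_mul]

/-- The values on products and inverses are forced by those on the factors. An identity between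
crossed homomorphisms therefore needs checking on generators only, where the values are entries of
`π`. -/
theorem ext_of {n : Type*} {ρ : FreeGroup n →* Q} {D E : FreeGroup n → Q → M}
    (hD : IsCrossedHom ρ D) (hE : IsCrossedHom ρ E)
    (h : ∀ i x, D (.of i) x = E (.of i) x) : D = E := by
  funext g
  induction g using FreeGroup.induction_on with
  | C1 => funext x; rw [hD.map_one, hE.map_one]
  | of i => funext x; exact h i x
  | inv_of i _ =>
    funext x
    have h1 := hD.map_inv (.of i) (x * (ρ (.of i))⁻¹)
    have h2 := hE.map_inv (.of i) (x * (ρ (.of i))⁻¹)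
    rw [inv_mul_cancel_right] at h1 h2
    rw [h1, h2, h]
  | mul g g' h1 h2 => funext x; rw [hD.map_mul, hE.map_mul, h1, h2]

end IsCrossedHom

/-- Right translation of functions as an action by automorphisms. -/
def rightTranslation (Q M : Type*) [Group Q] [CommGroup M] : Q →* MulAut (Q → M) where
  toFun q :=
    { toFun := fun f x => f (x * q)
      invFun := fun f x => f (x * q⁻¹)
      left_inv := fun f => by funext x; simp
      right_inv := fun f => by funext x; simp
      map_mul' := fun _ _ => rfl }
  map_one' := by ext f x; simp
  map_mul' p q := by ext f x; simp [mul_assoc]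

/-- Crossed homomorphisms are the lifts of `ρ` to the semidirect product of the function module with
`Q`, and the universal property of the free group supplies such a lift. -/
theorem exists_isCrossedHom {n Q M : Type*} [Group Q] [CommGroup M] (ρ : FreeGroup n →* Q)
    (d : n → Q → M) : ∃ D, IsCrossedHom ρ D ∧ ∀ i, D (.of i) = d i := by
  let L : FreeGroup n →* (Q → M) ⋊[rightTranslation Q M] Q :=
    FreeGroup.lift fun i => ⟨d i, ρ (.of i)⟩
  have hL : ∀ g, (L g).right = ρ g := fun g => DFunLike.congr_fun
    (FreeGroup.ext_hom (f := SemidirectProduct.rightHom.comp L) (g := ρ) fun i => by simp [L]) g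
  refine ⟨fun g => (L g).left, ⟨fun g h x => ?_⟩, fun i => by simp [L]⟩
  rw [map_mul, SemidirectProduct.mul_left, hL]
  rfl

/-! ### The rank of the kernel, by counting crossed homomorphisms -/

section Rank

variable {n Q M : Type*} [Group Q] [CommGroup M] (ρ : FreeGroup n →* Q)

/-- Crossed homomorphisms on a free group are determined freely by their values on the basis. -/
noncomputable def crossedHomEquiv :
    {D : FreeGroup n → Q → M // IsCrossedHom ρ D} ≃ (n → Q → M) :=
  Equiv.ofBijective (fun D i => D.1 (.of i))
    ⟨fun D E h => Subtype.ext (D.2.ext_of E.2 fun i x => congrFun (congrFun h i) x),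
      fun d => (exists_isCrossedHom ρ d).elim fun D hD => ⟨⟨D, hD.1⟩, funext hD.2⟩⟩

/-- A crossed homomorphism amounts to a homomorphism on the kernel and a normalized function. -/
noncomputable def crossedHomEquivKer (s : Q → FreeGroup n) (hs : ∀ q, ρ (s q) = q) (hs1 : s 1 = 1) :
    {D : FreeGroup n → Q → M // IsCrossedHom ρ D} ≃ (ρ.ker →* M) × {f : Q → M // f 1 = 1} where
  toFun D :=
    (⟨⟨fun σ => D.1 σ.1 1, D.2.map_one 1⟩, fun σ τ => D.2.map_mul_of_mem_ker σ.2 τ.1 1⟩,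
      ⟨fun x => D.1 (s x) 1, by beta_reduce; rw [hs1]; exact D.2.map_one 1⟩)
  invFun p :=
    -- The formula solves for `D g x` in two expansions of `D (s x * g) 1`: one through the factors
    -- `s x` and `g`, the other through an element of the kernel times `s (x * ρ g)`. This is
    -- Shapiro's lemma on the level of cocycles.
    ⟨fun g x => p.1 ⟨s x * g * (s (x * ρ g))⁻¹, by simp [MonoidHom.mem_ker, hs]⟩ *
        (p.2.1 (x * ρ g) / p.2.1 x), by
      refine IsCrossedHom.mul (D := fun g x => p.1 ⟨s x * g * (s (x * ρ g))⁻¹, _⟩) ⟨fun g h x => ?_⟩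
        (IsCrossedHom.principal ρ p.2.1)
      rw [← p.1.map_mul]
      congr 1
      ext
      simp [mul_assoc]⟩
  left_inv D := by
    ext g x
    have h1 : ρ (s x * g * (s (x * ρ g))⁻¹ * s (x * ρ g)) = x * ρ g := by simp [hs]
    have h2 := D.2.map_mul_of_mem_ker (σ := s x * g * (s (x * ρ g))⁻¹) (by simp [hs])
      (s (x * ρ g)) 1
    have h3 := D.2.map_mul (s x) g 1
    rw [inv_mul_cancel_right, h3, hs, one_mul] at h2
    change D.1 (s x * g * (s (x * ρ g))⁻¹) 1 * (D.1 (s (x * ρ g)) 1 / D.1 (s x) 1) = D.1 g x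
    rw [← mul_div_assoc, ← h2, mul_div_cancel_left]
  right_inv p := by
    obtain ⟨h, f, hf⟩ := p
    refine Prod.ext (MonoidHom.ext fun σ => ?_) (Subtype.ext (funext fun x => ?_))
    · have hσ : ρ σ.1 = 1 := σ.2
      change h ⟨s 1 * σ.1 * (s (1 * ρ σ.1))⁻¹, _⟩ * (f (1 * ρ σ.1) / f 1) = h σ
      simp [hσ, hs1]
    · change h ⟨s 1 * s x * (s (1 * ρ (s x)))⁻¹, _⟩ * (f (1 * ρ (s x)) / f 1) = f x
      have : (⟨s 1 * s x * (s (1 * ρ (s x)))⁻¹, by simp [MonoidHom.mem_ker, hs]⟩ : ρ.ker) = 1 := by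
        ext; simp [hs, hs1]
      rw [this, map_one, hf, hs, one_mul, one_mul, div_one]

/-- **Schreier index formula** for the kernel of a surjection from a free group to a finite
group. -/
theorem nonempty_freeGroup_mulEquiv_ker {Q : Type*} [Group Q] [Finite Q] {n : ℕ} (hn : 0 < n)
    (ρ : FreeGroup (Fin n) →* Q) (hρ : Function.Surjective ρ) :
    Nonempty (FreeGroup (Fin (Nat.card Q * (n - 1) + 1)) ≃* ρ.ker) := by
  classical
  obtain ⟨s₀, hs₀⟩ := hρ.hasRightInverse
  let s : Q → FreeGroup (Fin n) := Function.update s₀ 1 1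
  have hs1 : s 1 = 1 := Function.update_self ..
  have hs : ∀ q, ρ (s q) = q := fun q => by
    by_cases h : q = 1
    · rw [h, hs1, map_one]
    · simp only [s, Function.update_of_ne h]; exact hs₀ q
  let X := IsFreeGroup.Generators ρ.ker
  -- Coefficients of order two turn the bijections into an equation between powers of 2. They need
  -- only be finite and nontrivial for the count to detect the number of generators.
  let M := Multiplicative (ZMod 2)
  have hM : Nat.card M = 2 := Nat.card_zmod 2
  have e : (Fin n → Q → M) ≃ (X → M) × {f : Q → M // f 1 = 1} :=
    (crossedHomEquiv ρ).symm.trans ((crossedHomEquivKer ρ s hs hs1).trans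
      (Equiv.prodCongr IsFreeGroup.lift.symm (Equiv.refl _)))
  have : Finite M := Nat.finite_of_card_ne_zero (by rw [hM]; decide)
  have e' : {f : Q → M // f 1 = 1} ≃ ({q : Q // q ≠ 1} → M) :=
    { toFun := fun f q => f.1 q.1
      invFun := fun f => ⟨fun q => if h : q = 1 then 1 else f ⟨q, h⟩, by simp⟩
      left_inv := fun f => by
        ext q; by_cases h : q = 1
        · simp [h, f.2]
        · simp [h]
      right_inv := fun f => by ext q; simp [q.2] }
  -- Finite generation of the kernel is not presupposed: an infinite basis would carry infinitely
  -- many functions to `M`, while these are a quotient of a finite set.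
  have hfin : Finite (X → M) := Finite.of_surjective (fun d => (e d).1)
    (Prod.fst_surjective (h := ⟨⟨1, rfl⟩⟩) |>.comp e.surjective)
  have : Nontrivial M := inferInstanceAs (Nontrivial (ZMod 2))
  have : Finite X := by
    by_contra h
    rw [not_finite_iff_infinite] at h
    exact not_finite (X → M)
  have hcard := Nat.card_congr (e.trans (Equiv.prodCongr (Equiv.refl _) e'))
  have hQ : Nat.card {q : Q // q ≠ 1} + 1 = Nat.card Q := by
    have := Fintype.ofFinite Q
    rw [Nat.card_eq_fintype_card, Nat.card_eq_fintype_card, Fintype.card_subtype_compl,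
      Fintype.card_subtype_eq]
    exact Nat.sub_add_cancel Fintype.card_pos
  rw [Nat.card_prod, Nat.card_fun, Nat.card_fun, Nat.card_fun, Nat.card_fun, hM, ← pow_mul,
    ← pow_add, Nat.card_fin] at hcard
  have hX : Nat.card X = Nat.card Q * (n - 1) + 1 := by
    -- Comparing exponents gives `n|Q| = |X| + (|Q| - 1)`; the last summand comes from the
    -- normalization `f 1 = 1`.
    have h := Nat.pow_right_injective le_rfl hcard
    obtain ⟨n, rfl⟩ := Nat.exists_eq_succ_of_ne_zero hn.ne'
    simp only [Nat.succ_eq_add_one, Nat.add_sub_cancel]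
    rw [Nat.succ_eq_add_one, mul_add, mul_one] at h
    omega
  exact ⟨(FreeGroup.freeGroupCongr ((Finite.equivFin X).trans (finCongr hX))).symm.trans
    (IsFreeGroup.mulEquiv ρ.ker)⟩

end Rank

/-! ### Writing a 4-cocycle as a cup product with the extension class -/

/-- Over a free group, a 4-cocycle `π` of the quotient `Q` is cohomologous to the cup product of a
2-cocycle `β` with values in the characters of the kernel and of the extension class; `γ` is the
cochain relating the two. -/
theorem exists_characters_of_cocycle {n Q M : Type*} [Group Q] [CommGroup M]
    (ρ : FreeGroup n →* Q) (s : Q → FreeGroup n) (hs : ∀ q, ρ (s q) = q)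
    {π : Q → Q → Q → Q → M} (hπ : IsNormalizedCocycle₄ π) :
    ∃ (β : Q → Q → FreeGroup n → M) (γ : Q → Q → Q → M),
      (∀ a b σ τ, ρ σ = 1 → β a b (σ * τ) = β a b σ * β a b τ) ∧
      (∀ a b c σ, ρ σ = 1 → β b c σ * β a (b * c) σ = β (a * b) c σ * β a b (s c * σ * (s c)⁻¹)) ∧
      (∀ q r x y, γ r x y * γ q (r * x) y * γ q r x =
        π q r x y * (γ q r (x * y) * β q r (s x * s y * (s (x * y))⁻¹) * γ (q * r) x y)) ∧
      (∀ a σ, β 1 a σ = 1) ∧ (∀ a σ, β a 1 σ = 1) ∧ (∀ a b, γ a 1 b = 1) := by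
  -- The first two arguments of `π` are parameters, the third is the variable in `Q`, and the last
  -- is the image of a generator. The values agree with `π` only on generators; the discrepancy
  -- elsewhere is what `β` and `γ` record.
  choose D hD hDof using fun a b =>
    exists_isCrossedHom ρ fun i (x : Q) => π a b x (ρ (.of i))
  have hnorm : ∀ a b, (a = 1 ∨ b = 1) → ∀ g x, D a b g x = 1 := by
    intro a b hab
    have := (hD a b).ext_of (E := fun _ _ => 1) ⟨fun _ _ _ => (mul_one _).symm⟩ fun i x => by
      rw [hDof]
      exact hπ.normalized _ _ _ _ (by tauto)
    intro g x
    rw [this]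
  -- Both sides, after moving the two `π` factors into the quotient of a principal crossed
  -- homomorphism, are crossed homomorphisms in `g`. On a generator the identity is the cocycle
  -- condition with `d = x` and `e` the image of the generator.
  have hcoc : ∀ a b c g x, D b c g x * D a (b * c) g x * π a b c (x * ρ g) =
      D (a * b) c g x * D a b g (c * x) * π a b c x := by
    intro a b c g x
    have := (((hD b c).mul (hD a (b * c))).mul (IsCrossedHom.principal ρ (π a b c))).ext_of
      ((hD (a * b) c).mul ((hD a b).translate c)) fun i x => by
        simp only [Pi.mul_apply, hDof]
        rw [← mul_div_assoc, hπ.cocycle, mul_div_cancel_right]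
    have := congrFun (congrFun this g) x
    simp only [Pi.mul_apply] at this
    rw [← this, ← mul_div_assoc, div_mul_cancel]
  -- The inverses place `π` on the side of the equation that the pentagon axiom prescribes.
  refine ⟨fun a b g => (D a b g 1)⁻¹, fun a b c => (D a b (s c) 1)⁻¹, ?_, ?_, ?_, ?_, ?_, ?_⟩ <;>
    beta_reduce
  · intro a b σ τ hσ
    rw [(hD a b).map_mul_of_mem_ker hσ, mul_inv]
  · intro a b c σ hσ
    have := hcoc a b c σ 1
    rw [hσ, mul_one, mul_one, mul_left_inj] at this
    rw [(hD a b).conj hσ, hs, ← mul_inv, ← mul_inv, this]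
  · intro q r x y
    -- At the lift `s y` and base point `1` the identity contains `π q r x y`, and its partner `π q
    -- r x 1` is trivial by normalization. The one value taken at `x` instead of `1` is then
    -- absorbed by the factor set `s x * s y * (s (x * y))⁻¹`.
    have h := hcoc q r x (s y) 1
    rw [hs, one_mul, mul_one, hπ.normalized q r x 1 (by tauto), mul_one] at h
    have h1 := (hD q r).map_inv (s (x * y)) 1
    rw [one_mul, hs] at h1
    have h2 : D q r (s x * s y * (s (x * y))⁻¹) 1 =
        D q r (s x) 1 * D q r (s y) x * (D q r (s (x * y)) 1)⁻¹ := by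
      rw [(hD q r).map_mul, (hD q r).map_mul, map_mul, hs, hs, one_mul, one_mul, h1]
    rw [h2]
    have h3 : D q r (s y) x = D r x (s y) 1 * D q (r * x) (s y) 1 * π q r x y *
        (D (q * r) x (s y) 1)⁻¹ := by
      rw [h, mul_inv_cancel_comm]
    rw [h3]
    simp only [mul_inv, inv_inv]
    generalize D r x (s y) 1 = a1
    generalize D q (r * x) (s y) 1 = a2
    generalize D (q * r) x (s y) 1 = a3
    generalize D q r (s x) 1 = a4
    generalize D q r (s (x * y)) 1 = a5
    generalize π q r x y = p
    calc _ = a1⁻¹ * a2⁻¹ * a4⁻¹ * (p * p⁻¹) * (a5 * a5⁻¹) * (a3 * a3⁻¹) := by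
          simp only [mul_inv_cancel, mul_one]
      _ = _ := by ac_rfl
  · intro a σ; rw [hnorm _ _ (Or.inl rfl), inv_one]
  · intro a σ; rw [hnorm _ _ (Or.inr rfl), inv_one]
  · intro a b; rw [hnorm _ _ (Or.inr rfl), inv_one]

end CrossedHom

/-! ### Coherence of the isomorphisms of a group action -/

section Tiles
open Functor.LaxMonoidal Functor.OplaxMonoidal

namespace TensorAction

variable {k : Type w} [Field k] {C : Type u} [Category.{v} C]
    [Preadditive C] [Linear k C] [MonoidalCategory C] {G : Type*} [Group G]
    (A : TensorAction k G C)

/-- The isomorphism `g_* h_* ≅ l_*` for `gh = l`. -/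
def compIso {g h l : G} (e : g * h = l) :
    (A.aut h).functor ⋙ (A.aut g).functor ≅ (A.aut l).functor :=
  A.mulIso g h ≪≫ LinearMonoidalAutoequiv.castIso A.aut e

instance {g h l : G} (e : g * h = l) : NatTrans.IsMonoidal (A.compIso e).hom :=
  inferInstanceAs (NatTrans.IsMonoidal
    ((A.mulIso g h).hom ≫ (LinearMonoidalAutoequiv.castIso A.aut e).hom))

/-- The isomorphism `e_* ≅ id` for `e = 1`. -/
def unitIso {e : G} (he : e = 1) : (A.aut e).functor ≅ 𝟭 C :=
  LinearMonoidalAutoequiv.castIso A.aut he ≪≫ A.oneIso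

instance {e : G} (he : e = 1) : NatTrans.IsMonoidal (A.unitIso he).hom :=
  inferInstanceAs (NatTrans.IsMonoidal
    ((LinearMonoidalAutoequiv.castIso A.aut he).hom ≫ A.oneIso.hom))

theorem compIso_assoc {g h l gh hl x : G} (e₁ : g * h = gh) (e₂ : gh * l = x) (e₃ : h * l = hl)
    (e₄ : g * hl = x) (V : C) :
    (A.compIso e₁).hom.app ((A.aut l).functor.obj V) ≫ (A.compIso e₂).hom.app V =
      (A.aut g).functor.map ((A.compIso e₃).hom.app V) ≫ (A.compIso e₄).hom.app V := by
  subst e₁ e₃ e₂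
  have := A.assoc g h l V
  simpa [compIso, LinearMonoidalAutoequiv.castIso_refl] using this

theorem compIso_one_left {e g : G} (he : e = 1) (h : e * g = g) (V : C) :
    (A.compIso h).hom.app V = (A.unitIso he).hom.app ((A.aut g).functor.obj V) := by
  subst he
  have := A.one_mul g V
  simpa [compIso, unitIso, LinearMonoidalAutoequiv.castIso_refl] using this

theorem compIso_one_right {e g : G} (he : e = 1) (h : g * e = g) (V : C) :
    (A.compIso h).hom.app V = (A.aut g).functor.map ((A.unitIso he).hom.app V) := by
  subst he
  have := A.mul_one g V
  simpa [compIso, unitIso, LinearMonoidalAutoequiv.castIso_refl] using this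

/-- The isomorphism `g_* h_* ≅ g'_* h'_*` for `gh = g'h'`. -/
def exchIso {g h g' h' : G} (e : g * h = g' * h') :
    (A.aut h).functor ⋙ (A.aut g).functor ≅ (A.aut h').functor ⋙ (A.aut g').functor :=
  A.compIso e ≪≫ (A.compIso rfl).symm

instance {g h g' h' : G} (e : g * h = g' * h') : NatTrans.IsMonoidal (A.exchIso e).hom :=
  inferInstanceAs (NatTrans.IsMonoidal ((A.compIso e).hom ≫ (A.compIso rfl).inv))

/-- An exchange isomorphism becomes a composition isomorphism once followed by the collapse to a
single functor. As the collapse is invertible, relations among exchange isomorphisms follow from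
associativity of the action after collapsing both sides. -/
theorem exchIso_comp {g h g' h' x : G} (e : g * h = g' * h') (e₁ : g' * h' = x) (V : C) :
    (A.exchIso e).hom.app V ≫ (A.compIso e₁).hom.app V = (A.compIso (e.trans e₁)).hom.app V := by
  subst e₁
  simp [exchIso]

/-- The part of the interchange law for tiles that concerns the group action alone. -/
theorem exchIso_interchange {g'' h' g' s' h s g a b : G} (e₁ : g'' * h' = g' * s')
    (e₂ : s' * h = g * s) (ea : g' * g = a) (eb : h' * h = b) (e : g'' * b = a * s) (V : C) :
    (A.exchIso e₁).hom.app ((A.aut h).functor.obj V) ≫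
        (A.aut g').functor.map ((A.exchIso e₂).hom.app V) ≫
        (A.compIso ea).hom.app ((A.aut s).functor.obj V) =
      (A.aut g'').functor.map ((A.compIso eb).hom.app V) ≫ (A.exchIso e).hom.app V := by
  have h₁ : g' * (g * s) = a * s := by rw [← ea, mul_assoc]
  have h₂ : g' * s' * h = a * s := by rw [mul_assoc, e₂, h₁]
  rw [← cancel_mono ((A.compIso (rfl : a * s = a * s)).hom.app V)]
  simp only [Category.assoc]
  rw [A.compIso_assoc ea rfl rfl h₁, ← Functor.map_comp_assoc, A.exchIso_comp, A.exchIso_comp,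
    ← A.compIso_assoc rfl h₂ e₂ h₁, reassoc_of% A.exchIso_comp, A.compIso_assoc e₁ h₂ eb]

/-- The part of the associativity of horizontal composition of tiles that concerns the group action
alone. -/
theorem exchIso_compIso_inv {s' t' m' s t m g h l : G} (e₁ : s' * h = g * s) (e₂ : t' * l = h * t)
    (e : m' * l = g * m) (em' : s' * t' = m') (em : s * t = m) (V : C) :
    (A.exchIso e).hom.app V ≫ (A.aut g).functor.map ((A.compIso em).inv.app V) =
      (A.compIso em').inv.app ((A.aut l).functor.obj V) ≫
        (A.aut s').functor.map ((A.exchIso e₂).hom.app V) ≫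
          (A.exchIso e₁).hom.app ((A.aut t).functor.obj V) := by
  have h₁ : g * s * t = g * m := by rw [mul_assoc, em]
  have h₂ : s' * (h * t) = g * m := by rw [← mul_assoc, e₁, h₁]
  rw [← cancel_mono ((A.aut g).functor.map ((A.compIso em).hom.app V)),
    ← cancel_mono ((A.compIso (rfl : g * m = g * m)).hom.app V),
    ← cancel_epi ((A.compIso em').hom.app ((A.aut l).functor.obj V))]
  simp only [Category.assoc, ← Functor.map_comp_assoc, Iso.inv_hom_id_app,
    CategoryTheory.Functor.map_id, Category.id_comp, Iso.hom_inv_id_app_assoc]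
  rw [A.exchIso_comp, ← A.compIso_assoc rfl h₁, reassoc_of% A.exchIso_comp,
    A.compIso_assoc e₁ h₁ rfl h₂, ← Functor.map_comp_assoc, A.exchIso_comp, A.compIso_assoc]

theorem exchIso_unitIso {e e' g : G} (he : e = 1) (he' : e' = 1) (h : e * g = g * e') (V : C) :
    (A.exchIso h).hom.app V ≫ (A.aut g).functor.map ((A.unitIso he').hom.app V) =
      (A.unitIso he).hom.app ((A.aut g).functor.obj V) := by
  rw [← A.compIso_one_right he' (by simp [he']), A.exchIso_comp, A.compIso_one_left he]

theorem exchIso_unitIso' {e e' g : G} (he : e = 1) (he' : e' = 1) (h : g * e = e' * g) (V : C) :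
    (A.exchIso h).hom.app V ≫ (A.unitIso he').hom.app ((A.aut g).functor.obj V) =
      (A.aut g).functor.map ((A.unitIso he).hom.app V) := by
  rw [← A.compIso_one_left he' (by simp [he']), A.exchIso_comp, A.compIso_one_right he]

end TensorAction

/-! ### Tiles: a double category of squares between homogeneous objects -/

namespace CrossedObj

section coh
variable {C : Type u} [Category.{v} C] [MonoidalCategory C]

/-- Stated for arbitrary monoidal functors, so that the monoidal bookkeeping is separated from the
group action, which enters only through `h`. -/
theorem coh_tile_assoc (S' S H M' g : C ⥤ C) [S'.Monoidal] [S.Monoidal] [H.Monoidal]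
    [g.Monoidal] (E : H ⋙ S' ⟶ S ⋙ g) [NatTrans.IsMonoidal E]
    {V' V W' W P' P Z' R : C} (n : V' ⟶ g.obj V) (p : W' ⟶ H.obj W)
    (c' : M'.obj Z' ⟶ S'.obj P') (q : P' ⟶ H.obj P) (d : M'.obj Z' ⟶ g.obj R)
    (c : R ⟶ S.obj P) (h : d ≫ g.map c = c' ≫ S'.map q ≫ E.app P) :
    ((α_ V' (S'.obj W') (M'.obj Z')).hom ≫ V' ◁ (S'.obj W' ◁ c' ≫ μ S' W' P')) ≫
      (n ⊗ₘ (S'.map ((p ⊗ₘ q) ≫ μ H W P) ≫ E.app (W ⊗ P))) ≫ μ g V (S.obj (W ⊗ P)) =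
    ((((n ⊗ₘ (S'.map p ≫ E.app W)) ≫ μ g V (S.obj W)) ⊗ₘ d) ≫ μ g (V ⊗ S.obj W) R) ≫
      g.map ((α_ V (S.obj W) R).hom ≫ V ◁ (S.obj W ◁ c ≫ μ S W P)) := by
  have hE := NatTrans.IsMonoidal.tensor (τ := E) W P
  simp only [Functor.LaxMonoidal.comp_μ, Category.assoc] at hE
  -- This is the claim with the first tensor factor stripped off: monoidality of `E` carries it past
  -- `μ`, and `h` settles the last factor.
  have key : (S'.obj W' ◁ c' ≫ μ S' W' P') ≫ S'.map ((p ⊗ₘ q) ≫ μ H W P) ≫ E.app (W ⊗ P) =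
      ((S'.map p ≫ E.app W) ⊗ₘ d) ≫ μ g (S.obj W) R ≫ g.map (S.obj W ◁ c ≫ μ S W P) := by
    simp only [Functor.map_comp, Category.assoc]
    rw [← μ_natural_assoc, hE, ← μ_natural_right_assoc]
    simp only [← Category.assoc]
    congr 2
    simp only [← id_tensorHom, tensorHom_comp_tensorHom, Category.id_comp,
      Category.assoc, h]
    simp
  rw [Category.assoc, ← id_tensorHom V', tensorHom_comp_tensorHom_assoc, Category.id_comp, key]
  have h1 : ((n ⊗ₘ (S'.map p ≫ E.app W)) ≫ μ g V (S.obj W)) ⊗ₘ d =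
      ((n ⊗ₘ (S'.map p ≫ E.app W)) ⊗ₘ d) ≫ μ g V (S.obj W) ▷ g.obj R := by
    rw [← tensorHom_id, tensorHom_comp_tensorHom, Category.comp_id]
  rw [h1]
  simp only [Category.assoc, Functor.map_comp g (α_ _ _ _).hom]
  rw [Functor.LaxMonoidal.associativity_assoc, ← μ_natural_right]
  dsimp only [Functor.comp_obj]
  rw [associator_naturality_assoc]
  simp only [← id_tensorHom, tensorHom_comp_tensorHom_assoc, Category.comp_id]

/-- Naturality of `E₁` and monoidality of `κ` bring both stackings to one form; what remains is the
hypothesis `h` on the action. -/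
theorem coh_tile_interchange (S'' H' S' H g' g a b S : C ⥤ C) [S''.Monoidal] [g'.Monoidal]
    [g.Monoidal] [a.Monoidal] (κ : g ⋙ g' ⟶ a) [NatTrans.IsMonoidal κ]
    {V'' V' V W'' W' W : C} (n : V'' ⟶ g'.obj V') (p : V' ⟶ g.obj V) (n₂ : W'' ⟶ H'.obj W')
    (p₂ : W' ⟶ H.obj W) (E₁ : H' ⋙ S'' ⟶ S' ⋙ g') (E₂ : H ⋙ S' ⟶ S ⋙ g)
    (E₃ : b ⋙ S'' ⟶ S ⋙ a) (κ' : H ⋙ H' ⟶ b)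
    (h : E₁.app (H.obj W) ≫ g'.map (E₂.app W) ≫ κ.app (S.obj W) =
      S''.map (κ'.app W) ≫ E₃.app W) :
    ((n ⊗ₘ (S''.map n₂ ≫ E₁.app W')) ≫ μ g' V' (S'.obj W')) ≫
      g'.map ((p ⊗ₘ (S'.map p₂ ≫ E₂.app W)) ≫ μ g V (S.obj W)) ≫ κ.app (V ⊗ S.obj W) =
    ((n ≫ g'.map p ≫ κ.app V) ⊗ₘ (S''.map (n₂ ≫ H'.map p₂ ≫ κ'.app W) ≫ E₃.app W)) ≫
      μ a V (S.obj W) := by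
  have hκ := NatTrans.IsMonoidal.tensor (τ := κ) V (S.obj W)
  simp only [Functor.LaxMonoidal.comp_μ, Category.assoc] at hκ
  have hn := E₁.naturality p₂
  simp only [Functor.comp_map] at hn
  simp only [Functor.comp_obj] at hn h ⊢
  simp only [Functor.map_comp, Category.assoc, ← μ_natural_assoc,
    tensorHom_comp_tensorHom_assoc, ← h, ← reassoc_of% hn]
  rw [hκ, tensorHom_comp_tensorHom_assoc]
  simp only [Category.assoc]

end coh

variable {k : Type w} [Field k] {C : Type u} [Category.{v} C]
    [Preadditive C] [Linear k C] [MonoidalCategory C] {G N : Type*} [Group G] [Group N]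
    {A : TensorAction k G C} {φ : N →* G}

/-- For an action `A` of `G` and `φ : N → G`, an isomorphism in the crossed product of `C` with `G`
between `X' ⊗ [𝟙, h]` and `[𝟙, g] ⊗ X`, where `X'` and `X` are homogeneous objects of the crossed
product with `N`. -/
@[ext]
structure Tile (g h : G) (X' X : CrossedObj (A.restrict φ)) where
  iso : X'.obj ≅ (A.aut g).functor.obj X.obj
  deg : φ X'.deg * h = g * φ X.deg

namespace Tile

/-- The morphism `f'` is carried to `f` by the tiles `n` and `m`. -/
def Over {g h : G} {X' X Y' Y : CrossedObj (A.restrict φ)} (n : Tile g h X' X)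
    (m : Tile g h Y' Y) (f' : X' ⟶ Y') (f : X ⟶ Y) : Prop :=
  f'.1 ≫ m.iso.hom = n.iso.hom ≫ (A.aut g).functor.map f.1

section Over
variable {g h : G} {X' X Y' Y Z' Z : CrossedObj (A.restrict φ)} {n : Tile g h X' X}
    {m : Tile g h Y' Y} {o : Tile g h Z' Z}

theorem Over.id (n : Tile g h X' X) : Over n n (𝟙 X') (𝟙 X) := by
  simp [Over]

theorem Over.comp {f' : X' ⟶ Y'} {f : X ⟶ Y} {e' : Y' ⟶ Z'} {e : Y ⟶ Z} (hf : Over n m f' f)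
    (he : Over m o e' e) : Over n o (f' ≫ e') (f ≫ e) := by
  simp only [Over, comp_val, Category.assoc, Functor.map_comp] at *
  rw [he, reassoc_of% hf]

theorem Over.smul {f' : X' ⟶ Y'} {f : X ⟶ Y} (hf : Over n m f' f) (r : k) :
    Over n m (r • f') (r • f) := by
  simp only [Over, smul_val, Functor.map_smul, Linear.smul_comp, Linear.comp_smul] at *
  rw [hf]

theorem Over.inv {f' : X' ≅ Y'} {f : X ≅ Y} (hf : Over n m f'.hom f.hom) :
    Over m n f'.inv f.inv := by
  have h1 : f'.inv.1 ≫ f'.hom.1 = 𝟙 _ := congrArg Subtype.val f'.inv_hom_id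
  have h2 : f.hom.1 ≫ f.inv.1 = 𝟙 _ := congrArg Subtype.val f.hom_inv_id
  simp only [Over] at *
  calc f'.inv.1 ≫ n.iso.hom = f'.inv.1 ≫ n.iso.hom ≫ (A.aut g).functor.map (f.hom.1 ≫ f.inv.1) := by
        rw [h2, CategoryTheory.Functor.map_id, Category.comp_id]
    _ = _ := by rw [Functor.map_comp, ← reassoc_of% hf, reassoc_of% h1]

/-- The morphism `f'` is recovered from `f` because the tile on its target is invertible. Every
axiom of the anomalous action is proved by this: both sides are exhibited over morphisms whose
equality is a matter of monoidal coherence and scalars. -/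
theorem Over.unique {f' e' : X' ⟶ Y'} {f e : X ⟶ Y} (hf : Over n m f' f) (he : Over n m e' e)
    (h : f = e) : f' = e' := by
  subst h
  ext
  rw [← cancel_mono m.iso.hom]
  exact hf.trans he.symm

end Over

section lift
variable {g h : G} {X' X Y' Y : CrossedObj (A.restrict φ)}

/-- The edges and the lower degree determine `φ X'.deg`, so injectivity of `φ` is what makes lifted
morphisms respect degrees. -/
theorem deg_eq (hφ : Function.Injective φ) (n : Tile g h X' X) (m : Tile g h Y' Y)
    (e : X.deg = Y.deg) : X'.deg = Y'.deg :=
  hφ (mul_right_cancel (n.deg.trans (e ▸ m.deg.symm)))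

/-- The morphism carried to `f` by `n` and `m`. -/
def lift (hφ : Function.Injective φ) (n : Tile g h X' X) (m : Tile g h Y' Y) (f : X ⟶ Y) :
    X' ⟶ Y' :=
  ⟨n.iso.hom ≫ (A.aut g).functor.map f.1 ≫ m.iso.inv, fun e => by
    rw [f.2 fun e' => e (deg_eq hφ n m e'), Functor.map_zero, Limits.zero_comp, Limits.comp_zero]⟩

theorem over_lift (hφ : Function.Injective φ) (n : Tile g h X' X) (m : Tile g h Y' Y)
    (f : X ⟶ Y) : Over n m (lift hφ n m f) f := by
  simp [Over, lift]

/-- The isomorphism carried to `f` by `n` and `m`. -/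
@[simps]
def liftIso (hφ : Function.Injective φ) (n : Tile g h X' X) (m : Tile g h Y' Y) (f : X ≅ Y) :
    X' ≅ Y' where
  hom := lift hφ n m f.hom
  inv := lift hφ m n f.inv
  hom_inv_id := ((over_lift hφ n m f.hom).comp (over_lift hφ m n f.inv)).unique (.id n)
    f.hom_inv_id
  inv_hom_id := ((over_lift hφ m n f.inv).comp (over_lift hφ n m f.hom)).unique (.id m)
    f.inv_hom_id

end lift

section vcomp
variable {g' h' g h a b : G} {X'' X' X Y'' Y' Y : CrossedObj (A.restrict φ)}

/-- Vertical composition of tiles. -/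
def vcomp (n : Tile g' h' X'' X') (p : Tile g h X' X) (ha : g' * g = a) (hb : h' * h = b) :
    Tile a b X'' X where
  iso := n.iso ≪≫ (A.aut g').functor.mapIso p.iso ≪≫ (A.compIso ha).app X.obj
  deg := by rw [← ha, ← hb, ← mul_assoc, n.deg, mul_assoc, p.deg, mul_assoc]

theorem Over.vcomp {n : Tile g' h' X'' X'} {p : Tile g h X' X} {m : Tile g' h' Y'' Y'}
    {q : Tile g h Y' Y} {f'' : X'' ⟶ Y''} {f' : X' ⟶ Y'} {f : X ⟶ Y} (h₁ : Over n m f'' f')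
    (h₂ : Over p q f' f) (ha : g' * g = a) (hb : h' * h = b) :
    Over (n.vcomp p ha hb) (m.vcomp q ha hb) f'' f := by
  have := (A.compIso ha).hom.naturality f.1
  simp only [Over, Tile.vcomp, Iso.trans_hom, Functor.mapIso_hom, Iso.app_hom,
    Category.assoc] at *
  rw [reassoc_of% h₁, ← Functor.map_comp_assoc, h₂, Functor.map_comp_assoc, ← this]
  rfl

theorem vcomp_assoc {g'' h'' c d x y : G} {X''' : CrossedObj (A.restrict φ)}
    (o : Tile g'' h'' X''' X'')
    (n : Tile g' h' X'' X') (p : Tile g h X' X) (ha : g' * g = a) (hb : h' * h = b)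
    (hc : g'' * g' = c) (hd : h'' * h' = d) (hx : c * g = x) (hy : d * h = y)
    (hx' : g'' * a = x) (hy' : h'' * b = y) :
    (o.vcomp n hc hd).vcomp p hx hy = o.vcomp (n.vcomp p ha hb) hx' hy' := by
  have h₁ := (A.compIso hc).hom.naturality p.iso.hom
  have h₂ := A.compIso_assoc hc hx ha hx' X.obj
  simp only [Functor.comp_map] at h₁
  ext
  simp only [Tile.vcomp, Iso.trans_hom, Functor.mapIso_hom, Iso.app_hom, Category.assoc,
    Functor.map_comp, ← h₂, reassoc_of% h₁]

end vcomp

section unit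
variable [MonoidalPreadditive C]

/-- The tile given by `𝟙 ≅ g_* 𝟙`, for an object `[𝟙, u]` with `u h = g`. -/
noncomputable def unit (u : N) (g h : G) (hu : φ u * h = g) :
    Tile g h (⟨𝟙_ C, u⟩ : CrossedObj (A.restrict φ)) (𝟙_ (CrossedObj (A.restrict φ))) where
  iso := Functor.Monoidal.εIso (A.aut g).functor
  deg := by
    change φ u * h = g * φ 1
    rw [map_one, mul_one, hu]

/-- The tile given by `𝟙 ≅ g_* 𝟙` for the unit object. -/
noncomputable def one (g : G) :
    Tile g g (𝟙_ (CrossedObj (A.restrict φ))) (𝟙_ (CrossedObj (A.restrict φ))) :=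
  unit 1 g g (by simp)

/-- Stacking on a unit tile only multiplies the edges on the right. This serves to pad tiles until
neighbouring edges match. -/
theorem unit_vcomp_one (u : N) {g h g' a b : G} (hu : φ u * h = g) (ha : g * g' = a)
    (hb : h * g' = b) :
    (unit (A := A) u g h hu).vcomp (one g') ha hb =
      unit u a b (by rw [← ha, ← hb, ← mul_assoc, hu]) := by
  ext
  have := NatTrans.IsMonoidal.unit (τ := (A.compIso ha).hom)
  rw [Functor.LaxMonoidal.comp_ε, Category.assoc] at this
  exact this

theorem one_vcomp_one {g g' a : G} (ha : g * g' = a) :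
    (one (A := A) (φ := φ) g).vcomp (one g') ha ha = one a :=
  unit_vcomp_one 1 (by simp) ha ha

end unit

section refl
variable {g h : G} {X' X : CrossedObj (A.restrict φ)}

/-- The tile given by `X ≅ 1_* X`. -/
def refl (X : CrossedObj (A.restrict φ)) : Tile 1 1 X X where
  iso := ((A.unitIso rfl).app X.obj).symm
  deg := by simp

theorem refl_vcomp (p : Tile g h X' X) :
    (refl X').vcomp p (one_mul g) (one_mul h) = p := by
  ext
  have := (A.unitIso rfl).hom.naturality p.iso.hom
  simp [vcomp, refl, A.compIso_one_left rfl (one_mul g), this]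

theorem vcomp_refl (p : Tile g h X' X) :
    p.vcomp (refl X) (mul_one g) (mul_one h) = p := by
  ext
  simp [vcomp, refl, A.compIso_one_right rfl (mul_one g), ← Functor.map_comp]

variable [MonoidalPreadditive C]

theorem refl_unit : refl (𝟙_ (CrossedObj (A.restrict φ))) = one 1 := by
  ext
  have := NatTrans.IsMonoidal.unit (τ := (A.unitIso rfl).inv)
  simpa using! this

end refl

section tensor
variable [MonoidalPreadditive C]
variable {g h l : G} {X' X Y' Y Z' Z : CrossedObj (A.restrict φ)}

/-- Horizontal composition of tiles. -/
noncomputable def tensor (n : Tile g h X' X) (p : Tile h l Y' Y) : Tile g l (X' ⊗ Y') (X ⊗ Y) where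
  iso := (n.iso ⊗ᵢ ((A.aut (φ X'.deg)).functor.mapIso p.iso ≪≫ (A.exchIso n.deg).app Y.obj)) ≪≫
    Functor.Monoidal.μIso (A.aut g).functor X.obj ((A.aut (φ X.deg)).functor.obj Y.obj)
  deg := by
    change φ (X'.deg * Y'.deg) * l = g * φ (X.deg * Y.deg)
    rw [map_mul, map_mul, mul_assoc, p.deg, ← mul_assoc, n.deg, mul_assoc]

theorem tensor_iso_hom (n : Tile g h X' X) (p : Tile h l Y' Y) : (n.tensor p).iso.hom =
    (n.iso.hom ⊗ₘ ((A.aut (φ X'.deg)).functor.map p.iso.hom ≫ (A.exchIso n.deg).hom.app Y.obj)) ≫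
      μ (A.aut g).functor X.obj ((A.aut (φ X.deg)).functor.obj Y.obj) := rfl

theorem Over.whiskerLeft (n : Tile g h X' X) {p : Tile h l Y' Y} {q : Tile h l Z' Z}
    {f' : Y' ⟶ Z'} {f : Y ⟶ Z} (hf : Over p q f' f) :
    Over (n.tensor p) (n.tensor q) (X' ◁ f') (X ◁ f) := by
  have := (A.exchIso n.deg).hom.naturality f.1
  simp only [Functor.comp_map] at this
  simp only [Over, tensor_iso_hom, whiskerLeft_val] at *
  change (X'.obj ◁ (A.aut (φ X'.deg)).functor.map f'.1) ≫ (_ ⊗ₘ _) ≫ _ =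
    (_ ≫ _) ≫ (A.aut g).functor.map (X.obj ◁ (A.aut (φ X.deg)).functor.map f.1)
  rw [Category.assoc, ← μ_natural_right, ← id_tensorHom, ← id_tensorHom,
    tensorHom_comp_tensorHom_assoc, tensorHom_comp_tensorHom_assoc, ← Functor.map_comp_assoc, hf,
    Category.id_comp, Category.comp_id, Functor.map_comp, Category.assoc, Category.assoc, ← this]

theorem Over.whiskerRight {n : Tile g h X' X} {m : Tile g h Y' Y} {f' : X' ⟶ Y'} {f : X ⟶ Y}
    (hf : Over n m f' f) (p : Tile h l Z' Z) :
    Over (n.tensor p) (m.tensor p) (f' ▷ Z') (f ▷ Z) := by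
  by_cases e' : X'.deg = Y'.deg
  · by_cases e : X.deg = Y.deg
    · obtain ⟨X', σ'⟩ := X'
      obtain ⟨Y', τ'⟩ := Y'
      obtain ⟨X, σ⟩ := X
      obtain ⟨Y, τ⟩ := Y
      obtain rfl : σ' = τ' := e'
      obtain rfl : σ = τ := e
      have h1 := whiskerRight_val f' rfl Z'
      have h2 := whiskerRight_val f rfl Z
      simp only [LinearMonoidalAutoequiv.castIso_refl, Iso.refl_hom, NatTrans.id_app,
        MonoidalCategory.whiskerLeft_id, Category.comp_id] at h1 h2
      simp only [Over, tensor_iso_hom] at *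
      rw [h1, h2]
      change (f'.1 ▷ (A.aut (φ σ')).functor.obj Z'.obj) ≫
        (m.iso.hom ⊗ₘ ((A.aut (φ σ')).functor.map p.iso.hom ≫ (A.exchIso m.deg).hom.app Z.obj)) ≫
          μ (A.aut g).functor Y ((A.aut (φ σ)).functor.obj Z.obj) =
        ((n.iso.hom ⊗ₘ ((A.aut (φ σ')).functor.map p.iso.hom ≫ (A.exchIso n.deg).hom.app Z.obj)) ≫
          μ (A.aut g).functor X ((A.aut (φ σ)).functor.obj Z.obj)) ≫
          (A.aut g).functor.map (f.1 ▷ (A.aut (φ σ)).functor.obj Z.obj)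
      rw [Category.assoc, ← μ_natural_left, ← tensorHom_id, ← tensorHom_id,
        tensorHom_comp_tensorHom_assoc, tensorHom_comp_tensorHom_assoc, hf, Category.id_comp]
      simp
    -- When degrees differ on one level, that morphism vanishes, and so does the other one: going up
    -- by invertibility of the tile, going down by faithfulness of `g_*`.
    · have h1 : f = 0 := eq_zero_of_deg_ne f e
      have h2 : f' = 0 := by
        ext
        subst h1
        simpa [Over] using hf
      simp [h1, h2, Over]
  · have h2 : f' = 0 := eq_zero_of_deg_ne f' e'
    have h1 : f = 0 := by
      ext
      apply (A.aut g).functor.map_injective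
      subst h2
      simpa [Over] using hf.symm
    simp [h1, h2, Over]

/-- Horizontal composition of tiles is associative up to the associators of the two rows. Hence an
associator upstairs may be replaced by the one below; the two unitor statements play the same role.
-/
theorem over_associator {r : G} (n : Tile g h X' X) (p : Tile h l Y' Y) (o : Tile l r Z' Z) :
    Over ((n.tensor p).tensor o) (n.tensor (p.tensor o)) (α_ X' Y' Z').hom (α_ X Y Z).hom := by
  refine coh_tile_assoc (A.aut (φ X'.deg)).functor (A.aut (φ X.deg)).functor (A.aut h).functor
    (A.aut (φ (X'.deg * Y'.deg))).functor (A.aut g).functor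
    (A.exchIso n.deg).hom n.iso.hom p.iso.hom _ _ _ _ ?_
  have h₁ := (A.compIso (map_mul φ X'.deg Y'.deg).symm).inv.naturality o.iso.hom
  have h₂ := A.exchIso_compIso_inv n.deg p.deg (n.tensor p).deg (map_mul φ X'.deg Y'.deg).symm
    (map_mul φ X.deg Y.deg).symm Z.obj
  simp only [Functor.comp_map] at h₁
  change ((A.aut (φ (X'.deg * Y'.deg))).functor.map o.iso.hom ≫
    (A.exchIso (n.tensor p).deg).hom.app Z.obj) ≫
      (A.aut g).functor.map ((A.compIso (map_mul φ X.deg Y.deg).symm).inv.app Z.obj) =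
    (A.compIso (map_mul φ X'.deg Y'.deg).symm).inv.app Z'.obj ≫
      (A.aut (φ X'.deg)).functor.map ((A.aut (φ Y'.deg)).functor.map o.iso.hom ≫
        (A.exchIso p.deg).hom.app Z.obj) ≫
      (A.exchIso n.deg).hom.app ((A.aut (φ Y.deg)).functor.obj Z.obj)
  rw [Category.assoc, Functor.map_comp, Category.assoc, ← reassoc_of% h₁]
  exact congrArg _ h₂

theorem over_leftUnitor (n : Tile g h X' X) :
    Over ((one g).tensor n) n (λ_ X').hom (λ_ X).hom := by
  have h₁ := A.exchIso_unitIso (map_one φ) (map_one φ) (one (A := A) (φ := φ) g).deg X.obj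
  have h₂ := (A.unitIso (map_one φ)).hom.naturality n.iso.hom
  have h₃ := Functor.LaxMonoidal.left_unitality (A.aut g).functor X.obj
  change (𝟙_ C ◁ (A.unitIso (map_one φ)).hom.app X'.obj ≫ (λ_ X'.obj).hom) ≫ n.iso.hom =
    ((ε (A.aut g).functor ⊗ₘ ((A.aut (φ 1)).functor.map n.iso.hom ≫
      (A.exchIso (one (A := A) (φ := φ) g).deg).hom.app X.obj)) ≫
      μ (A.aut g).functor (𝟙_ C) ((A.aut (φ 1)).functor.obj X.obj)) ≫
      (A.aut g).functor.map (𝟙_ C ◁ (A.unitIso (map_one φ)).hom.app X.obj ≫ (λ_ X.obj).hom)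
  simp only [Functor.id_map, Functor.comp_obj, Functor.id_obj] at h₁ h₂
  rw [Functor.map_comp, Category.assoc, Category.assoc, ← μ_natural_right_assoc, ← id_tensorHom,
    ← id_tensorHom, tensorHom_comp_tensorHom_assoc, Category.assoc, h₁, h₂]
  simp only [Functor.id_obj]
  rw [Category.comp_id, MonoidalCategory.tensorHom_def' (ε _), Category.assoc, ← h₃]
  simp

theorem over_rightUnitor (n : Tile g h X' X) :
    Over (n.tensor (one h)) n (ρ_ X').hom (ρ_ X).hom := by
  have h₁ := NatTrans.IsMonoidal.unit (τ := (A.exchIso n.deg).hom)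
  have h₃ := Functor.LaxMonoidal.right_unitality (A.aut g).functor X.obj
  change (X'.obj ◁ η (A.aut (φ X'.deg)).functor ≫ (ρ_ X'.obj).hom) ≫ n.iso.hom =
    ((n.iso.hom ⊗ₘ ((A.aut (φ X'.deg)).functor.map (ε (A.aut h).functor) ≫
      (A.exchIso n.deg).hom.app (𝟙_ C))) ≫
      μ (A.aut g).functor X.obj ((A.aut (φ X.deg)).functor.obj (𝟙_ C))) ≫
      (A.aut g).functor.map (X.obj ◁ η (A.aut (φ X.deg)).functor ≫ (ρ_ X.obj).hom)
  simp only [Functor.LaxMonoidal.comp_ε, Category.assoc] at h₁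
  rw [← cancel_epi (X'.obj ◁ ε (A.aut (φ X'.deg)).functor), Functor.map_comp, Category.assoc,
    Category.assoc, ← μ_natural_right_assoc, ← id_tensorHom, ← id_tensorHom, ← id_tensorHom,
    tensorHom_comp_tensorHom_assoc, tensorHom_comp_tensorHom_assoc, h₁]
  simp only [Functor.comp_obj]
  rw [tensorHom_comp_tensorHom_assoc, Category.assoc (ε _), ← Functor.map_comp,
    Functor.Monoidal.ε_η, Functor.Monoidal.ε_η, CategoryTheory.Functor.map_id, Category.comp_id,
    Category.comp_id, Category.comp_id, Category.id_comp, MonoidalCategory.tensorHom_def n.iso.hom,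
    Category.assoc, ← h₃]
  simp

/-- The interchange law of the double category. It regroups a vertical stack of horizontal
composites into a form where the next square can be attached. -/
theorem tensor_vcomp_tensor {g' h' l' a b c : G} {X'' Y'' : CrossedObj (A.restrict φ)}
    (n : Tile g' h' X'' X') (n₂ : Tile h' l' Y'' Y') (p : Tile g h X' X) (p₂ : Tile h l Y' Y)
    (ha : g' * g = a) (hb : h' * h = b) (hc : l' * l = c) :
    (n.tensor n₂).vcomp (p.tensor p₂) ha hc = (n.vcomp p ha hb).tensor (n₂.vcomp p₂ hb hc) := by
  apply Tile.ext
  ext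
  exact coh_tile_interchange (A.aut (φ X''.deg)).functor (A.aut h').functor
    (A.aut (φ X'.deg)).functor (A.aut h).functor (A.aut g').functor (A.aut g).functor
    (A.aut a).functor (A.aut b).functor (A.aut (φ X.deg)).functor (A.compIso ha).hom
    n.iso.hom p.iso.hom n₂.iso.hom p₂.iso.hom (A.exchIso n.deg).hom (A.exchIso p.deg).hom
    (A.exchIso _).hom (A.compIso hb).hom (A.exchIso_interchange _ _ _ _ _ _)

theorem refl_tensor_refl (X Y : CrossedObj (A.restrict φ)) :
    (refl X).tensor (refl Y) = refl (X ⊗ Y) := by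
  ext
  have h₁ := A.exchIso_unitIso' rfl rfl (refl X).deg Y.obj
  have h₂ := NatTrans.IsMonoidal.tensor (τ := (A.unitIso (rfl : (1 : G) = 1)).inv) X.obj
    ((A.aut (φ X.deg)).functor.obj Y.obj)
  have h₃ : (A.aut (φ X.deg)).functor.map ((A.unitIso (rfl : (1 : G) = 1)).inv.app Y.obj) ≫
      (A.exchIso (refl X).deg).hom.app Y.obj =
        (A.unitIso (rfl : (1 : G) = 1)).inv.app ((A.aut (φ X.deg)).functor.obj Y.obj) := by
    rw [← cancel_mono ((A.unitIso (rfl : (1 : G) = 1)).hom.app _), Category.assoc, h₁,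
      ← Functor.map_comp]
    simp
  change ((A.unitIso rfl).inv.app X.obj ⊗ₘ
    ((A.aut (φ X.deg)).functor.map ((A.unitIso (rfl : (1 : G) = 1)).inv.app Y.obj) ≫
      (A.exchIso (refl X).deg).hom.app Y.obj)) ≫ _ = _
  rw [h₃]
  exact h₂.symm.trans (Category.id_comp _)

theorem Over.tensorHom {n : Tile g h X' X} {m : Tile g h Y' Y} {f' : X' ⟶ Y'} {f : X ⟶ Y}
    (hf : Over n m f' f) {W' W : CrossedObj (A.restrict φ)} {p : Tile h l Z' Z}
    {q : Tile h l W' W} {e' : Z' ⟶ W'} {e : Z ⟶ W} (he : Over p q e' e) :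
    Over (n.tensor p) (m.tensor q) (f' ⊗ₘ e') (f ⊗ₘ e) := by
  rw [MonoidalCategory.tensorHom_def, MonoidalCategory.tensorHom_def]
  exact (hf.whiskerRight p).comp (he.whiskerLeft m)

end tensor
end Tile
end CrossedObj
end Tiles

/-- A scalar multiple of an isomorphism by an invertible scalar. -/
@[simps]
def unitsSMulIso {k : Type w} [Field k] {C : Type u} [Category.{v} C] [Preadditive C] [Linear k C]
    {X Y : C} (c : kˣ) (e : X ≅ Y) : X ≅ Y where
  hom := (c : k) • e.hom
  inv := ((c⁻¹ : kˣ) : k) • e.inv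
  hom_inv_id := by simp [Linear.comp_smul, Linear.smul_comp, smul_smul]
  inv_hom_id := by simp [Linear.comp_smul, Linear.smul_comp, smul_smul]

/-! ### Conjugation on the crossed product with a normal subgroup -/

/-- An isomorphism from `N` to a normal subgroup of `G`, with the resulting action of `G` on `N` by
conjugation. -/
structure NormalEmbedding {G N : Type*} [Group G] [Group N] (φ : N →* G) where
  injective : Function.Injective φ
  conj : G → N ≃* N
  conj_spec (g : G) (σ : N) : φ (conj g σ) = g * φ σ * g⁻¹

namespace NormalEmbedding
open Functor.LaxMonoidal Functor.OplaxMonoidal CrossedObj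

variable {k : Type w} [Field k] {C : Type u} [Category.{v} C]
    [Preadditive C] [Linear k C] [MonoidalCategory C] {G N : Type*} [Group G] [Group N]
    {φ : N →* G} (S : NormalEmbedding φ) (A : TensorAction k G C)

/-- The functor `[V, σ] ↦ [g_* V, gσg⁻¹]`. -/
@[simps]
def functor (g : G) : CrossedObj (A.restrict φ) ⥤ CrossedObj (A.restrict φ) where
  obj X := ⟨(A.aut g).functor.obj X.obj, S.conj g X.deg⟩
  map f := ⟨(A.aut g).functor.map f.1, fun h => by
    rw [f.2 fun e => h (congrArg (S.conj g) e), Functor.map_zero]⟩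
  map_id X := by ext; exact (A.aut g).functor.map_id _
  map_comp f f' := by ext; exact (A.aut g).functor.map_comp _ _

instance (g : G) : (S.functor A g).Additive where
  map_add := Subtype.ext (A.aut g).functor.map_add

instance (g : G) : (S.functor A g).Linear k where
  map_smul _ _ := Subtype.ext ((A.aut g).functor.map_smul _ _)

instance (g : G) : (S.functor A g).Faithful where
  map_injective h := by
    ext
    exact (A.aut g).functor.map_injective (congrArg Subtype.val h)

instance (g : G) : (S.functor A g).Full where
  map_surjective {X Y} f := by
    obtain ⟨f', hf'⟩ := (A.aut g).functor.map_surjective (X := X.obj) (Y := Y.obj) f.1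
    refine ⟨⟨f', fun h => ?_⟩, Subtype.ext hf'⟩
    apply (A.aut g).functor.map_injective
    rw [hf', Functor.map_zero]
    exact f.2 fun e => h ((S.conj g).injective e)

instance (g : G) : (S.functor A g).EssSurj where
  mem_essImage Y := ⟨⟨(A.aut g).functor.objPreimage Y.obj, (S.conj g).symm Y.deg⟩,
    ⟨mkIso ((A.aut g).functor.objObjPreimageIso Y.obj) ((S.conj g).apply_symm_apply _)⟩⟩

instance (g : G) : (S.functor A g).IsEquivalence where

/-- The tile relating `[g_* V, gσg⁻¹]` with `[V, σ]`. -/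
def tile {g a : G} (e : g = a) (X : CrossedObj (A.restrict φ)) :
    Tile a a ((S.functor A g).obj X) X where
  iso := (LinearMonoidalAutoequiv.castIso A.aut e).app X.obj
  deg := by simp [S.conj_spec, e]

/-- Applying the conjugation functor does not change the morphism below, so functors disappear from
an equation once it is read over the lower row. -/
theorem over_map {g a : G} (e : g = a) {X Y : CrossedObj (A.restrict φ)} (f : X ⟶ Y) :
    (S.tile A e X).Over (S.tile A e Y) ((S.functor A g).map f) f :=
  cast_naturality A e f.1

theorem over_lift {A : TensorAction k G C} {g h : G} {X' X Y' Y : CrossedObj (A.restrict φ)}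
    (n : Tile g h X' X) (m : Tile g h Y' Y) (f : X ⟶ Y) :
    n.Over m (Tile.lift S.injective n m f) f :=
  Tile.over_lift S.injective n m f

variable [MonoidalPreadditive C]

/-- The functor `[V, σ] ↦ [g_* V, gσg⁻¹]` is monoidal. -/
noncomputable def coreMonoidal (g : G) : (S.functor A g).CoreMonoidal where
  -- The constraints are the lifts of identities, so each axiom of a monoidal functor becomes an
  -- equation in which they are invisible.
  εIso := Tile.liftIso S.injective (Tile.one g) (S.tile A rfl _) (Iso.refl _)
  μIso X Y := Tile.liftIso S.injective ((S.tile A rfl X).tensor (S.tile A rfl Y))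
    (S.tile A rfl (X ⊗ Y)) (Iso.refl _)
  μIso_hom_natural_left {X Y} f Z :=
    Tile.Over.unique (((S.over_map A rfl f).whiskerRight _).comp (S.over_lift _ _ _))
      ((S.over_lift _ _ _).comp (S.over_map A rfl _)) (by simp)
  μIso_hom_natural_right X f :=
    Tile.Over.unique (((S.over_map A rfl f).whiskerLeft _).comp (S.over_lift _ _ _))
      ((S.over_lift _ _ _).comp (S.over_map A rfl _)) (by simp)
  associativity X Y Z :=
    Tile.Over.unique (((S.over_lift _ _ _).whiskerRight _).comp
      ((S.over_lift _ _ _).comp (S.over_map A rfl _)))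
      ((Tile.over_associator ..).comp (((S.over_lift _ _ _).whiskerLeft _).comp
        (S.over_lift _ _ _))) (by simp)
  left_unitality X :=
    Tile.Over.unique (Tile.over_leftUnitor ..) (((S.over_lift _ _ _).whiskerRight _).comp
      ((S.over_lift _ _ _).comp (S.over_map A rfl _))) (by simp)
  right_unitality X :=
    Tile.Over.unique (Tile.over_rightUnitor ..) (((S.over_lift _ _ _).whiskerLeft _).comp
      ((S.over_lift _ _ _).comp (S.over_map A rfl _))) (by simp)

noncomputable instance (g : G) : (S.functor A g).Monoidal := (S.coreMonoidal A g).toMonoidal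

section
variable {g a : G} (e : g = a) (X Y : CrossedObj (A.restrict φ))

theorem over_μ : ((S.tile A e X).tensor (S.tile A e Y)).Over (S.tile A e (X ⊗ Y))
    (μ (S.functor A g) X Y) (𝟙 _) := by
  subst e; exact S.over_lift _ _ _

theorem over_δ : (S.tile A e (X ⊗ Y)).Over ((S.tile A e X).tensor (S.tile A e Y))
    (δ (S.functor A g) X Y) (𝟙 _) := by
  subst e; exact S.over_lift _ _ _

theorem over_ε : (Tile.one a).Over (S.tile A e (𝟙_ _)) (ε (S.functor A g)) (𝟙 _) := by
  subst e; exact S.over_lift _ _ _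

theorem over_η : (S.tile A e (𝟙_ _)).Over (Tile.one a) (η (S.functor A g)) (𝟙 _) := by
  subst e; exact S.over_lift _ _ _

end

/-- The monoidal autoequivalence `[V, σ] ↦ [g_* V, gσg⁻¹]` of the crossed product. -/
noncomputable def autoequiv (g : G) : LinearMonoidalAutoequiv k (CrossedObj (A.restrict φ)) where
  functor := S.functor A g

/-- Transport along equalities in the quotient lies over identities, so it leaves no trace in the
lower row. -/
theorem over_castIso {Q : Type*} (s : Q → G) {p q : Q} (h : p = q) {a : G} (hp : s p = a)
    (hq : s q = a) (X : CrossedObj (A.restrict φ)) :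
    (S.tile A hp X).Over (S.tile A hq X)
      ((LinearMonoidalAutoequiv.castIso (fun q => S.autoequiv A (s q)) h).hom.app X) (𝟙 X) := by
  subst h
  exact Tile.Over.id _

end NormalEmbedding

namespace NormalEmbedding
open Functor.LaxMonoidal Functor.OplaxMonoidal CrossedObj

variable {k : Type w} [Field k] {C : Type u} [Category.{v} C]
    [Preadditive C] [Linear k C] [MonoidalCategory C] {G N : Type*} [Group G] [Group N]
    {φ : N →* G} (S : NormalEmbedding φ) (A : TensorAction k G C)

section comp
variable {g h a : G} (e : g * h = a)

/-- The tile relating `[g_* h_* V, ghσh⁻¹g⁻¹]` with `[V, σ]`. -/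
def tileComp (X : CrossedObj (A.restrict φ)) :
    Tile a a ((S.functor A h ⋙ S.functor A g).obj X) X :=
  (S.tile A (rfl : g = g) ((S.functor A h).obj X)).vcomp (S.tile A (rfl : h = h) X) e e

theorem over_map_comp {X Y : CrossedObj (A.restrict φ)} (f : X ⟶ Y) :
    (S.tileComp A e X).Over (S.tileComp A e Y) ((S.functor A h ⋙ S.functor A g).map f) f :=
  (S.over_map A rfl _).vcomp (S.over_map A rfl f) e e

theorem tile_vcomp_tile {g g' h h' a : G} (eg : g = g') (eh : h = h') (e : g' * h' = a)
    (X : CrossedObj (A.restrict φ)) :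
    (S.tile A eg ((S.functor A h).obj X)).vcomp (S.tile A eh X) e e =
      S.tileComp A (by rw [eg, eh, e]) X := by
  subst eg eh
  rfl

variable [MonoidalPreadditive C]

theorem over_μ_comp (X Y : CrossedObj (A.restrict φ)) :
    ((S.tileComp A e X).tensor (S.tileComp A e Y)).Over (S.tileComp A e (X ⊗ Y))
      (μ (S.functor A h ⋙ S.functor A g) X Y) (𝟙 _) := by
  have := ((S.over_μ A (rfl : g = g) ((S.functor A h).obj X) ((S.functor A h).obj Y)).vcomp
    (Tile.Over.id ((S.tile A (rfl : h = h) X).tensor (S.tile A (rfl : h = h) Y))) e e).comp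
      ((S.over_map A (rfl : g = g) (μ (S.functor A h) X Y)).vcomp
        (S.over_μ A (rfl : h = h) X Y) e e)
  rw [Tile.tensor_vcomp_tensor _ _ _ _ e e e, Category.comp_id] at this
  exact this

theorem over_ε_comp :
    (Tile.one a).Over (S.tileComp A e (𝟙_ _)) (ε (S.functor A h ⋙ S.functor A g)) (𝟙 _) := by
  have := ((S.over_ε A (rfl : g = g)).vcomp (Tile.Over.id (Tile.one h)) e e).comp
      ((S.over_map A (rfl : g = g) (ε (S.functor A h))).vcomp
        (S.over_ε A (rfl : h = h)) e e)
  rw [Tile.one_vcomp_one, Category.comp_id] at this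
  exact this

end comp

end NormalEmbedding

/-! ### Twisting the conjugation action by scalars -/

/-- Scalars that twist the conjugation action on the crossed product with a normal subgroup into a
`π`-anomalous action of the quotient `Q`: a section `s` of the quotient map with factor set `u`, a
2-cocycle `β` with values in characters of the subgroup, and a 3-cochain `γ`, such that `π` differs
from the cup product of `β` and `u` by the coboundary of `γ`. -/
structure NormalEmbedding.AnomalyDatum {G N : Type*} [Group G] [Group N] {φ : N →* G}
    (S : NormalEmbedding φ) {Q M : Type*} [Group Q] [CommGroup M] (π : Q → Q → Q → Q → M) where
  s : Q → G
  s_one : s 1 = 1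
  u : Q → Q → N
  u_spec (q r : Q) : φ (u q r) * s (q * r) = s q * s r
  β : Q → Q → N → M
  β_mul (q r : Q) (σ τ : N) : β q r (σ * τ) = β q r σ * β q r τ
  β_cocycle (q r t : Q) (σ : N) :
    β r t σ * β q (r * t) σ = β (q * r) t σ * β q r (S.conj (s t) σ)
  β_one_left (q : Q) (σ : N) : β 1 q σ = 1
  β_one_right (q : Q) (σ : N) : β q 1 σ = 1
  γ : Q → Q → Q → M
  γ_one (q r : Q) : γ q 1 r = 1
  cocycle (q r x y : Q) : γ r x y * γ q (r * x) y * γ q r x =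
    π q r x y * (γ q r (x * y) * β q r (u x y) * γ (q * r) x y)

namespace NormalEmbedding.AnomalyDatum
open Functor.LaxMonoidal Functor.OplaxMonoidal CrossedObj

variable {k : Type w} [Field k] {C : Type u} [Category.{v} C]
    [Preadditive C] [Linear k C] [MonoidalCategory C] [MonoidalPreadditive C]
    {G N Q : Type*} [Group G] [Group N] [Group Q]
    {φ : N →* G} {S : NormalEmbedding φ} {π : Q → Q → Q → Q → kˣ} (T : S.AnomalyDatum π)
    (A : TensorAction k G C)

theorem β_one (q r : Q) : T.β q r 1 = 1 := by
  have := T.β_mul q r 1 1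
  simpa using this

/-- The pseudonatural transformation given by the object `[𝟙, u q r]`. -/
noncomputable def mul (q r : Q) :
    PseudonaturalData (S.functor A (T.s r) ⋙ S.functor A (T.s q)) (S.functor A (T.s (q * r))) where
  obj := ⟨𝟙_ C, T.u q r⟩
  app X := Tile.liftIso S.injective
    ((S.tileComp A rfl X).tensor (Tile.unit (T.u q r) _ _ (T.u_spec q r)))
    ((Tile.unit (T.u q r) _ _ (T.u_spec q r)).tensor (S.tile A rfl X))
    -- With scalar one this would be the canonical comparison coming from `s q * s r = u q r * s (q
    -- * r)`. The twist depends on `X` only through its degree.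
    (unitsSMulIso (T.β q r X.deg) (ρ_ X ≪≫ (λ_ X).symm))

/-- The tile given by the object `[𝟙, u q r]`. -/
noncomputable def unit (q r : Q) {a b : G} (h : φ (T.u q r) * b = a) :
    Tile a b (T.mul A q r).obj (𝟙_ _) :=
  Tile.unit (T.u q r) a b h

theorem unit_vcomp_one (q r : Q) {a b g c d : G} (h : φ (T.u q r) * b = a) (hc : a * g = c)
    (hd : b * g = d) : (T.unit A q r h).vcomp (Tile.one g) hc hd =
      T.unit A q r (by rw [← hc, ← hd, ← mul_assoc, h]) :=
  Tile.unit_vcomp_one _ _ _ _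

theorem over_mul (q r : Q) (X : CrossedObj (A.restrict φ)) {a c : G} (ha : T.s q * T.s r = a)
    (hc : T.s (q * r) = c) :
    ((S.tileComp A ha X).tensor (T.unit A q r (by rw [← ha, ← hc, T.u_spec]))).Over
      ((T.unit A q r (by rw [← ha, ← hc, T.u_spec])).tensor (S.tile A hc X))
      ((T.mul A q r).app X).hom ((T.β q r X.deg : k) • ((ρ_ X).hom ≫ (λ_ X).inv)) := by
  subst ha hc
  exact S.over_lift _ _ _

/-- The component at `X'` is read further down, over `X`, but the scalar still sees the degree of
`X'`. In the pentagon `X'` is `U_{x,y}` and `X` is the unit, which is where `β q r (u x y)` comes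
from. -/
theorem over_mul_vcomp (q r : Q) {X' X : CrossedObj (A.restrict φ)} {g h a b c d : G}
    (p : Tile g h X' X) (ha : T.s q * T.s r * g = a) (hb : T.s q * T.s r * h = b)
    (hc : T.s (q * r) * g = c) (hd : T.s (q * r) * h = d) :
    (((S.tileComp A rfl X').vcomp p ha hb).tensor
        (T.unit A q r (by rw [← hb, ← hd, ← mul_assoc, T.u_spec]))).Over
      ((T.unit A q r (by rw [← ha, ← hc, ← mul_assoc, T.u_spec])).tensor
        ((S.tile A rfl X').vcomp p hc hd))
      ((T.mul A q r).app X').hom ((T.β q r X'.deg : k) • ((ρ_ X).hom ≫ (λ_ X).inv)) := by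
  have := (T.over_mul A q r X' rfl rfl).vcomp
    (((Tile.over_rightUnitor p).comp (Tile.over_leftUnitor p).inv).smul (T.β q r X'.deg : k)) ha hd
  rwa [Tile.tensor_vcomp_tensor _ _ _ _ ha hb hd, Tile.tensor_vcomp_tensor _ _ _ _ ha hc hd,
    T.unit_vcomp_one, T.unit_vcomp_one] at this

theorem exists_inverse (u : N) : ∃ U : CrossedObj (A.restrict φ),
    Nonempty ((⟨𝟙_ C, u⟩ : CrossedObj (A.restrict φ)) ⊗ U ≅ 𝟙_ _) ∧
      Nonempty (U ⊗ (⟨𝟙_ C, u⟩ : CrossedObj (A.restrict φ)) ≅ 𝟙_ _) := by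
  refine ⟨⟨𝟙_ C, u⁻¹⟩, ⟨mkIso ?_ (mul_inv_cancel u)⟩, ⟨mkIso ?_ (inv_mul_cancel u)⟩⟩ <;>
  exact λ_ _ ≪≫ (Functor.Monoidal.εIso _).symm

/-- Nonzero morphisms preserve degree, so the twist is natural; it respects tensor products because
`β q r` is multiplicative, and the unit because `β q r 1 = 1`. -/
theorem mul_isPseudonaturalIso [MonoidalLinear k C] (q r : Q) :
    IsPseudonaturalIso (T.mul A q r) where
  naturality {V W} f := by
    refine Tile.Over.unique (((S.over_map_comp A rfl f).whiskerRight _).comp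
      (T.over_mul A q r W rfl rfl))
      ((T.over_mul A q r V rfl rfl).comp ((S.over_map A rfl f).whiskerLeft _)) ?_
    by_cases h : V.deg = W.deg
    · simp [h, Linear.comp_smul, Linear.smul_comp]
    · simp [eq_zero_of_deg_ne f h]
  tensor V W := by
    refine Tile.Over.unique (((S.over_μ_comp A rfl V W).whiskerRight _).comp
      (T.over_mul A q r _ rfl rfl))
      ((Tile.over_associator ..).comp (((T.over_mul A q r W rfl rfl).whiskerLeft _).comp
        ((Tile.Over.inv (Tile.over_associator ..)).comp
          (((T.over_mul A q r V rfl rfl).whiskerRight _).comp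
          ((Tile.over_associator ..).comp ((S.over_μ A rfl V W).whiskerLeft _)))))) ?_
    have : T.β q r (V ⊗ W).deg = T.β q r V.deg * T.β q r W.deg := T.β_mul q r _ _
    rw [this]
    simp [Linear.comp_smul, Linear.smul_comp, smul_smul]
  unit := by
    refine Tile.Over.unique (((S.over_ε_comp A rfl).whiskerRight _).comp
      (T.over_mul A q r _ rfl rfl))
      ((Tile.over_leftUnitor ..).comp ((Tile.Over.inv (Tile.over_rightUnitor ..)).comp
        ((S.over_ε A rfl).whiskerLeft _))) ?_
    have : T.β q r (𝟙_ (CrossedObj (A.restrict φ))).deg = 1 := T.β_one q r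
    rw [this]
    simp [unitors_equal, unitors_inv_equal]
  invertible := exists_inverse A _

end NormalEmbedding.AnomalyDatum

/-! ### Composites of pseudonatural transformations, units and associators over tiles -/

section
open Functor.LaxMonoidal Functor.OplaxMonoidal CrossedObj

variable {k : Type w} [Field k] {C : Type u} [Category.{v} C]
    [Preadditive C] [Linear k C] [MonoidalCategory C] [MonoidalPreadditive C]
    {G N : Type*} [Group G] [Group N]
    {φ : N →* G} {A : TensorAction k G C}

namespace CrossedObj.Tile

/-- Fixes one normal form for sliding an object past two units, so that composites built in
different ways can be compared by their scalars alone. -/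
theorem coh_rightUnitor_leftUnitor_inv {D : Type u} [Category.{v} D] [MonoidalCategory D] (X : D) :
    (α_ X (𝟙_ D) (𝟙_ D)).inv ≫ ((ρ_ X).hom ≫ (λ_ X).inv) ▷ 𝟙_ D ≫ (α_ (𝟙_ D) X (𝟙_ D)).hom ≫
        𝟙_ D ◁ ((ρ_ X).hom ≫ (λ_ X).inv) ≫ (α_ (𝟙_ D) (𝟙_ D) X).inv =
      X ◁ (λ_ (𝟙_ D)).hom ≫ (ρ_ X).hom ≫ (λ_ X).inv ≫ (λ_ (𝟙_ D)).inv ▷ X := by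
  monoidal

/-- Vertical composition multiplies the scalars and otherwise depends only on coherence in the lower
row. -/
theorem over_comp [MonoidalLinear k C]
    {F₁ F₂ F₃ : CrossedObj (A.restrict φ) ⥤ CrossedObj (A.restrict φ)}
    {P : PseudonaturalData F₁ F₂} {R : PseudonaturalData F₂ F₃} {X : CrossedObj (A.restrict φ)}
    {a b c : G} {n₁ : Tile a a (F₁.obj X) X} {n₂ : Tile b b (F₂.obj X) X}
    {n₃ : Tile c c (F₃.obj X) X} {p : Tile a b P.obj (𝟙_ _)} {r : Tile b c R.obj (𝟙_ _)} {x y : k}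
    (hP : (n₁.tensor p).Over (p.tensor n₂) (P.app X).hom (x • ((ρ_ X).hom ≫ (λ_ X).inv)))
    (hR : (n₂.tensor r).Over (r.tensor n₃) (R.app X).hom (y • ((ρ_ X).hom ≫ (λ_ X).inv))) :
    (n₁.tensor (p.tensor r)).Over ((p.tensor r).tensor n₃) ((P.comp R).app X).hom
      ((x * y) • (X ◁ (λ_ (𝟙_ _)).hom ≫ (ρ_ X).hom ≫ (λ_ X).inv ≫ (λ_ (𝟙_ _)).inv ▷ X)) := by
  have := (Over.inv (over_associator n₁ p r)).comp ((hP.whiskerRight r).comp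
    ((over_associator p n₂ r).comp ((hR.whiskerLeft p).comp (Over.inv (over_associator p r n₃)))))
  rw [← coh_rightUnitor_leftUnitor_inv]
  convert! this using 1
  simp only [Linear.comp_smul, Linear.smul_comp, smul_smul, MonoidalLinear.smul_whiskerRight,
    MonoidalLinear.whiskerLeft_smul]
  rw [mul_comm x y]

theorem over_congr {F F' K K' : CrossedObj (A.restrict φ) ⥤ CrossedObj (A.restrict φ)}
    {P : PseudonaturalData F K} {X : CrossedObj (A.restrict φ)} {e : F ≅ F'} {e' : K ≅ K'}
    {a b : G} {n : Tile a a (F.obj X) X} {n' : Tile a a (F'.obj X) X} {m : Tile b b (K.obj X) X}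
    {m' : Tile b b (K'.obj X) X} {Z : CrossedObj (A.restrict φ)} {p : Tile a b P.obj Z}
    {f : X ⊗ Z ⟶ Z ⊗ X}
    (hP : (n.tensor p).Over (p.tensor m) (P.app X).hom f)
    (he : n'.Over n (e.inv.app X) (𝟙 X)) (he' : m.Over m' (e'.hom.app X) (𝟙 X)) :
    (n'.tensor p).Over (p.tensor m') ((P.congr e e').app X).hom f := by
  have := (he.whiskerRight p).comp (hP.comp (he'.whiskerLeft p))
  simpa using! this

end CrossedObj.Tile

namespace NormalEmbedding
variable (S : NormalEmbedding φ)

/-- Whiskering on the outside by a conjugation functor leaves the lower morphism, hence its scalar,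
unchanged; only the edges are multiplied on the left by `g`. -/
theorem over_postcomp {F K : CrossedObj (A.restrict φ) ⥤ CrossedObj (A.restrict φ)}
    {P : PseudonaturalData F K} {X : CrossedObj (A.restrict φ)}
    {a b c d g : G} {n : Tile a a (F.obj X) X} {m : Tile b b (K.obj X) X}
    {p : Tile a b P.obj (𝟙_ _)} {f : X ⊗ 𝟙_ _ ⟶ 𝟙_ _ ⊗ X}
    (hP : (n.tensor p).Over (p.tensor m) (P.app X).hom f) (hc : g * a = c) (hd : g * b = d) :
    (((S.tile A rfl (F.obj X)).vcomp n hc hc).tensor ((S.tile A rfl P.obj).vcomp p hc hd)).Over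
      (((S.tile A rfl P.obj).vcomp p hc hd).tensor ((S.tile A rfl (K.obj X)).vcomp m hd hd))
      ((P.postcomp (S.functor A g)).app X).hom f := by
  have := ((S.over_μ A (rfl : g = g) (F.obj X) P.obj).vcomp (Tile.Over.id (n.tensor p)) hc hd).comp
    (((S.over_map A (rfl : g = g) (P.app X).hom).vcomp hP hc hd).comp
      ((S.over_δ A (rfl : g = g) P.obj (K.obj X)).vcomp (Tile.Over.id (p.tensor m)) hc hd))
  rw [Tile.tensor_vcomp_tensor _ _ _ _ hc hc hd, Tile.tensor_vcomp_tensor _ _ _ _ hc hd hd,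
    Category.id_comp, Category.comp_id] at this
  exact this

theorem over_eqToHom {u u' : N} {a b : G} (hu : φ u * b = a) (hu' : φ u' * b = a)
    (e : (⟨𝟙_ C, u⟩ : CrossedObj (A.restrict φ)) = ⟨𝟙_ C, u'⟩) :
    (Tile.unit u a b hu).Over (Tile.unit u' a b hu') (eqToHom e) (𝟙 _) := by
  obtain rfl : u = u' := congrArg CrossedObj.deg e
  exact Tile.Over.id _

namespace AnomalyDatum
variable {S} {Q : Type*} [Group Q] {π : Q → Q → Q → Q → kˣ} (T : S.AnomalyDatum π)
variable (A)

/-- The autoequivalence attached to an element of the quotient. -/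
noncomputable abbrev aut (q : Q) : LinearMonoidalAutoequiv k (CrossedObj (A.restrict φ)) :=
  S.autoequiv A (T.s q)

/-- The pseudonatural transformation relating the identity to the action of the unit. -/
noncomputable abbrev one : PseudonaturalData (𝟭 _) (S.functor A (T.s 1)) where
  obj := 𝟙_ _
  app X := Tile.liftIso S.injective ((Tile.refl X).tensor (Tile.one 1))
    ((Tile.one 1).tensor (S.tile A T.s_one X)) (ρ_ X ≪≫ (λ_ X).symm)

theorem over_one (X : CrossedObj (A.restrict φ)) :
    ((Tile.refl X).tensor (Tile.one 1)).Over ((Tile.one 1).tensor (S.tile A T.s_one X))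
      ((T.one A).app X).hom ((ρ_ X).hom ≫ (λ_ X).inv) :=
  S.over_lift _ _ _

theorem over_one_vcomp {X' X : CrossedObj (A.restrict φ)} {g h : G} (p : Tile g h X' X) :
    (p.tensor (Tile.one h)).Over
      ((Tile.one g).tensor ((S.tile A T.s_one X').vcomp p (one_mul g) (one_mul h)))
      ((T.one A).app X').hom ((ρ_ X).hom ≫ (λ_ X).inv) := by
  have := (T.over_one A X').vcomp ((Tile.over_rightUnitor p).comp (Tile.over_leftUnitor p).inv)
    (one_mul g) (one_mul h)
  rwa [Tile.tensor_vcomp_tensor _ _ _ _ (one_mul g) (one_mul h) (one_mul h),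
    Tile.tensor_vcomp_tensor _ _ _ _ (one_mul g) (one_mul g) (one_mul h),
    Tile.one_vcomp_one, Tile.one_vcomp_one, Tile.refl_vcomp] at this

theorem one_isPseudonaturalIso : IsPseudonaturalIso (T.one A) where
  naturality {V W} f := by
    have hf : (Tile.refl V).Over (Tile.refl W) f f := by
      have := (A.unitIso (rfl : (1 : G) = 1)).inv.naturality f.1
      exact this
    exact Tile.Over.unique ((hf.whiskerRight _).comp (T.over_one A W))
      ((T.over_one A V).comp ((S.over_map A T.s_one f).whiskerLeft _)) (by simp)
  tensor V W := by
    have hμ : ((Tile.refl V).tensor (Tile.refl W)).Over (Tile.refl (V ⊗ W))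
        (μ (𝟭 (CrossedObj (A.restrict φ))) V W) (𝟙 _) := by
      rw [Tile.refl_tensor_refl]
      exact Tile.Over.id _
    exact Tile.Over.unique ((hμ.whiskerRight _).comp (T.over_one A _))
      ((Tile.over_associator ..).comp (((T.over_one A W).whiskerLeft _).comp
        ((Tile.Over.inv (Tile.over_associator ..)).comp (((T.over_one A V).whiskerRight _).comp
          ((Tile.over_associator ..).comp ((S.over_μ A T.s_one V W).whiskerLeft _)))))) (by simp)
  unit := by
    have hε : (Tile.one 1).Over (Tile.refl (𝟙_ _)) (ε (𝟭 (CrossedObj (A.restrict φ)))) (𝟙 _) := by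
      rw [Tile.refl_unit]
      exact Tile.Over.id _
    exact Tile.Over.unique ((hε.whiskerRight _).comp (T.over_one A _))
      ((Tile.over_leftUnitor ..).comp ((Tile.Over.inv (Tile.over_rightUnitor ..)).comp
        ((S.over_ε A T.s_one).whiskerLeft _))) (by simp [unitors_equal, unitors_inv_equal])
  invertible := exists_inverse A 1

theorem unit_aux (q r : Q) (g : G) {a b : G} (ha : T.s q * T.s r * g = a)
    (hb : T.s (q * r) * g = b) : φ (T.u q r) * b = a := by
  rw [← ha, ← hb, ← mul_assoc, T.u_spec]

/-- Since `s 1 = 1`, the factor set is trivial on pairs containing `1`, and the edge is unchanged.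
-/
theorem unit_one_left_aux (q : Q) (a : G) : φ (T.u 1 q) * a = a := by
  have := T.u_spec 1 q
  rw [one_mul, T.s_one, one_mul] at this
  rw [mul_eq_right.1 this, one_mul]

theorem unit_one_right_aux (q : Q) (a : G) : φ (T.u q 1) * a = a := by
  have := T.u_spec q 1
  rw [mul_one, T.s_one, mul_one] at this
  rw [mul_eq_right.1 this, one_mul]

/-- The modification given by the scalar `γ`. -/
noncomputable def assoc (q r t : Q) :
    (S.functor A (T.s q)).obj (T.mul A r t).obj ⊗ (T.mul A q (r * t)).obj ≅
      (T.mul A q r).obj ⊗ (T.mul A (q * r) t).obj :=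
  Tile.liftIso S.injective
    (((S.tile A rfl (T.mul A r t).obj).vcomp (T.unit A r t (T.u_spec r t))
      (mul_assoc _ _ _).symm rfl).tensor (T.unit A q (r * t) (b := T.s (q * r * t))
        (by rw [mul_assoc, T.u_spec])))
    ((T.unit A q r (b := T.s (q * r) * T.s t) (T.unit_aux q r (T.s t) rfl rfl)).tensor
      (T.unit A (q * r) t (T.u_spec _ _)))
    (unitsSMulIso (T.γ q r t) (Iso.refl _))

/-- The factor `g` pads all edges on the right. In the pentagon the modifications occur with
different paddings, `1` and `s y`, and the named edges allow their tiles to be glued. -/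
theorem over_assoc (q r t : Q) {x y a b c d : G} (g : G) (hx : T.s r * T.s t * g = x)
    (hy : T.s (r * t) * g = y) (ha : T.s q * x = a) (hb : T.s q * y = b)
    (hc : T.s (q * r * t) * g = c) (hd : T.s (q * r) * T.s t * g = d) :
    (((S.tile A rfl (T.mul A r t).obj).vcomp (T.unit A r t (T.unit_aux r t g hx hy)) ha hb).tensor
      (T.unit A q (r * t) (T.unit_aux q (r * t) g (by rw [← hb, ← hy, mul_assoc])
        (by rw [← hc, mul_assoc q])))).Over
    ((T.unit A q r (T.unit_aux q r (T.s t * g) (by rw [← ha, ← hx]; simp only [mul_assoc])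
        (by rw [← hd, mul_assoc]))).tensor
      (T.unit A (q * r) t (T.unit_aux (q * r) t g hd hc)))
    (T.assoc A q r t).hom ((T.γ q r t : k) • 𝟙 _) := by
  have := (S.over_lift (((S.tile A rfl (T.mul A r t).obj).vcomp (T.unit A r t (T.u_spec r t))
      (mul_assoc _ _ _).symm rfl).tensor (T.unit A q (r * t) (b := T.s (q * r * t))
        (by rw [mul_assoc, T.u_spec])))
    ((T.unit A q r (b := T.s (q * r) * T.s t) (T.unit_aux q r (T.s t) rfl rfl)).tensor
      (T.unit A (q * r) t (T.u_spec _ _)))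
    (unitsSMulIso (T.γ q r t) (Iso.refl _)).hom).vcomp
      ((Tile.Over.id ((Tile.one g).tensor (Tile.one g))).smul (T.γ q r t : k))
      (show T.s q * T.s r * T.s t * g = a by rw [← ha, ← hx]; simp only [mul_assoc]) hc
  rwa [Tile.tensor_vcomp_tensor _ _ _ _ _
      (show T.s q * T.s (r * t) * g = b by rw [← hb, ← hy, mul_assoc]),
    Tile.tensor_vcomp_tensor _ _ _ _ _ hd, T.unit_vcomp_one, T.unit_vcomp_one,
    T.unit_vcomp_one, Tile.vcomp_assoc _ _ _ hx hy _ _ _ _ ha hb, T.unit_vcomp_one] at this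

/-- The modification comparing `χ_{1,q}` with the identity. -/
noncomputable def leftUnit (q : Q) : (T.one A).obj ⊗ (T.mul A 1 q).obj ≅ 𝟙_ _ :=
  Tile.liftIso S.injective ((Tile.one (T.s q)).tensor (T.unit A 1 q (T.unit_one_left_aux q _)))
    (Tile.one (T.s q)) (λ_ _)

/-- The modification comparing `χ_{q,1}` with the identity. -/
noncomputable def rightUnit (q : Q) :
    (S.functor A (T.s q)).obj (T.one A).obj ⊗ (T.mul A q 1).obj ≅ 𝟙_ _ :=
  Tile.liftIso S.injective ((S.tile A rfl (𝟙_ _)).tensor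
    (T.unit A q 1 (T.unit_one_right_aux q _))) (Tile.one (T.s q)) (λ_ _)

theorem over_leftUnit (q : Q) :
    ((Tile.one (T.s q)).tensor (T.unit A 1 q (T.unit_one_left_aux q _))).Over (Tile.one (T.s q))
      (T.leftUnit A q).hom (λ_ _).hom :=
  S.over_lift _ _ _

theorem over_rightUnit (q : Q) {g a : G} (ha : T.s q * g = a) :
    (((S.tile A rfl (𝟙_ _)).vcomp (Tile.one g) ha ha).tensor
      (T.unit A q 1 (T.unit_one_right_aux q a))).Over (Tile.one a)
      (T.rightUnit A q).hom (λ_ _).hom := by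
  have := (S.over_lift ((S.tile A rfl (𝟙_ _)).tensor (T.unit A q 1 (T.unit_one_right_aux q _)))
    (Tile.one (T.s q)) (λ_ _).hom).vcomp (Tile.over_leftUnitor (Tile.one g)) ha ha
  rwa [Tile.tensor_vcomp_tensor _ _ _ _ _ ha, T.unit_vcomp_one, Tile.one_vcomp_one] at this

end AnomalyDatum
end NormalEmbedding
end

/-! ### The axioms of an anomalous action on homogeneous objects -/

namespace NormalEmbedding.AnomalyDatum
open Functor.LaxMonoidal Functor.OplaxMonoidal CrossedObj

variable {k : Type w} [Field k] {C : Type u} [Category.{v} C]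
    [Preadditive C] [Linear k C] [MonoidalCategory C] [MonoidalPreadditive C]
    {G N Q : Type*} [Group G] [Group N] [Group Q]
    {φ : N →* G} {S : NormalEmbedding φ} {π : Q → Q → Q → Q → kˣ} (T : S.AnomalyDatum π)
    (A : TensorAction k G C)

theorem over_eqToHom {q r q' r' : Q} {a b : G} (h : φ (T.u q r) * b = a)
    (h' : φ (T.u q' r') * b = a) (e : (T.mul A q r).obj = (T.mul A q' r').obj) :
    (T.unit A q r h).Over (T.unit A q' r' h') (eqToHom e) (𝟙 _) :=
  NormalEmbedding.over_eqToHom h h' e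

/-- The only scalar that occurs is `γ q 1 r`, which is normalized to one. -/
theorem triangle (q r : Q) :
    (α_ _ _ _).inv ≫
        (μ (T.aut A q).functor _ _ ≫ (T.aut A q).functor.map (T.leftUnit A r).hom ≫
          η (T.aut A q).functor) ▷ (T.mul A q (1 * r)).obj ≫
        (λ_ _).hom ≫
        eqToHom (congrArg (fun x => (T.mul A q x).obj) (one_mul r)) =
      (T.aut A q).functor.obj (T.one A).obj ◁ (T.assoc A q 1 r).hom ≫
        (α_ _ _ _).inv ≫
        (T.rightUnit A q).hom ▷ (T.mul A (q * 1) r).obj ≫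
        (λ_ _).hom ≫
        eqToHom (congrArg (fun x => (T.mul A x r).obj) (mul_one q)) := by
  have h₁ := (S.over_μ A (rfl : T.s q = T.s q) (T.one A).obj (T.mul A 1 r).obj).vcomp
    (Tile.Over.id ((Tile.one (T.s r)).tensor (T.unit A 1 r (T.unit_one_left_aux r _)))) rfl rfl
  have h₂ := (S.over_map A (rfl : T.s q = T.s q) (T.leftUnit A r).hom).vcomp
    (T.over_leftUnit A r) rfl rfl
  have h₃ := (S.over_η A (rfl : T.s q = T.s q)).vcomp (Tile.Over.id (Tile.one (T.s r))) rfl rfl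
  have h₄ := h₁.comp (h₂.comp h₃)
  rw [Tile.tensor_vcomp_tensor _ _ _ _ _ rfl, Tile.one_vcomp_one] at h₄
  have h₅ := T.over_assoc A q 1 r (x := T.s r) (y := T.s r) (a := T.s q * T.s r)
    (b := T.s q * T.s r) (c := T.s (q * r)) (d := T.s q * T.s r) 1 (by simp [T.s_one]) (by simp)
    rfl rfl (by simp) (by simp)
  have h₆ := (Tile.over_associator _ _ _).inv.comp ((h₄.whiskerRight
    (T.unit A q (1 * r) (b := T.s (q * r)) (T.unit_aux q (1 * r) 1 (by simp) (by simp)))).comp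
    ((Tile.over_leftUnitor _).comp (T.over_eqToHom A (q' := q) (r' := r) _
      (T.unit_aux q r 1 (by simp) (by simp)) (congrArg (fun x => (T.mul A q x).obj) (one_mul r)))))
  have h₇ := (h₅.whiskerLeft ((S.tile A rfl (𝟙_ _)).vcomp (Tile.one (T.s r)) rfl rfl)).comp
    ((Tile.over_associator _ _ _).inv.comp (((T.over_rightUnit A q rfl).whiskerRight _).comp
    ((Tile.over_leftUnitor _).comp (T.over_eqToHom A (q' := q) (r' := r) _
      (T.unit_aux q r 1 (by simp) (by simp)) (congrArg (fun x => (T.mul A x r).obj) (mul_one q))))))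
  refine Tile.Over.unique h₆ h₇ ?_
  simp [T.γ_one]

variable [MonoidalLinear k C]

theorem over_comp_postcomp (q r t : Q) (X : CrossedObj (A.restrict φ)) :
    ((((S.tile A rfl _).vcomp (S.tileComp A rfl X) (mul_assoc _ _ _).symm
      (mul_assoc _ _ _).symm)).tensor (((S.tile A rfl (T.mul A r t).obj).vcomp
        (T.unit A r t (T.u_spec r t)) (mul_assoc _ _ _).symm rfl).tensor
          (T.unit A q (r * t) (b := T.s (q * r * t)) (by rw [mul_assoc, T.u_spec])))).Over
    ((((S.tile A rfl (T.mul A r t).obj).vcomp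
        (T.unit A r t (T.u_spec r t)) (mul_assoc _ _ _).symm rfl).tensor
          (T.unit A q (r * t) (b := T.s (q * r * t)) (by rw [mul_assoc, T.u_spec]))).tensor
      (S.tile A rfl X))
    (((((T.mul A r t).postcomp (T.aut A q).functor).comp (T.mul A q (r * t))).congr
        (Functor.associator (T.aut A t).functor (T.aut A r).functor (T.aut A q).functor)
        (LinearMonoidalAutoequiv.castIso (T.aut A) (mul_assoc q r t).symm)).app X).hom
    (((T.β r t X.deg * T.β q (r * t) X.deg : kˣ) : k) •
      (X ◁ (λ_ (𝟙_ _)).hom ≫ (ρ_ X).hom ≫ (λ_ X).inv ≫ (λ_ (𝟙_ _)).inv ▷ X)) := by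
  have h₁ := S.over_postcomp (T.over_mul A r t X rfl rfl)
    (mul_assoc (T.s q) (T.s r) (T.s t)).symm rfl
  have h₂ := T.over_mul A q (r * t) X rfl (congrArg T.s (mul_assoc q r t).symm)
  have h₃ := Tile.over_comp h₁ h₂
  rw [← Units.val_mul] at h₃
  exact Tile.over_congr h₃ (Tile.Over.id _) (S.over_castIso A T.s _ _ _ X)

theorem over_comp_precomp (q r t : Q) (X : CrossedObj (A.restrict φ)) :
    ((((S.tile A rfl _).vcomp (S.tileComp A rfl X) (mul_assoc _ _ _).symm
      (mul_assoc _ _ _).symm)).tensor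
        ((T.unit A q r (b := T.s (q * r) * T.s t) (T.unit_aux q r (T.s t) rfl rfl)).tensor
      (T.unit A (q * r) t (T.u_spec _ _)))).Over
    (((T.unit A q r (b := T.s (q * r) * T.s t) (T.unit_aux q r (T.s t) rfl rfl)).tensor
      (T.unit A (q * r) t (T.u_spec _ _))).tensor (S.tile A rfl X))
    ((((T.mul A q r).precomp (T.aut A t).functor).comp (T.mul A (q * r) t)).app X).hom
    (((T.β r t X.deg * T.β q (r * t) X.deg : kˣ) : k) •
      (X ◁ (λ_ (𝟙_ _)).hom ≫ (ρ_ X).hom ≫ (λ_ X).inv ≫ (λ_ (𝟙_ _)).inv ▷ X)) := by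
  have h₁ := T.over_mul_vcomp A q r (S.tile A (rfl : T.s t = T.s t) X) rfl rfl rfl rfl
  have h₂ := T.over_mul A (q * r) t X rfl rfl
  have h₃ := Tile.over_comp (P := (T.mul A q r).precomp (T.aut A t).functor) h₁ h₂
  -- The component of `χ_{q,r}` is taken at `F_t X`, of degree `conj (s t) X.deg`. The twisted
  -- cocycle condition on `β` therefore gives exactly the scalar of the other composite.
  have h₄ := T.β_cocycle q r t X.deg
  rw [mul_comm (T.β (q * r) t X.deg)] at h₄
  rw [h₄, Units.val_mul]
  unfold tileComp
  rw [← Tile.vcomp_assoc _ _ _ rfl rfl rfl rfl rfl rfl]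
  exact h₃

theorem assoc_isModification (q r t : Q) :
    IsModification
      ((((T.mul A r t).postcomp (T.aut A q).functor).comp (T.mul A q (r * t))).congr
        (Functor.associator (T.aut A t).functor (T.aut A r).functor (T.aut A q).functor)
        (LinearMonoidalAutoequiv.castIso (T.aut A) (mul_assoc q r t).symm))
      (((T.mul A q r).precomp (T.aut A t).functor).comp (T.mul A (q * r) t))
      (T.assoc A q r t) := fun X => by
  have h := T.over_assoc A q r t 1 (mul_one _) (mul_one _) (mul_assoc _ _ _).symm rfl (mul_one _)
    (mul_one _)
  refine Tile.Over.unique ((h.whiskerLeft _).comp (T.over_comp_precomp A q r t X))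
    ((T.over_comp_postcomp A q r t X).comp (h.whiskerRight _)) ?_
  simp [Linear.comp_smul, Linear.smul_comp, smul_smul, mul_comm]

theorem leftUnit_isModification (q : Q) :
    IsModification
      ((((T.one A).precomp (T.aut A q).functor).comp (T.mul A 1 q)).congr
        (Functor.rightUnitor (T.aut A q).functor)
        (LinearMonoidalAutoequiv.castIso (T.aut A) (one_mul q)))
      (.id (T.aut A q).functor) (T.leftUnit A q) := fun X => by
  have h₁ := (T.over_one_vcomp A (S.tile A (rfl : T.s q = T.s q) X))
  -- The unit transformation carries no twist; writing its scalar as one puts it in the shape needed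
  -- for composition.
  rw [← one_smul k ((ρ_ X).hom ≫ (λ_ X).inv), S.tile_vcomp_tile] at h₁
  have h₂ := T.over_mul A 1 q X (by rw [T.s_one, one_mul]) (congrArg T.s (one_mul q))
  have h₃ := Tile.over_congr (e := Functor.rightUnitor (T.aut A q).functor)
    (e' := LinearMonoidalAutoequiv.castIso (T.aut A) (one_mul q))
    (Tile.over_comp (P := (T.one A).precomp (T.aut A q).functor) h₁ h₂) (Tile.Over.id _)
    (S.over_castIso A T.s _ _ rfl X)
  have h := T.over_leftUnit A q
  refine Tile.Over.unique ((h.whiskerLeft _).comp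
    ((Tile.over_rightUnitor _).comp (Tile.over_leftUnitor _).inv))
    (h₃.comp (h.whiskerRight _)) ?_
  simp [T.β_one_left]

theorem rightUnit_isModification (q : Q) :
    IsModification
      ((((T.one A).postcomp (T.aut A q).functor).comp (T.mul A q 1)).congr
        (Functor.leftUnitor (T.aut A q).functor)
        (LinearMonoidalAutoequiv.castIso (T.aut A) (mul_one q)))
      (.id (T.aut A q).functor) (T.rightUnit A q) := fun X => by
  have h₁ := (S.over_postcomp (T.over_one A X) (mul_one (T.s q)) (mul_one (T.s q)))
  rw [← one_smul k ((ρ_ X).hom ≫ (λ_ X).inv), S.tile_vcomp_tile] at h₁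
  have h₀ : (S.tile A (rfl : T.s q = T.s q) X).Over ((S.tile A (rfl : T.s q = T.s q) X).vcomp
      (Tile.refl X) (mul_one _) (mul_one _)) (𝟙 _) (𝟙 X) := by
    rw [Tile.vcomp_refl]
    exact .id _
  have h₂ := T.over_mul A q 1 X (by rw [T.s_one, mul_one]) (congrArg T.s (mul_one q))
  have h₃ := Tile.over_congr (e := Functor.leftUnitor (T.aut A q).functor)
    (e' := LinearMonoidalAutoequiv.castIso (T.aut A) (mul_one q))
    (Tile.over_comp h₁ h₂) h₀ (S.over_castIso A T.s _ _ rfl X)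
  have h := T.over_rightUnit A q (mul_one _)
  refine Tile.Over.unique ((h.whiskerLeft _).comp
    ((Tile.over_rightUnitor _).comp (Tile.over_leftUnitor _).inv))
    (h₃.comp (h.whiskerRight _)) ?_
  simp [T.β_one_right]

/-- Over the lower row both composites are scalar multiples of the same coherence morphism, so the
axiom becomes the relation between `π`, `γ` and `β q r (u x y)`. -/
theorem pentagon (q r x y : Q) :
    (α_ _ _ _).inv ≫
        ((μ (T.aut A q).functor _ _ ≫ (T.aut A q).functor.map (T.assoc A r x y).hom ≫
            δ (T.aut A q).functor _ _) ⊗ₘ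
          eqToHom (congrArg (fun x => (T.mul A q x).obj) (mul_assoc r x y).symm)) ≫
        (α_ _ _ _).hom ≫
        (T.aut A q).functor.obj (T.mul A r x).obj ◁ (T.assoc A q (r * x) y).hom ≫
        (α_ _ _ _).inv ≫
        ((T.assoc A q r x).hom ⊗ₘ
          eqToHom (congrArg (fun x => (T.mul A x y).obj) (mul_assoc q r x).symm)) ≫
        (α_ _ _ _).hom =
      (π q r x y : k) •
        ((T.aut A q).functor.obj ((T.aut A r).functor.obj (T.mul A x y).obj) ◁
          (T.assoc A q r (x * y)).hom ≫
        (α_ _ _ _).inv ≫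
        ((T.mul A q r).app (T.mul A x y).obj).hom ▷ (T.mul A (q * r) (x * y)).obj ≫
        (α_ _ _ _).hom ≫
        (T.mul A q r).obj ◁ (T.assoc A (q * r) x y).hom) := by
  -- The edges of the tiles are products in the group that agree only after reassociation. Opaque
  -- names for them let adjacent tiles share edges literally.
  obtain ⟨a₁, ea₁⟩ : ∃ a, a = T.s r * T.s x * T.s y := ⟨_, rfl⟩
  obtain ⟨a₂, ea₂⟩ : ∃ a, a = T.s r * T.s (x * y) := ⟨_, rfl⟩
  obtain ⟨a₃, ea₃⟩ : ∃ a, a = T.s (r * x * y) := ⟨_, rfl⟩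
  obtain ⟨a₄, ea₄⟩ : ∃ a, a = T.s (r * x) * T.s y := ⟨_, rfl⟩
  obtain ⟨b, eb⟩ : ∃ a, a = T.s (q * (r * x) * y) := ⟨_, rfl⟩
  obtain ⟨d₁, ed₁⟩ : ∃ a, a = T.s (q * (r * x)) * T.s y := ⟨_, rfl⟩
  obtain ⟨d₂, ed₂⟩ : ∃ a, a = T.s (q * r) * (T.s x * T.s y) := ⟨_, rfl⟩
  obtain ⟨d₃, ed₃⟩ : ∃ a, a = T.s (q * r) * T.s (x * y) := ⟨_, rfl⟩
  have h₁ := T.over_assoc A r x y (x := T.s x * T.s y) (y := T.s (x * y)) (a := a₁) (b := a₂)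
    (c := a₃) (d := a₄) 1 (by simp) (by simp) (by simp [ea₁, mul_assoc]) (by simp [ea₂])
    (by simp [ea₃]) (by simp [ea₄])
  have h₂ := ((S.over_μ A (rfl : T.s q = T.s q) _ _).vcomp (Tile.Over.id _) rfl rfl).comp
    (((S.over_map A (rfl : T.s q = T.s q) _).vcomp h₁ rfl rfl).comp
      ((S.over_δ A (rfl : T.s q = T.s q) _ _).vcomp (Tile.Over.id _) rfl rfl))
  rw [Tile.tensor_vcomp_tensor _ _ _ _ _ rfl, Tile.tensor_vcomp_tensor _ _ _ _ _ rfl] at h₂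
  have h₃ := T.over_assoc A q (r * x) y (x := a₄) (y := a₃) (a := T.s q * a₄) (b := T.s q * a₃)
    (c := b) (d := d₁) 1 (by simp [ea₄]) (by simp [ea₃]) rfl rfl (by simp [eb]) (by simp [ed₁])
  have h₄ := T.over_assoc A q r x (x := a₁) (y := a₄) (a := T.s q * a₁) (b := T.s q * a₄)
    (c := d₁) (d := d₂) (T.s y) ea₁.symm ea₄.symm rfl rfl (by simp [ed₁, mul_assoc])
    (by simp [ed₂, mul_assoc])
  have h₅ := (Tile.over_associator _ _ _).inv.comp ((h₂.tensorHom (T.over_eqToHom A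
      (T.unit_aux q (r * (x * y)) 1 (by simp [ea₃, mul_assoc]) (by simp [eb, mul_assoc])) _
      (congrArg (fun x => (T.mul A q x).obj) (mul_assoc r x y).symm))).comp
    ((Tile.over_associator _ _ _).comp ((h₃.whiskerLeft _).comp
      ((Tile.over_associator _ _ _).inv.comp ((h₄.tensorHom (T.over_eqToHom A _
        (T.unit_aux (q * r * x) y 1 (by simp [ed₁, mul_assoc]) (by simp [eb, mul_assoc]))
          (congrArg (fun x => (T.mul A x y).obj) (mul_assoc q r x).symm))).comp
            (Tile.over_associator _ _ _))))))
  have k₁ := T.over_assoc A q r (x * y) (x := a₂) (y := a₃) (a := T.s q * a₂) (b := T.s q * a₃)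
    (c := b) (d := d₃) 1 (by simp [ea₂]) (by simp [ea₃, mul_assoc]) rfl rfl
    (by simp [eb, mul_assoc]) (by simp [ed₃])
  -- The interchange with `U_{x,y}`: its degree is `u x y`, so this square carries the cup product
  -- term.
  have k₂ := T.over_mul_vcomp A q r (T.unit A x y (T.u_spec x y)) (a := T.s q * a₁)
    (b := T.s q * a₂) (c := d₂) (d := d₃) (by simp [ea₁, mul_assoc]) (by simp [ea₂, mul_assoc])
    ed₂.symm ed₃.symm
  unfold tileComp at k₂
  rw [Tile.vcomp_assoc _ _ _ (show T.s r * (T.s x * T.s y) = a₁ by simp [ea₁, mul_assoc])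
    ea₂.symm _ _ _ _ rfl rfl] at k₂
  have k₃ := T.over_assoc A (q * r) x y (x := T.s x * T.s y) (y := T.s (x * y)) (a := d₂) (b := d₃)
    (c := b) (d := d₁) 1 (by simp) (by simp) ed₂.symm ed₃.symm (by simp [eb, mul_assoc])
    (by simp [ed₁, mul_assoc])
  have k₄ := ((k₁.whiskerLeft _).comp ((Tile.over_associator _ _ _).inv.comp
    ((k₂.whiskerRight _).comp ((Tile.over_associator _ _ _).comp (k₃.whiskerLeft _))))).smul
      (π q r x y : k)
  refine Tile.Over.unique h₅ k₄ ?_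
  have e₁ : (ρ_ (𝟙_ (CrossedObj (A.restrict φ)))).hom ≫ (λ_ _).inv = 𝟙 _ := by
    rw [← unitors_equal, Iso.hom_inv_id]
  have e₂ := congrArg (Units.val (α := k)) (T.cocycle q r x y)
  simp only [Units.val_mul] at e₂
  rw [e₁]
  simp only [MonoidalLinear.whiskerLeft_smul, MonoidalLinear.smul_whiskerRight, tensorHom_id,
    Linear.comp_smul, Linear.smul_comp, smul_smul, Category.id_comp, Category.comp_id,
    MonoidalCategory.whiskerLeft_id, id_whiskerRight, Iso.inv_hom_id]
  congr 1
  refine Eq.trans ?_ (e₂.trans ?_)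
  · ring
  · rw [show (T.mul A x y).obj.deg = T.u x y from rfl]
    ring

/-- The anomalous action on the category of homogeneous objects of the crossed product. -/
noncomputable def action : AnomalousAction k π (CrossedObj (A.restrict φ)) where
  aut := T.aut A
  mul := T.mul A
  mul_isPseudonaturalIso := T.mul_isPseudonaturalIso A
  one := T.one A
  one_isPseudonaturalIso := T.one_isPseudonaturalIso A
  assoc := T.assoc A
  assoc_isModification := T.assoc_isModification A
  leftUnit := T.leftUnit A
  leftUnit_isModification := T.leftUnit_isModification A
  rightUnit := T.rightUnit A
  rightUnit_isModification := T.rightUnit_isModification A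
  pentagon := T.pentagon A
  triangle := T.triangle A

end NormalEmbedding.AnomalyDatum

/-! ### Extending functors and transformations to formal direct sums -/

namespace MatTensor
open Functor.LaxMonoidal Functor.OplaxMonoidal

variable {k : Type w} [Field k] {D : Type u} [Category.{v} D] [Preadditive D]

/-- The inverse index map is supplied by hand, not taken as `e.symm`, so that composites of
structural matrices have index maps equal by definition. -/
theorem isReindex_reindexInv {M N : Mat_ D} (e : M.ι ≃ N.ι) (φ : ∀ i, N.X (e i) ⟶ M.X i)
    {e' : N.ι → M.ι} {ψ : ∀ j, N.X j ⟶ M.X (e' j)} (h : ∀ j, e (e' j) = j)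
    (hψ : ∀ j, ψ j = eqToHom (congrArg N.X (h j).symm) ≫ φ (e' j)) :
    IsReindex (reindexInv e φ) e' ψ where
  self j := by rw [hψ, reindexInv, dif_pos (h j)]
  ne j i hj := reindexInv_apply_ne _ _ _ _ fun hi => hj (e.injective ((h j).trans hi.symm))

theorem IsReindex.map {F : D ⥤ D} [F.Additive] {M N : Mat_ D} {f : M ⟶ N} {e : M.ι → N.ι}
    {φ : ∀ i, M.X i ⟶ N.X (e i)} (hf : IsReindex f e φ) :
    IsReindex (M := F.mapMat_.obj M) (N := F.mapMat_.obj N) (F.mapMat_.map f) e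
      (fun i => F.map (φ i)) where
  self i := congrArg F.map (hf.self i)
  ne i j h := (congrArg F.map (hf.ne i j h)).trans (F.map_zero _ _)

theorem mapMat_map_id_apply (F : D ⥤ D) [F.Additive] (M : Mat_ D) (i j : M.ι) :
    F.map ((𝟙 M : M ⟶ M) i j) = (𝟙 (F.mapMat_.obj M) : F.mapMat_.obj M ⟶ F.mapMat_.obj M) i j :=
  congrFun (congrFun (F.mapMat_.map_id M) i) j

theorem IsReindex.smul [Linear k D] {M N : Mat_ D} {f : M ⟶ N} {e : M.ι → N.ι}
    {φ : ∀ i, M.X i ⟶ N.X (e i)} (hf : IsReindex f e φ) (r : k) :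
    IsReindex (r • f) e (fun i => r • φ i) where
  self i := by rw [smul_apply, hf.self]
  ne i j h := by rw [smul_apply, hf.ne i j h, smul_zero]

/-- The object `U` of `D`, as a direct sum with one summand. -/
def single (U : D) : Mat_ D := ⟨PUnit, fun _ => U⟩

theorem id_single_apply (U : D) (i j : PUnit) :
    (𝟙 (single U) : single U ⟶ single U) i j = 𝟙 U :=
  Mat_.id_apply_self _ _

instance (F : D ⥤ D) [F.Additive] : F.mapMat_.Additive where
  map_add := by
    intros
    ext
    exact F.map_add

instance (F : D ⥤ D) [F.Additive] [Linear k D] [F.Linear k] : F.mapMat_.Linear k where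
  map_smul _ _ := by
    ext
    exact F.map_smul _ _

instance (F : D ⥤ D) [F.Additive] [F.Faithful] : F.mapMat_.Faithful where
  map_injective h := by
    ext i j
    exact F.map_injective (congrFun (congrFun h i) j)

instance (F : D ⥤ D) [F.Additive] [F.Full] : F.mapMat_.Full where
  map_surjective f := ⟨fun i j => F.preimage (f i j), by ext i j; exact F.map_preimage (f i j)⟩

instance (F : D ⥤ D) [F.Additive] [F.EssSurj] : F.mapMat_.EssSurj where
  mem_essImage M := ⟨⟨M.ι, fun i => F.objPreimage (M.X i)⟩,
    ⟨reindexIso (M := F.mapMat_.obj ⟨M.ι, fun i => F.objPreimage (M.X i)⟩) (N := M)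
      (Equiv.refl _) fun i => F.objObjPreimageIso (M.X i)⟩⟩

instance (F : D ⥤ D) [F.Additive] [F.IsEquivalence] : F.mapMat_.IsEquivalence where

variable [MonoidalCategory D]

theorem exists_inverse {U : D} (h : ∃ V : D, Nonempty (U ⊗ V ≅ 𝟙_ D) ∧ Nonempty (V ⊗ U ≅ 𝟙_ D)) :
    ∃ V : Mat_ D, Nonempty (single U ⊗ V ≅ 𝟙_ (Mat_ D)) ∧
      Nonempty (V ⊗ single U ≅ 𝟙_ (Mat_ D)) := by
  obtain ⟨V, ⟨e⟩, ⟨e'⟩⟩ := h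
  exact ⟨single V, ⟨reindexIso (M := single U ⊗ single V) (N := 𝟙_ (Mat_ D))
    (Equiv.prodPUnit PUnit) fun _ => e⟩, ⟨reindexIso (M := single V ⊗ single U) (N := 𝟙_ (Mat_ D))
    (Equiv.prodPUnit PUnit) fun _ => e'⟩⟩

section structural
variable (M N K : Mat_ D)

theorem isReindex_associator_hom :
    IsReindex (M := (M ⊗ N) ⊗ K) (N := M ⊗ (N ⊗ K)) (α_ M N K).hom (fun p => (p.1.1, p.1.2, p.2))
      (fun p => (α_ (M.X p.1.1) (N.X p.1.2) (K.X p.2)).hom) :=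
  isReindex_reindexHom (M := (M ⊗ N) ⊗ K) (N := M ⊗ (N ⊗ K)) (Equiv.prodAssoc _ _ _) _

theorem isReindex_associator_inv :
    IsReindex (M := M ⊗ (N ⊗ K)) (N := (M ⊗ N) ⊗ K) (α_ M N K).inv
      (fun p => ((p.1, p.2.1), p.2.2))
      (fun p => (α_ (M.X p.1) (N.X p.2.1) (K.X p.2.2)).inv) :=
  isReindex_reindexInv (M := (M ⊗ N) ⊗ K) (N := M ⊗ (N ⊗ K)) (Equiv.prodAssoc _ _ _) _
    (fun _ => rfl) (fun _ => (Category.id_comp _).symm)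

theorem isReindex_leftUnitor_hom :
    IsReindex (M := 𝟙_ (Mat_ D) ⊗ M) (λ_ M).hom (fun p => p.2) (fun p => (λ_ (M.X p.2)).hom) :=
  isReindex_reindexHom (M := 𝟙_ (Mat_ D) ⊗ M) (Equiv.punitProd _) _

theorem isReindex_leftUnitor_inv :
    IsReindex (N := 𝟙_ (Mat_ D) ⊗ M) (λ_ M).inv (fun i => (PUnit.unit, i))
      (fun i => (λ_ (M.X i)).inv) :=
  isReindex_reindexInv (M := 𝟙_ (Mat_ D) ⊗ M) (Equiv.punitProd _) _
    (fun _ => rfl) (fun _ => (Category.id_comp _).symm)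

theorem isReindex_rightUnitor_hom :
    IsReindex (M := M ⊗ 𝟙_ (Mat_ D)) (ρ_ M).hom (fun p => p.1) (fun p => (ρ_ (M.X p.1)).hom) :=
  isReindex_reindexHom (M := M ⊗ 𝟙_ (Mat_ D)) (Equiv.prodPUnit _) _

theorem isReindex_rightUnitor_inv :
    IsReindex (N := M ⊗ 𝟙_ (Mat_ D)) (ρ_ M).inv (fun i => (i, PUnit.unit))
      (fun i => (ρ_ (M.X i)).inv) :=
  isReindex_reindexInv (M := M ⊗ 𝟙_ (Mat_ D)) (Equiv.prodPUnit _) _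
    (fun _ => rfl) (fun _ => (Category.id_comp _).symm)

end structural

section monoidal
variable (F : D ⥤ D) [F.Additive] [F.Monoidal]

/-- The unit constraint of the extension of a monoidal functor to formal direct sums. -/
noncomputable def mapMatεIso : 𝟙_ (Mat_ D) ≅ F.mapMat_.obj (𝟙_ (Mat_ D)) :=
  reindexIso (M := 𝟙_ (Mat_ D)) (N := F.mapMat_.obj (𝟙_ (Mat_ D))) (Equiv.refl _)
    fun _ => Functor.Monoidal.εIso F

/-- The tensor constraint of the extension of a monoidal functor to formal direct sums. -/
noncomputable def mapMatμIso (M N : Mat_ D) :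
    F.mapMat_.obj M ⊗ F.mapMat_.obj N ≅ F.mapMat_.obj (M ⊗ N) :=
  reindexIso (M := F.mapMat_.obj M ⊗ F.mapMat_.obj N) (N := F.mapMat_.obj (M ⊗ N)) (Equiv.refl _)
    fun p => Functor.Monoidal.μIso F (M.X p.1) (N.X p.2)

theorem isReindex_mapMatμIso_hom (M N : Mat_ D) :
    IsReindex (M := F.mapMat_.obj M ⊗ F.mapMat_.obj N) (N := F.mapMat_.obj (M ⊗ N))
      (mapMatμIso F M N).hom (fun p => p) (fun p => μ F (M.X p.1) (N.X p.2)) :=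
  isReindex_reindexHom (M := F.mapMat_.obj M ⊗ F.mapMat_.obj N) (N := F.mapMat_.obj (M ⊗ N))
    (Equiv.refl _) _

theorem isReindex_mapMatεIso_hom :
    IsReindex (M := 𝟙_ (Mat_ D)) (N := F.mapMat_.obj (𝟙_ (Mat_ D))) (mapMatεIso F).hom
      (fun p => p) (fun _ => ε F) :=
  isReindex_reindexHom (M := 𝟙_ (Mat_ D)) (N := F.mapMat_.obj (𝟙_ (Mat_ D))) (Equiv.refl _) _

end monoidal

variable [MonoidalPreadditive D]

section whisker
variable {M N : Mat_ D} {f : M ⟶ N} {e : M.ι → N.ι} {φ : ∀ i, M.X i ⟶ N.X (e i)}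

theorem IsReindex.whiskerLeft (hf : IsReindex f e φ) (K : Mat_ D) :
    IsReindex (M := K ⊗ M) (N := K ⊗ N) (K ◁ f) (fun p => (p.1, e p.2))
      (fun p => K.X p.1 ◁ φ p.2) := by
  have := (isReindex_id K).tensor hf
  simp only [id_tensorHom] at this
  exact this

theorem IsReindex.whiskerRight (hf : IsReindex f e φ) (K : Mat_ D) :
    IsReindex (M := M ⊗ K) (N := N ⊗ K) (f ▷ K) (fun p => (e p.1, p.2))
      (fun p => φ p.1 ▷ K.X p.2) := by
  have := hf.tensor (isReindex_id K)
  simp only [tensorHom_id] at this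
  exact this

end whisker

section monoidal
variable (F : D ⥤ D) [F.Additive] [F.Monoidal]

/-- The extension of a monoidal functor to formal direct sums is monoidal. -/
noncomputable def mapMatCoreMonoidal : F.mapMat_.CoreMonoidal where
  εIso := mapMatεIso F
  μIso := mapMatμIso F
  -- Here `f` is an arbitrary matrix, so entries are compared one at a time. The remaining axioms
  -- involve permutation matrices only and are handled through `IsReindex`.
  μIso_hom_natural_left {M N} f K := by
    refine hom_ext_equiv (N := F.mapMat_.obj (N ⊗ K)) (Equiv.refl _) fun p q => ?_
    refine (comp_reindexHom_apply _ _ _ _ _).trans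
      (Eq.trans ?_ (reindexHom_comp_apply _ _ _ _ _).symm)
    change (F.map (f p.1 q.1) ⊗ₘ (𝟙 (F.mapMat_.obj K) : F.mapMat_.obj K ⟶ _) p.2 q.2) ≫ μ F _ _ =
      μ F _ _ ≫ F.map (f p.1 q.1 ⊗ₘ (𝟙 K : K ⟶ K) p.2 q.2)
    exact (congrArg (fun z => (F.map (f p.1 q.1) ⊗ₘ z) ≫ μ F _ _)
      (mapMat_map_id_apply F K p.2 q.2).symm).trans (μ_natural _ _ _)
  μIso_hom_natural_right {M N} K f := by
    refine hom_ext_equiv (N := F.mapMat_.obj (K ⊗ N)) (Equiv.refl _) fun p q => ?_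
    refine (comp_reindexHom_apply _ _ _ _ _).trans
      (Eq.trans ?_ (reindexHom_comp_apply _ _ _ _ _).symm)
    change ((𝟙 (F.mapMat_.obj K) : F.mapMat_.obj K ⟶ _) p.1 q.1 ⊗ₘ F.map (f p.2 q.2)) ≫ μ F _ _ =
      μ F _ _ ≫ F.map ((𝟙 K : K ⟶ K) p.1 q.1 ⊗ₘ f p.2 q.2)
    exact (congrArg (fun z => (z ⊗ₘ F.map (f p.2 q.2)) ≫ μ F _ _)
      (mapMat_map_id_apply F K p.1 q.1).symm).trans (μ_natural _ _ _)
  associativity M N K :=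
    (((isReindex_mapMatμIso_hom F M N).whiskerRight _).comp
      ((isReindex_mapMatμIso_hom F _ K).comp (isReindex_associator_hom M N K).map)).eq
    ((isReindex_associator_hom _ _ _).comp (((isReindex_mapMatμIso_hom F N K).whiskerLeft _).comp
      (isReindex_mapMatμIso_hom F M _))) fun _ => Functor.LaxMonoidal.associativity F _ _ _
  left_unitality M :=
    (isReindex_leftUnitor_hom _).eq (((isReindex_mapMatεIso_hom F).whiskerRight _).comp
      ((isReindex_mapMatμIso_hom F _ M).comp (isReindex_leftUnitor_hom M).map))
      fun _ => Functor.LaxMonoidal.left_unitality F _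
  right_unitality M :=
    (isReindex_rightUnitor_hom _).eq (((isReindex_mapMatεIso_hom F).whiskerLeft _).comp
      ((isReindex_mapMatμIso_hom F M _).comp (isReindex_rightUnitor_hom M).map))
      fun _ => Functor.LaxMonoidal.right_unitality F _

noncomputable instance : F.mapMat_.Monoidal := (mapMatCoreMonoidal F).toMonoidal

theorem isReindex_μ (M N : Mat_ D) :
    IsReindex (M := F.mapMat_.obj M ⊗ F.mapMat_.obj N) (N := F.mapMat_.obj (M ⊗ N))
      (μ F.mapMat_ M N) (fun p => p) (fun p => μ F (M.X p.1) (N.X p.2)) :=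
  isReindex_mapMatμIso_hom F M N

theorem isReindex_δ (M N : Mat_ D) :
    IsReindex (M := F.mapMat_.obj (M ⊗ N)) (N := F.mapMat_.obj M ⊗ F.mapMat_.obj N)
      (δ F.mapMat_ M N) (fun p => p) (fun p => δ F (M.X p.1) (N.X p.2)) :=
  isReindex_reindexInv (M := F.mapMat_.obj M ⊗ F.mapMat_.obj N) (N := F.mapMat_.obj (M ⊗ N))
    (Equiv.refl _) _ (fun _ => rfl) (fun _ => (Category.id_comp _).symm)

theorem isReindex_ε :
    IsReindex (M := 𝟙_ (Mat_ D)) (N := F.mapMat_.obj (𝟙_ (Mat_ D))) (ε F.mapMat_)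
      (fun p => p) (fun _ => ε F) :=
  isReindex_mapMatεIso_hom F

theorem isReindex_η :
    IsReindex (M := F.mapMat_.obj (𝟙_ (Mat_ D))) (N := 𝟙_ (Mat_ D)) (η F.mapMat_)
      (fun p => p) (fun _ => η F) :=
  isReindex_reindexInv (M := 𝟙_ (Mat_ D)) (N := F.mapMat_.obj (𝟙_ (Mat_ D)))
    (Equiv.refl _) _ (fun _ => rfl) (fun _ => (Category.id_comp _).symm)

end monoidal

end MatTensor

namespace MatTensor
open Functor.LaxMonoidal Functor.OplaxMonoidal

variable {k : Type w} [Field k] {D : Type u} [Category.{v} D] [Preadditive D]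
  [MonoidalCategory D] [MonoidalPreadditive D]

/-- The extension of a monoidal autoequivalence to formal direct sums. -/
noncomputable def autoequiv [Linear k D] (F : LinearMonoidalAutoequiv k D) :
    LinearMonoidalAutoequiv k (Mat_ D) where
  functor := F.functor.mapMat_

theorem isReindex_castIso [Linear k D] {Q : Type*} (F : Q → LinearMonoidalAutoequiv k D) {a b : Q}
    (h : a = b) (M : Mat_ D) :
    IsReindex (M := (F a).functor.mapMat_.obj M) (N := (F b).functor.mapMat_.obj M)
      ((LinearMonoidalAutoequiv.castIso (fun q => autoequiv (F q)) h).hom.app M) (fun i => i)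
      (fun i => (LinearMonoidalAutoequiv.castIso F h).hom.app (M.X i)) := by
  subst h
  exact isReindex_id _

section pseudonatural
variable {F G : D ⥤ D} [F.Additive] [G.Additive]

/-- The extension of a pseudonatural transformation to formal direct sums. -/
noncomputable def mat (T : PseudonaturalData F G) :
    PseudonaturalData F.mapMat_ G.mapMat_ where
  obj := single T.obj
  app M := reindexIso (M := F.mapMat_.obj M ⊗ single T.obj) (N := single T.obj ⊗ G.mapMat_.obj M)
    (Equiv.prodComm _ _) fun p => T.app (M.X p.1)

theorem isReindex_mat_hom (T : PseudonaturalData F G) (M : Mat_ D) :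
    IsReindex (M := F.mapMat_.obj M ⊗ single T.obj) (N := single T.obj ⊗ G.mapMat_.obj M)
      ((mat T).app M).hom (fun p => (p.2, p.1)) (fun p => (T.app (M.X p.1)).hom) :=
  isReindex_reindexHom (M := F.mapMat_.obj M ⊗ single T.obj)
    (N := single T.obj ⊗ G.mapMat_.obj M) (Equiv.prodComm _ _) _

/-- The monoidal structures on the extensions are variable, subject to having the expected entries.
For a composite, the extension of the composite and the composite of the extensions are the same
functor, and the latter's structure is the one required. -/
theorem mat_isPseudonaturalIso [F.Monoidal] [G.Monoidal] [mF : F.mapMat_.Monoidal]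
    [mG : G.mapMat_.Monoidal]
    (hF : ∀ M N : Mat_ D,
      IsReindex (M := F.mapMat_.obj M ⊗ F.mapMat_.obj N) (N := F.mapMat_.obj (M ⊗ N))
        (μ F.mapMat_ M N) (fun p => p) (fun p => μ F (M.X p.1) (N.X p.2)))
    (hF' : IsReindex (M := 𝟙_ (Mat_ D)) (N := F.mapMat_.obj (𝟙_ (Mat_ D))) (ε F.mapMat_)
      (fun p => p) (fun _ => ε F))
    (hG : ∀ M N : Mat_ D,
      IsReindex (M := G.mapMat_.obj M ⊗ G.mapMat_.obj N) (N := G.mapMat_.obj (M ⊗ N))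
        (μ G.mapMat_ M N) (fun p => p) (fun p => μ G (M.X p.1) (N.X p.2)))
    (hG' : IsReindex (M := 𝟙_ (Mat_ D)) (N := G.mapMat_.obj (𝟙_ (Mat_ D))) (ε G.mapMat_)
      (fun p => p) (fun _ => ε G))
    {T : PseudonaturalData F G} (hT : IsPseudonaturalIso T) : IsPseudonaturalIso (mat T) where
  naturality {M N} f := by
    refine hom_ext_equiv (N := single T.obj ⊗ G.mapMat_.obj N) (Equiv.prodComm N.ι PUnit)
      fun p q => ?_
    refine (comp_reindexHom_apply _ _ _ _ _).trans
      (Eq.trans ?_ (reindexHom_comp_apply _ _ _ _ _).symm)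
    change (F.map (f p.1 q.1) ⊗ₘ (𝟙 (single T.obj) : single T.obj ⟶ _) p.2 q.2) ≫
      (T.app (N.X q.1)).hom = (T.app (M.X p.1)).hom ≫
        ((𝟙 (single T.obj) : single T.obj ⟶ _) p.2 q.2 ⊗ₘ G.map (f p.1 q.1))
    exact (congrArg₂ (· ≫ ·) ((congrArg _ (id_single_apply _ _ _)).trans (tensorHom_id _ _))
      rfl).trans ((hT.naturality (f p.1 q.1)).trans (congrArg₂ (· ≫ ·) rfl
        ((id_tensorHom _ _).symm.trans
          (congrArg (· ⊗ₘ G.map (f p.1 q.1)) (id_single_apply _ p.2 q.2).symm))))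
  tensor M N :=
    (((hF M N).whiskerRight (single T.obj)).comp (isReindex_mat_hom T (M ⊗ N))).eq
      ((isReindex_associator_hom _ _ _).comp (((isReindex_mat_hom T N).whiskerLeft _).comp
        ((isReindex_associator_inv _ _ _).comp (((isReindex_mat_hom T M).whiskerRight _).comp
          ((isReindex_associator_hom _ _ _).comp ((hG M N).whiskerLeft _))))))
      fun p => hT.tensor (M.X p.1.1) (N.X p.1.2)
  unit :=
    ((hF'.whiskerRight (single T.obj)).comp (isReindex_mat_hom T (𝟙_ (Mat_ D)))).eq
      ((isReindex_leftUnitor_hom _).comp ((isReindex_rightUnitor_inv _).comp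
        (hG'.whiskerLeft _))) fun _ => hT.unit
  invertible := exists_inverse hT.invertible

end pseudonatural

end MatTensor

namespace MatTensor
open Functor.LaxMonoidal Functor.OplaxMonoidal

section composites
variable {D : Type u} [Category.{v} D] [Preadditive D] [MonoidalCategory D]
  [MonoidalPreadditive D] {M : Mat_ D}

theorem isReindex_comp {F G H : Mat_ D ⥤ Mat_ D} {S : PseudonaturalData F G}
    {T : PseudonaturalData G H} {e : (F.obj M ⊗ S.obj).ι → (S.obj ⊗ G.obj M).ι}
    {φ : ∀ p, (F.obj M ⊗ S.obj).X p ⟶ (S.obj ⊗ G.obj M).X (e p)}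
    {e' : (G.obj M ⊗ T.obj).ι → (T.obj ⊗ H.obj M).ι}
    {φ' : ∀ p, (G.obj M ⊗ T.obj).X p ⟶ (T.obj ⊗ H.obj M).X (e' p)}
    (hS : IsReindex (S.app M).hom e φ) (hT : IsReindex (T.app M).hom e' φ') :
    IsReindex (M := F.obj M ⊗ (S.obj ⊗ T.obj)) (N := (S.obj ⊗ T.obj) ⊗ H.obj M)
      ((S.comp T).app M).hom
      (fun p => (((e (p.1, p.2.1)).1, (e' ((e (p.1, p.2.1)).2, p.2.2)).1),
        (e' ((e (p.1, p.2.1)).2, p.2.2)).2))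
      (fun p => (α_ ((F.obj M).X p.1) (S.obj.X p.2.1) (T.obj.X p.2.2)).inv ≫
        φ (p.1, p.2.1) ▷ T.obj.X p.2.2 ≫ (α_ _ _ _).hom ≫
          S.obj.X (e (p.1, p.2.1)).1 ◁ φ' ((e (p.1, p.2.1)).2, p.2.2) ≫ (α_ _ _ _).inv) :=
  (isReindex_associator_inv _ _ _).comp ((hS.whiskerRight T.obj).comp
    ((isReindex_associator_hom _ _ _).comp ((hT.whiskerLeft S.obj).comp
      (isReindex_associator_inv _ _ _))))

theorem isReindex_postcomp {F G : Mat_ D ⥤ Mat_ D} {T : PseudonaturalData F G}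
    (K : D ⥤ D) [K.Additive] [K.Monoidal]
    {e : (F.obj M ⊗ T.obj).ι → (T.obj ⊗ G.obj M).ι}
    {φ : ∀ p, (F.obj M ⊗ T.obj).X p ⟶ (T.obj ⊗ G.obj M).X (e p)}
    (hT : IsReindex (T.app M).hom e φ) :
    IsReindex (M := K.mapMat_.obj (F.obj M) ⊗ K.mapMat_.obj T.obj)
      (N := K.mapMat_.obj T.obj ⊗ K.mapMat_.obj (G.obj M)) ((T.postcomp K.mapMat_).app M).hom e
      (fun p => μ K ((F.obj M).X p.1) (T.obj.X p.2) ≫ K.map (φ p) ≫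
        δ K (T.obj.X (e p).1) ((G.obj M).X (e p).2)) :=
  (isReindex_μ K _ _).comp (hT.map.comp (isReindex_δ K _ _))

theorem isReindex_congr {F F' G G' : Mat_ D ⥤ Mat_ D} {T : PseudonaturalData F G}
    {e : F ≅ F'} {e' : G ≅ G'} {i : (F.obj M ⊗ T.obj).ι → (T.obj ⊗ G.obj M).ι}
    {φ : ∀ p, (F.obj M ⊗ T.obj).X p ⟶ (T.obj ⊗ G.obj M).X (i p)}
    {j : (F'.obj M).ι → (F.obj M).ι} {ψ : ∀ p, (F'.obj M).X p ⟶ (F.obj M).X (j p)}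
    {j' : (G.obj M).ι → (G'.obj M).ι} {ψ' : ∀ p, (G.obj M).X p ⟶ (G'.obj M).X (j' p)}
    (hT : IsReindex (T.app M).hom i φ) (he : IsReindex (e.inv.app M) j ψ)
    (he' : IsReindex (e'.hom.app M) j' ψ') :
    IsReindex (M := F'.obj M ⊗ T.obj) (N := T.obj ⊗ G'.obj M) ((T.congr e e').app M).hom
      (fun p => ((i (j p.1, p.2)).1, j' (i (j p.1, p.2)).2))
      (fun p => ψ p.1 ▷ T.obj.X p.2 ≫ φ (j p.1, p.2) ≫
        T.obj.X (i (j p.1, p.2)).1 ◁ ψ' (i (j p.1, p.2)).2) :=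
  (he.whiskerRight T.obj).comp (hT.comp (he'.whiskerLeft T.obj))

end composites

end MatTensor

/-! ### Extending an anomalous action to formal direct sums -/

namespace AnomalousAction
open Functor.LaxMonoidal Functor.OplaxMonoidal MatTensor

variable {k : Type w} [Field k] {D : Type u} [Category.{v} D] [Preadditive D] [Linear k D]
  [MonoidalCategory D] [MonoidalPreadditive D] {Q : Type*} [Group Q] {π : Q → Q → Q → Q → kˣ}
  (A : AnomalousAction k π D)

/-- The extension to formal direct sums of the pseudonatural transformation `χ_{q,r}`. -/
noncomputable def matMul (q r : Q) : PseudonaturalData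
    ((autoequiv (A.aut r)).functor ⋙ (autoequiv (A.aut q)).functor)
    (autoequiv (A.aut (q * r))).functor :=
  mat (A.mul q r)

/-- The extension to formal direct sums of the unit of an anomalous action. -/
noncomputable def matOne : PseudonaturalData (𝟭 (Mat_ D)) (autoequiv (A.aut 1)).functor :=
  mat A.one

/-- The extension to formal direct sums of the modification `ω_{q,r,s}`. -/
noncomputable def matAssoc (q r s : Q) :
    (autoequiv (A.aut q)).functor.obj (A.matMul r s).obj ⊗ (A.matMul q (r * s)).obj ≅
      (A.matMul q r).obj ⊗ (A.matMul (q * r) s).obj :=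
  reindexIso (M := (autoequiv (A.aut q)).functor.obj (A.matMul r s).obj ⊗ (A.matMul q (r * s)).obj)
    (N := (A.matMul q r).obj ⊗ (A.matMul (q * r) s).obj) (Equiv.refl (PUnit × PUnit))
    fun _ => A.assoc q r s

theorem isReindex_matAssoc (q r s : Q) :
    IsReindex
      (M := (autoequiv (A.aut q)).functor.obj (A.matMul r s).obj ⊗ (A.matMul q (r * s)).obj)
      (N := (A.matMul q r).obj ⊗ (A.matMul (q * r) s).obj)
      (A.matAssoc q r s).hom (fun p => p) (fun _ => (A.assoc q r s).hom) :=
  isReindex_reindexHom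
    (M := (autoequiv (A.aut q)).functor.obj (A.matMul r s).obj ⊗ (A.matMul q (r * s)).obj)
    (N := (A.matMul q r).obj ⊗ (A.matMul (q * r) s).obj) (Equiv.refl (PUnit × PUnit)) _

theorem isReindex_matMul_hom (q r : Q) (M : Mat_ D) :
    IsReindex
      (M := (autoequiv (A.aut q)).functor.obj ((autoequiv (A.aut r)).functor.obj M) ⊗
        (A.matMul q r).obj)
      (N := (A.matMul q r).obj ⊗ (autoequiv (A.aut (q * r))).functor.obj M)
      ((A.matMul q r).app M).hom (fun p => (p.2, p.1))
      (fun p => ((A.mul q r).app (M.X p.1)).hom) :=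
  isReindex_mat_hom (A.mul q r) M

theorem isReindex_matOne_hom (M : Mat_ D) :
    IsReindex (M := M ⊗ A.matOne.obj) (N := A.matOne.obj ⊗ (autoequiv (A.aut 1)).functor.obj M)
      (A.matOne.app M).hom (fun p => (p.2, p.1)) (fun p => (A.one.app (M.X p.1)).hom) :=
  isReindex_mat_hom A.one M

theorem matMul_isPseudonaturalIso (q r : Q) : IsPseudonaturalIso (A.matMul q r) := by
  -- The structure of the composite of the two extensions is placed on the extension of the
  -- composite, since pseudonaturality is demanded for the former.
  let mF : ((A.aut r).functor ⋙ (A.aut q).functor).mapMat_.Monoidal :=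
    (inferInstance : ((A.aut r).functor.mapMat_ ⋙ (A.aut q).functor.mapMat_).Monoidal)
  have hμ : ∀ M N : Mat_ D, IsReindex
      (M := (A.aut q).functor.mapMat_.obj ((A.aut r).functor.mapMat_.obj M) ⊗
        (A.aut q).functor.mapMat_.obj ((A.aut r).functor.mapMat_.obj N))
      (N := (A.aut q).functor.mapMat_.obj ((A.aut r).functor.mapMat_.obj (M ⊗ N)))
      (mF.μ M N) (fun p => p)
      (fun p => μ ((A.aut r).functor ⋙ (A.aut q).functor) (M.X p.1) (N.X p.2)) := fun M N =>
    (isReindex_μ (A.aut q).functor _ _).comp (isReindex_μ (A.aut r).functor M N).map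
  have hε : IsReindex (M := 𝟙_ (Mat_ D))
      (N := (A.aut q).functor.mapMat_.obj ((A.aut r).functor.mapMat_.obj (𝟙_ (Mat_ D))))
      mF.ε (fun p => p) (fun _ => ε ((A.aut r).functor ⋙ (A.aut q).functor)) :=
    (isReindex_ε (A.aut q).functor).comp (isReindex_ε (A.aut r).functor).map
  exact mat_isPseudonaturalIso hμ hε (isReindex_μ _) (isReindex_ε _) (A.mul_isPseudonaturalIso q r)

theorem matOne_isPseudonaturalIso : IsPseudonaturalIso A.matOne := by
  let mF : (𝟭 D).mapMat_.Monoidal := (inferInstance : (𝟭 (Mat_ D)).Monoidal)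
  have hμ : ∀ M N : Mat_ D, IsReindex (M := M ⊗ N) (N := M ⊗ N)
      (mF.μ M N) (fun p => p) (fun p => μ (𝟭 D) (M.X p.1) (N.X p.2)) := fun M N =>
    isReindex_id (M ⊗ N)
  have hε : IsReindex (M := 𝟙_ (Mat_ D)) (N := 𝟙_ (Mat_ D)) mF.ε (fun p => p) (fun _ => ε (𝟭 D)) :=
    isReindex_id _
  exact mat_isPseudonaturalIso (F := 𝟭 D) hμ hε (isReindex_μ _) (isReindex_ε _)
    A.one_isPseudonaturalIso

theorem matAssoc_isModification (q r s : Q) :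
    IsModification
      ((((A.matMul r s).postcomp (autoequiv (A.aut q)).functor).comp (A.matMul q (r * s))).congr
        (Functor.associator (autoequiv (A.aut s)).functor (autoequiv (A.aut r)).functor
          (autoequiv (A.aut q)).functor)
        (LinearMonoidalAutoequiv.castIso (fun q => autoequiv (A.aut q)) (mul_assoc q r s).symm))
      (((A.matMul q r).precomp (autoequiv (A.aut s)).functor).comp (A.matMul (q * r) s))
      (A.matAssoc q r s) := fun M => by
  have h₁ := isReindex_postcomp (A.aut q).functor (A.isReindex_matMul_hom r s M)
  have h₂ := isReindex_comp h₁ (A.isReindex_matMul_hom q (r * s) M)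
  have h₃ := isReindex_congr (e := Functor.associator _ _ _) h₂ (isReindex_id _)
    (isReindex_castIso A.aut (mul_assoc q r s).symm M)
  have h₄ := isReindex_comp (S := (A.matMul q r).precomp (autoequiv (A.aut s)).functor)
    (A.isReindex_matMul_hom q r _) (A.isReindex_matMul_hom (q * r) s M)
  exact (((A.isReindex_matAssoc q r s).whiskerLeft _).comp h₄).eq
    (h₃.comp ((A.isReindex_matAssoc q r s).whiskerRight _))
    fun p => A.assoc_isModification q r s (M.X p.1)

/-- The extension to formal direct sums of the modification comparing `χ_{1,q}` with the
identity. -/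
noncomputable def matLeftUnit (q : Q) : A.matOne.obj ⊗ (A.matMul 1 q).obj ≅ 𝟙_ (Mat_ D) :=
  reindexIso (M := A.matOne.obj ⊗ (A.matMul 1 q).obj) (N := 𝟙_ (Mat_ D)) (Equiv.prodPUnit PUnit)
    fun _ => A.leftUnit q

/-- The extension to formal direct sums of the modification comparing `χ_{q,1}` with the
identity. -/
noncomputable def matRightUnit (q : Q) :
    (autoequiv (A.aut q)).functor.obj A.matOne.obj ⊗ (A.matMul q 1).obj ≅ 𝟙_ (Mat_ D) :=
  reindexIso (M := (autoequiv (A.aut q)).functor.obj A.matOne.obj ⊗ (A.matMul q 1).obj)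
    (N := 𝟙_ (Mat_ D)) (Equiv.prodPUnit PUnit) fun _ => A.rightUnit q

theorem isReindex_matLeftUnit (q : Q) :
    IsReindex (M := A.matOne.obj ⊗ (A.matMul 1 q).obj) (N := 𝟙_ (Mat_ D)) (A.matLeftUnit q).hom
      (fun p => p.1) (fun _ => (A.leftUnit q).hom) :=
  isReindex_reindexHom (M := A.matOne.obj ⊗ (A.matMul 1 q).obj) (N := 𝟙_ (Mat_ D))
    (Equiv.prodPUnit PUnit) _

theorem isReindex_matRightUnit (q : Q) :
    IsReindex (M := (autoequiv (A.aut q)).functor.obj A.matOne.obj ⊗ (A.matMul q 1).obj)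
      (N := 𝟙_ (Mat_ D)) (A.matRightUnit q).hom (fun p => p.1) (fun _ => (A.rightUnit q).hom) :=
  isReindex_reindexHom (M := (autoequiv (A.aut q)).functor.obj A.matOne.obj ⊗ (A.matMul q 1).obj)
    (N := 𝟙_ (Mat_ D)) (Equiv.prodPUnit PUnit) _

theorem matLeftUnit_isModification (q : Q) :
    IsModification
      (((A.matOne.precomp (autoequiv (A.aut q)).functor).comp (A.matMul 1 q)).congr
        (Functor.rightUnitor (autoequiv (A.aut q)).functor)
        (LinearMonoidalAutoequiv.castIso (fun q => autoequiv (A.aut q)) (one_mul q)))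
      (.id (autoequiv (A.aut q)).functor) (A.matLeftUnit q) := fun M => by
  have h₁ := isReindex_comp (S := A.matOne.precomp (autoequiv (A.aut q)).functor)
    (A.isReindex_matOne_hom _) (A.isReindex_matMul_hom 1 q M)
  have h₂ := isReindex_congr (e := Functor.rightUnitor _) h₁ (isReindex_id _)
    (isReindex_castIso A.aut (one_mul q) M)
  exact (((A.isReindex_matLeftUnit q).whiskerLeft _).comp
    ((isReindex_rightUnitor_hom _).comp (isReindex_leftUnitor_inv _))).eq
    (h₂.comp ((A.isReindex_matLeftUnit q).whiskerRight _))
    fun p => A.leftUnit_isModification q (M.X p.1)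

theorem matRightUnit_isModification (q : Q) :
    IsModification
      (((A.matOne.postcomp (autoequiv (A.aut q)).functor).comp (A.matMul q 1)).congr
        (Functor.leftUnitor (autoequiv (A.aut q)).functor)
        (LinearMonoidalAutoequiv.castIso (fun q => autoequiv (A.aut q)) (mul_one q)))
      (.id (autoequiv (A.aut q)).functor) (A.matRightUnit q) := fun M => by
  have h₁ := isReindex_postcomp (A.aut q).functor (A.isReindex_matOne_hom M)
  have h₂ := isReindex_comp h₁ (A.isReindex_matMul_hom q 1 M)
  have h₃ := isReindex_congr (e := Functor.leftUnitor _) h₂ (isReindex_id _)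
    (isReindex_castIso A.aut (mul_one q) M)
  exact (((A.isReindex_matRightUnit q).whiskerLeft _).comp
    ((isReindex_rightUnitor_hom _).comp (isReindex_leftUnitor_inv _))).eq
    (h₃.comp ((A.isReindex_matRightUnit q).whiskerRight _))
    fun p => A.rightUnit_isModification q (M.X p.1)

theorem isReindex_eqToHom_matMul {q r q' r' : Q} (h : (q, r) = (q', r'))
    (e : (A.matMul q r).obj = (A.matMul q' r').obj) (e' : (A.mul q r).obj = (A.mul q' r').obj) :
    IsReindex (M := (A.matMul q r).obj) (N := (A.matMul q' r').obj) (eqToHom e) (fun i => i)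
      (fun _ => eqToHom e') := by
  cases h
  exact isReindex_id _

/-- All objects `U` are single summands, so both sides have one entry and that entry is the pentagon
for homogeneous objects. -/
theorem mat_pentagon (q r s t : Q) :
    (α_ _ _ _).inv ≫
        ((μ (autoequiv (A.aut q)).functor _ _ ≫
            (autoequiv (A.aut q)).functor.map (A.matAssoc r s t).hom ≫
            δ (autoequiv (A.aut q)).functor _ _) ⊗ₘ
          eqToHom (congrArg (fun x => (A.matMul q x).obj) (mul_assoc r s t).symm)) ≫
        (α_ _ _ _).hom ≫
        (autoequiv (A.aut q)).functor.obj (A.matMul r s).obj ◁ (A.matAssoc q (r * s) t).hom ≫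
        (α_ _ _ _).inv ≫
        ((A.matAssoc q r s).hom ⊗ₘ
          eqToHom (congrArg (fun x => (A.matMul x t).obj) (mul_assoc q r s).symm)) ≫
        (α_ _ _ _).hom =
      (π q r s t : k) •
        ((autoequiv (A.aut q)).functor.obj ((autoequiv (A.aut r)).functor.obj (A.matMul s t).obj) ◁
          (A.matAssoc q r (s * t)).hom ≫
        (α_ _ _ _).inv ≫
        ((A.matMul q r).app (A.matMul s t).obj).hom ▷ (A.matMul (q * r) (s * t)).obj ≫
        (α_ _ _ _).hom ≫
        (A.matMul q r).obj ◁ (A.matAssoc (q * r) s t).hom) := by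
  have h₁ := ((isReindex_μ (A.aut q).functor _ _).comp ((A.isReindex_matAssoc r s t).map.comp
    (isReindex_δ (A.aut q).functor _ _))).tensor (A.isReindex_eqToHom_matMul (q := q) (q' := q)
      (by rw [mul_assoc]) (congrArg (fun x => (A.matMul q x).obj) (mul_assoc r s t).symm)
      (congrArg (fun x => (A.mul q x).obj) (mul_assoc r s t).symm))
  have h₂ := (A.isReindex_matAssoc q r s).tensor (A.isReindex_eqToHom_matMul (r := t) (r' := t)
      (by rw [mul_assoc]) (congrArg (fun x => (A.matMul x t).obj) (mul_assoc q r s).symm)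
      (congrArg (fun x => (A.mul x t).obj) (mul_assoc q r s).symm))
  have h₃ := (isReindex_associator_inv _ _ _).comp (h₁.comp ((isReindex_associator_hom _ _ _).comp
    (((A.isReindex_matAssoc q (r * s) t).whiskerLeft _).comp
      ((isReindex_associator_inv _ _ _).comp (h₂.comp (isReindex_associator_hom _ _ _))))))
  have h₄ := ((A.isReindex_matAssoc q r (s * t)).whiskerLeft
    ((autoequiv (A.aut q)).functor.obj ((autoequiv (A.aut r)).functor.obj (A.matMul s t).obj))).comp
    ((isReindex_associator_inv _ _ _).comp
      (((A.isReindex_matMul_hom q r (A.matMul s t).obj).whiskerRight _).comp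
        ((isReindex_associator_hom _ _ _).comp ((A.isReindex_matAssoc (q * r) s t).whiskerLeft _))))
  exact h₃.eq (h₄.smul (π q r s t : k)) fun _ => A.pentagon q r s t

theorem mat_triangle (q r : Q) :
    (α_ _ _ _).inv ≫
        (μ (autoequiv (A.aut q)).functor _ _ ≫
          (autoequiv (A.aut q)).functor.map (A.matLeftUnit r).hom ≫
          η (autoequiv (A.aut q)).functor) ▷ (A.matMul q (1 * r)).obj ≫
        (λ_ _).hom ≫
        eqToHom (congrArg (fun x => (A.matMul q x).obj) (one_mul r)) =
      (autoequiv (A.aut q)).functor.obj A.matOne.obj ◁ (A.matAssoc q 1 r).hom ≫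
        (α_ _ _ _).inv ≫
        (A.matRightUnit q).hom ▷ (A.matMul (q * 1) r).obj ≫
        (λ_ _).hom ≫
        eqToHom (congrArg (fun x => (A.matMul x r).obj) (mul_one q)) := by
  have h₁ := (isReindex_μ (A.aut q).functor _ _).comp ((A.isReindex_matLeftUnit r).map.comp
    (isReindex_η (A.aut q).functor))
  have h₂ := (isReindex_associator_inv _ _ _).comp ((h₁.whiskerRight
    (A.matMul q (1 * r)).obj).comp ((isReindex_leftUnitor_hom _).comp
      (A.isReindex_eqToHom_matMul (q := q) (q' := q) (by rw [one_mul])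
        (congrArg (fun x => (A.matMul q x).obj) (one_mul r))
        (congrArg (fun x => (A.mul q x).obj) (one_mul r)))))
  have h₃ := ((A.isReindex_matAssoc q 1 r).whiskerLeft
    ((autoequiv (A.aut q)).functor.obj A.matOne.obj)).comp ((isReindex_associator_inv _ _ _).comp
      (((A.isReindex_matRightUnit q).whiskerRight (A.matMul (q * 1) r).obj).comp
        ((isReindex_leftUnitor_hom _).comp
          (A.isReindex_eqToHom_matMul (r := r) (r' := r) (by rw [mul_one])
            (congrArg (fun x => (A.matMul x r).obj) (mul_one q))
            (congrArg (fun x => (A.mul x r).obj) (mul_one q))))))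
  exact h₂.eq h₃ fun _ => A.triangle q r

/-- The extension of an anomalous action to formal direct sums. -/
noncomputable def toMat : AnomalousAction k π (Mat_ D) where
  aut q := autoequiv (A.aut q)
  mul := A.matMul
  mul_isPseudonaturalIso := A.matMul_isPseudonaturalIso
  one := A.matOne
  one_isPseudonaturalIso := A.matOne_isPseudonaturalIso
  assoc := A.matAssoc
  assoc_isModification := A.matAssoc_isModification
  leftUnit := A.matLeftUnit
  leftUnit_isModification := A.matLeftUnit_isModification
  rightUnit := A.matRightUnit
  rightUnit_isModification := A.matRightUnit_isModification
  pentagon := A.mat_pentagon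
  triangle := A.mat_triangle

end AnomalousAction

/-! ### Assembling the datum for the kernel of a surjection from a free group -/

/-- An isomorphism onto a normal subgroup is a normal embedding. -/
noncomputable def NormalEmbedding.ofMulEquiv {G N : Type*} [Group G] [Group N] {K : Subgroup G}
    [K.Normal] (e : N ≃* K) : NormalEmbedding (K.subtype.comp e.toMonoidHom) where
  injective := K.subtype_injective.comp e.injective
  conj g := (e.trans (MulAut.conjNormal g)).trans e.symm
  conj_spec g σ := by simp

/-- The scalars found on the kernel are carried to `N` along `e`. On all of the free group `β` is
only a function; the datum restricts it to the kernel, where it is multiplicative. -/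
theorem NormalEmbedding.nonempty_anomalyDatum {α N Q M : Type*} [Group N] [Group Q] [CommGroup M]
    (ρ : FreeGroup α →* Q) (hρ : Function.Surjective ρ) (e : N ≃* ρ.ker)
    {π : Q → Q → Q → Q → M} (hπ : IsNormalizedCocycle₄ π) :
    Nonempty ((NormalEmbedding.ofMulEquiv e).AnomalyDatum π) := by
  classical
  obtain ⟨s₀, hs₀⟩ := hρ.hasRightInverse
  -- Any set-theoretic section may be corrected at one point; `s 1 = 1` is needed for the unit
  -- transformation and for trivial factor sets at `1`.
  let s := Function.update s₀ 1 1
  have hs : ∀ q, ρ (s q) = q := fun q => by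
    by_cases h : q = 1
    · simp [s, h]
    · simp [s, h, hs₀ q]
  have s_one : s 1 = 1 := by simp [s]
  obtain ⟨β, γ, h₁, h₂, h₃, h₄, h₅, h₆⟩ := exists_characters_of_cocycle ρ s hs hπ
  have hker : ∀ σ : N, ρ (e σ) = 1 := fun σ => (e σ).2
  have hu : ∀ q r, s q * s r * (s (q * r))⁻¹ ∈ ρ.ker := fun q r => by
    simp [MonoidHom.mem_ker, hs]
  exact ⟨{
    s := s
    s_one := s_one
    u q r := e.symm ⟨_, hu q r⟩
    u_spec q r := by simp
    β q r σ := β q r (e σ)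
    β_mul q r σ τ := by simp [h₁ q r _ _ (hker σ)]
    β_cocycle q r t σ := by
      rw [h₂ q r t _ (hker σ)]
      simp [NormalEmbedding.ofMulEquiv]
    β_one_left q σ := h₄ _ _
    β_one_right q σ := h₅ _ _
    γ := γ
    γ_one := h₆
    cocycle q r x y := by
      rw [h₃]
      simp }⟩

theorem mainTheorem2 {k : Type w} [Field k] {Q : Type*} [Group Q] [Finite Q] (n : ℕ) (hn : 1 < n)
    (ρ : FreeGroup (Fin n) →* Q) (hρ : Function.Surjective ρ)
    {C : Type u} [Category.{v} C] [Preadditive C] [Linear k C] [MonoidalCategory C]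
    [MonoidalPreadditive C] [MonoidalLinear k C] (A : TensorAction k (FreeGroup (Fin n)) C)
    (π : Q → Q → Q → Q → kˣ) (hπ : IsNormalizedCocycle₄ π) :
    Nonempty (FreeGroup (Fin (Nat.card Q * (n - 1) + 1)) ≃* ρ.ker) ∧
      ∀ e : FreeGroup (Fin (Nat.card Q * (n - 1) + 1)) ≃* ρ.ker,
        Nonempty (AnomalousAction k π
          (CrossedProduct (A.restrict (ρ.ker.subtype.comp e.toMonoidHom)))) := by
  refine ⟨nonempty_freeGroup_mulEquiv_ker (Nat.zero_lt_of_lt hn) ρ hρ, fun e => ?_⟩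
  obtain ⟨T⟩ := NormalEmbedding.nonempty_anomalyDatum ρ hρ e hπ
  exact ⟨(T.action A).toMat⟩
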